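/- **Conventions.** A *pseudo-distribution of degree $D$* over $\mathbb R^d$ is a finitely supported function $\mu:\mathbb R^d\to\mathbb R$ such that, with $\tilde{\mathbb E}_\mu F=\sum_{x\in\operatorname{supp}\mu}\mu(x)F(x)$, we have $\tilde{\mathbb E}_\mu 1=1$ and $\tilde{\mathbb E}_\mu f^2\ge 0$ for every real polynomial $f$ with $\deg f\le D/2$. It is *over the unit ball* if moreover $\tilde{\mathbb E}_\mu(1-\|x\|^2)f^2\ge 0$ for every $f$ with $2+2\deg f\le D$. A *degree-$k$ reweighting* of a distribution or pseudo-distribution $\mu$ is $\mu'=p\cdot\mu$, where $p$ is a sum of squares of real polynomials, $\deg p\le k$ and $\mathbb E_\mu p=1$ (for pseudo-distributions, $\mathbb E$ means $\tilde{\mathbb E}$). Running time is measured on a deterministic random access machine with exact real arithmetic ($+,-,\times,/$ and comparison of reals; constants, sum, truncated difference, comparison and indirect addressing for natural numbers; unit cost per instruction). Its input is $d$, $k$, $\delta$ and the table of the moments $\mathbb E_\mu x^\alpha$, $|\alpha|\le k+2$; its output is the table of the coefficients of $p$. **Lemma (Subspace Fixing Reweighting).** There are an absolute constant $K$ and one program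 $P$ such that for every $C\ge 1$ and $\delta>0$ there is $C'\in\mathbb N$ with the following property. Let $d\ge 3$ and $k=\lfloor \frac d\delta(\log d)^{C'}\rfloor$. Let $\mu$ be a Borel probability distribution over the unit ball $\{x:\|x\|\le 1\}$ of $\mathbb R^d$, or a pseudo-distribution over this unit ball of degree $D\ge k+2$, with $\mathbb E_\mu\|x\|^2\ge d^{-C}$. Then there is a degree-$k$ reweighting $\mu'=p\cdot\mu$ of $\mu$ with $$\bigl\|\mathbb E_{\mu'}x\bigr\|^2\ \ge\ (1-\delta)\,\mathbb E_\mu\|x\|^2 .$$ Here $\mu'$ is a probability distribution if $\mu$ is one, and a pseudo-distribution of degree $D-k$ over the unit ball if $\mu$ is a pseudo-distribution of degree $D$. Further: 1. $P$ finds all the coefficients of $p$ in at most $2^{Kk}$ steps. 2. All coefficients of $p$ in the monomial basis are at most $2^{Kk}$ in absolute value. 3. There are a unit vector $v$, a number $\ell\in\mathbb N$ and a univariate sum of squares $q$ with $2\ell+\deg q\le k$ such that $p(x)=\langle v,x\rangle^{2\ell}\,q(\langle v,x\rangle)$ and, for all $x\in\mathbb R^d$, $$p(x)\le k^{Kk}\,\|x\|^{2\ell}\max(1,\|x\|)^{k-2\ell},$$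 in particular $p(x)\le k^{Kk}\|x\|^k$ whenever $\|x\|\ge 1$. Moreover $\mathbb E_\mu\langle v,x\rangle^{2\ell}>0$, and the polynomial $h(x)=\langle v,x\rangle^{2\ell}/\mathbb E_\mu\langle v,x\rangle^{2\ell}$ satisfies $h(x)\le k^{Kk}\|x\|^{2\ell}$ for all $x\in\mathbb R^d$ and $\mathbb E_\mu\bigl[h(x)\langle v,x\rangle^2\bigr]\ge(1-\delta)\,\mathbb E_\mu\|x\|^2$. -/

import Mathlib

namespace SubspaceFixing

open MvPolynomial

noncomputable section

/-! ### Pseudo-distributions -/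

/-- `ℝ^d` with its Euclidean norm. -/
abbrev Vec (d : ℕ) : Type := EuclideanSpace ℝ (Fin d)

/-- The value of a polynomial in `d` variables at a point of `ℝ^d`. -/
def evalAt {d : ℕ} (f : MvPolynomial (Fin d) ℝ) (x : Vec d) : ℝ :=
  MvPolynomial.eval (fun i => x i) f

/-- The pseudo-expectation `∑_{x ∈ supp μ} μ(x) F(x)` of a scalar- or vector-valued function `F`
with respect to a finitely supported function `μ : ℝ^d → ℝ`. -/
def pseudoExp {d : ℕ} {V : Type*} [AddCommGroup V] [Module ℝ V] (μ : Vec d →₀ ℝ)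
    (F : Vec d → V) : V :=
  ∑ x ∈ μ.support, μ x • F x

/-- `μ` is a pseudo-distribution of degree `D` over `ℝ^d`. -/
def IsPseudoDistribution {d : ℕ} (D : ℕ) (μ : Vec d →₀ ℝ) : Prop :=
  pseudoExp μ (fun _ => (1 : ℝ)) = 1 ∧
    ∀ f : MvPolynomial (Fin d) ℝ, 2 * f.totalDegree ≤ D →
      0 ≤ pseudoExp μ (fun x => evalAt f x ^ 2)

/-- The pseudo-distribution `μ` of degree `D` satisfies the constraint `q ≥ 0`. -/
def SatisfiesNonneg {d : ℕ} (D : ℕ) (μ : Vec d →₀ ℝ) (q : MvPolynomial (Fin d) ℝ) : Prop :=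
  ∀ f : MvPolynomial (Fin d) ℝ, q.totalDegree + 2 * f.totalDegree ≤ D →
    0 ≤ pseudoExp μ (fun x => evalAt q x * evalAt f x ^ 2)

/-- `μ` is a pseudo-distribution of degree `D` over the unit ball: it satisfies
`1 - ∑ᵢ xᵢ² ≥ 0`. -/
def IsPseudoDistributionOnBall {d : ℕ} (D : ℕ) (μ : Vec d →₀ ℝ) : Prop :=
  IsPseudoDistribution D μ ∧ SatisfiesNonneg D μ (1 - ∑ i, X i ^ 2)

/-- The pointwise product `p · μ`. -/
def reweight {d : ℕ} (p : MvPolynomial (Fin d) ℝ) (μ : Vec d →₀ ℝ) : Vec d →₀ ℝ :=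
  Finsupp.onFinset μ.support (fun x => evalAt p x * μ x) (by
    intro x hx
    exact Finsupp.mem_support_iff.mpr (right_ne_zero_of_mul hx))

/-- The measure with density `p` with respect to `μ`. -/
def reweightMeasure {d : ℕ} (p : MvPolynomial (Fin d) ℝ) (μ : MeasureTheory.Measure (Vec d)) :
    MeasureTheory.Measure (Vec d) :=
  μ.withDensity (fun x => ENNReal.ofReal (evalAt p x))

/-! ### A real random access machine

Programs work on four banks of memory: natural numbers (used for counting and for addresses), real
numbers, a read-only bank of real inputs and a bank of real outputs. Every instruction and every
test costs one step. Real arithmetic is exact; the instructions on natural numbers are the usual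
ones of a random access machine: constants, sum, truncated difference and indirect addressing. -/

/-- A memory state. -/
structure State where
  nat : ℕ → ℕ
  real : ℕ → ℝ
  input : ℕ → ℝ
  output : ℕ → ℝ

/-- The elementary instructions. -/
inductive Instr where
  | natConst (i c : ℕ)
  | natAdd (i j l : ℕ)
  | natSub (i j l : ℕ)
  | natLoad (i j : ℕ)
  | natStore (i j : ℕ)
  | realConst (i : ℕ) (c : ℤ)
  | realAdd (i j l : ℕ)
  | realSub (i j l : ℕ)
  | realMul (i j l : ℕ)
  | realDiv (i j l : ℕ)
  | realLoad (i j : ℕ)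
  | realStore (i j : ℕ)
  | read (i j : ℕ)
  | write (i j : ℕ)

/-- The effect of an instruction. (A division by zero returns zero.) -/
def Instr.apply : Instr → State → State
  | .natConst i c, s => { s with nat := Function.update s.nat i c }
  | .natAdd i j l, s => { s with nat := Function.update s.nat i (s.nat j + s.nat l) }
  | .natSub i j l, s => { s with nat := Function.update s.nat i (s.nat j - s.nat l) }
  | .natLoad i j, s => { s with nat := Function.update s.nat i (s.nat (s.nat j)) }
  | .natStore i j, s => { s with nat := Function.update s.nat (s.nat i) (s.nat j) }
  | .realConst i c, s => { s with real := Function.update s.real i (c : ℝ) }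
  | .realAdd i j l, s => { s with real := Function.update s.real i (s.real j + s.real l) }
  | .realSub i j l, s => { s with real := Function.update s.real i (s.real j - s.real l) }
  | .realMul i j l, s => { s with real := Function.update s.real i (s.real j * s.real l) }
  | .realDiv i j l, s => { s with real := Function.update s.real i (s.real j / s.real l) }
  | .realLoad i j, s => { s with real := Function.update s.real i (s.real (s.nat j)) }
  | .realStore i j, s => { s with real := Function.update s.real (s.nat i) (s.real j) }
  | .read i j, s => { s with real := Function.update s.real i (s.input (s.nat j)) }
  | .write i j, s => { s with output := Function.update s.output (s.nat i) (s.real j) }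

/-- The tests: comparison of two natural numbers or of two real numbers. -/
inductive Test where
  | natLt (i j : ℕ)
  | realLt (i j : ℕ)

/-- When a test succeeds. -/
def Test.holds : Test → State → Prop
  | .natLt i j, s => s.nat i < s.nat j
  | .realLt i j, s => s.real i < s.real j

/-- Programs: instructions, sequential composition, branching and `while` loops. -/
inductive Program where
  | instr (a : Instr)
  | seq (P Q : Program)
  | branch (b : Test) (P Q : Program)
  | loop (b : Test) (P : Program)

/-- `Runs P s t s'`: started in the state `s`, the program `P` halts after exactly `t` steps in the
state `s'`. -/
inductive Runs : Program → State → ℕ → State → Prop where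
  | instr (a : Instr) (s : State) : Runs (.instr a) s 1 (a.apply s)
  | seq {P Q : Program} {s s' s'' : State} {t t' : ℕ} :
      Runs P s t s' → Runs Q s' t' s'' → Runs (.seq P Q) s (t + t') s''
  | branch_true {b : Test} {P Q : Program} {s s' : State} {t : ℕ} :
      b.holds s → Runs P s t s' → Runs (.branch b P Q) s (t + 1) s'
  | branch_false {b : Test} {P Q : Program} {s s' : State} {t : ℕ} :
      ¬ b.holds s → Runs Q s t s' → Runs (.branch b P Q) s (t + 1) s'
  | loop_done {b : Test} {P : Program} {s : State} :
      ¬ b.holds s → Runs (.loop b P) s 1 s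
  | loop_step {b : Test} {P : Program} {s s' s'' : State} {t t' : ℕ} :
      b.holds s → Runs P s t s' → Runs (.loop b P) s' t' s'' →
        Runs (.loop b P) s (t + t' + 1) s''

/-- The exponent vector with number `a`: its entries are the `d` lowest digits of `a` in
base `k + 3`. Every monomial of degree at most `k + 2` has exactly one number `a < (k + 3) ^ d`. -/
def exponent (d k a : ℕ) : Fin d →₀ ℕ :=
  Finsupp.equivFunOnFinite.symm (fun i => a / (k + 3) ^ (i : ℕ) % (k + 3))

/-- The initial state for the dimension `d`, the degree `k`, the accuracy `δ` and the expectation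
functional `E`: the natural number cells hold `d, k, 0, 0, …`, the input bank holds `δ`, followed
by the table of the moments of degree at most `k + 2` (entries of higher degree are blank). -/
def initialState (d k : ℕ) (δ : ℝ) (E : (Vec d → ℝ) → ℝ) : State where
  nat := fun a => if a = 0 then d else if a = 1 then k else 0
  real := fun _ => 0
  input := fun a =>
    if a = 0 then δ
    else if (exponent d k (a - 1)).degree ≤ k + 2 then
      E (evalAt (monomial (exponent d k (a - 1)) 1))
    else 0
  output := fun _ => 0

/-- Given the moments of degree at most `k + 2`, the program `P` writes down all coefficients of
`p` within `T` steps. -/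
def FindsWithin (P : Program) (T d k : ℕ) (δ : ℝ) (E : (Vec d → ℝ) → ℝ)
    (p : MvPolynomial (Fin d) ℝ) : Prop :=
  ∃ t : ℕ, t ≤ T ∧ ∃ s : State, Runs P (initialState d k δ E) t s ∧
    ∀ a < (k + 3) ^ d, s.output a = p.coeff (exponent d k a)

/-! ### The reweighting polynomial -/

/-- `p` is the polynomial of a degree-`k` reweighting of the (pseudo-)distribution with
(pseudo-)expectation `E`. -/
def IsReweightingPoly {d : ℕ} (k : ℕ) (E : (Vec d → ℝ) → ℝ) (p : MvPolynomial (Fin d) ℝ) : Prop :=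
  IsSumSq p ∧ p.totalDegree ≤ k ∧ E (evalAt p) = 1

/-- The linear form `⟨v, x⟩` as a polynomial in `x`. -/
def linForm {d : ℕ} (v : Vec d) : MvPolynomial (Fin d) ℝ :=
  ∑ i, C (v i) * X i

/-- Shape and size of the reweighting polynomial. For a unit vector `v`, a number `l` and a
univariate sum of squares `q`, it is `p = ⟨v,x⟩^(2l) q(⟨v,x⟩)`, where the homogeneous factor
`⟨v,x⟩^(2l)`, once normalized, is at most `k^(Kk) ‖x‖^(2l)` and is itself a reweighting under which
`⟨v,x⟩²` has expectation at least `(1 - δ) E‖x‖²`. -/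
def HasFixingShape {d : ℕ} (K k : ℕ) (δ : ℝ) (E : (Vec d → ℝ) → ℝ)
    (p : MvPolynomial (Fin d) ℝ) : Prop :=
  ∃ (v : Vec d) (l : ℕ) (q : Polynomial ℝ),
    ‖v‖ = 1 ∧ IsSumSq q ∧ 2 * l + q.natDegree ≤ k ∧
    p = linForm v ^ (2 * l) * Polynomial.aeval (linForm v) q ∧
    0 < E (fun x => inner ℝ v x ^ (2 * l)) ∧
    (∀ x : Vec d, inner ℝ v x ^ (2 * l) / E (fun y => inner ℝ v y ^ (2 * l)) ≤
      (k : ℝ) ^ (K * k) * ‖x‖ ^ (2 * l)) ∧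
    (1 - δ) * E (fun x => ‖x‖ ^ 2) ≤
      E (fun x => inner ℝ v x ^ (2 * l) * inner ℝ v x ^ 2) / E (fun x => inner ℝ v x ^ (2 * l)) ∧
    ∀ x : Vec d, evalAt p x ≤
      (k : ℝ) ^ (K * k) * (‖x‖ ^ (2 * l) * max 1 ‖x‖ ^ (k - 2 * l))

end

end SubspaceFixing

namespace SubspaceFixing

open MvPolynomial

/-! ### Total correctness with time bounds -/

/-! Let `L` be the (pseudo-)expectation on polynomials, `M = L(‖x‖²)`, `u = ∑ w i x i` and `W = ∑ w
i²`. Distributions and pseudo-distributions are treated together: the argument uses only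
nonnegativity of `L` on squares and on `(1 - ‖x‖²)` times squares, in degree at most `k + 2`
(`BallFunctional`). The reweighting is a multiple of the single square `u ^ (2l) (a + u)²`.

A direction with a large moment (`exists_large_moment`). By log-convexity `L(‖x‖^(2n)) ≥ M^n`.
Expanding into monomials `x^(2α)`, one `α` carries the share `(2n+1)^(-d)` or more. Taking `|w i|`
close to `N0 √(α i / n)` and averaging over the signs of the `w i` gives `L(u^(2n)) ≥ N0^(2n) M^n /
(2n+1)^(2d)`. For `n` well above `d log n` this is at least `T^n` with `T = (1 - 2γ) M W`.

Stationarity. The sequence `f j = L(u^(2j))` is log-convex. Hence `f n ≥ T^n` forces every ratio `f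
(j+1) / f j` with `j ≥ n` to be at least `T` (`mul_le_of_pow_le`), while the ball constraint bounds
it by `W`. The ratio cannot grow by a factor `1 + γ²` at each of `J` consecutive steps, so at some
`l` it is almost stationary (`exists_stationary`). After reweighting by `u^(2l)`, the variable `u²`
is then concentrated near `r² = f (l+1) / f l ≥ T`.

Fixing the sign. Now `u` is close to `r` or to `-r`. After replacing `w` by `-w` if necessary, the
odd moment is nonnegative, and the factor `(a + u)²` with `a` close to `r` suppresses the part near
`-r` (`third_moment`, `tilt_inequality`). The mean of `u` becomes at least `(1 - γ) r`, so the
squared mean along `v = w / √W` is at least `(1 - γ)² (1 - 2γ) M ≥ (1 - δ) M` (`exists_good`).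

The algorithm. All `w i` and `a` can be taken to be integers of absolute value at most `N =
2^(k/d)`, so there are `2^O(k)` candidates `(w, a, l)`. The program runs through them, computes the
moments from tables of coefficients obtained by Kronecker substitution, and stops at the first
candidate passing a test equivalent to `Good` (`accept_iff_good`, `halts_searchProg`). Every
candidate that passes has all the required properties (`good_reweighting`), so it does not matter
which one is found. The size clause of the test bounds the coefficients and the values of the
polynomial. The conditions on `n`, `J`, `N0` are met once `k / d` is a large multiple of `(log d)²`
(`exists_parameters`); the time bound is `totalTime_le_two_pow`. -/

/-- Started in `s`, the program halts within `T` steps in a state satisfying `Q`. -/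
def Halts (P : Program) (T : ℕ) (s : State) (Q : State → Prop) : Prop :=
  ∃ t ≤ T, ∃ s', Runs P s t s' ∧ Q s'

theorem Halts.mono {P : Program} {T T' : ℕ} {s : State} {Q Q' : State → Prop}
    (h : Halts P T s Q) (hT : T ≤ T') (hQ : ∀ s', Q s' → Q' s') : Halts P T' s Q' := by
  obtain ⟨t, ht, s', hr, hq⟩ := h
  exact ⟨t, ht.trans hT, s', hr, hQ _ hq⟩

theorem Halts.seq {P P' : Program} {T T' : ℕ} {s : State} {Q R : State → Prop}
    (h : Halts P T s Q) (h' : ∀ s', Q s' → Halts P' T' s' R) :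
    Halts (.seq P P') (T + T') s R := by
  obtain ⟨t, ht, s', hr, hq⟩ := h
  obtain ⟨t', ht', s'', hr', hq'⟩ := h' s' hq
  exact ⟨t + t', by omega, s'', .seq hr hr', hq'⟩

theorem Halts.branch {b : Test} {P P' : Program} {T : ℕ} {s : State} {Q : State → Prop}
    (h : b.holds s → Halts P T s Q) (h' : ¬ b.holds s → Halts P' T s Q) :
    Halts (.branch b P P') (T + 1) s Q := by
  by_cases hb : b.holds s
  · obtain ⟨t, ht, s', hr, hq⟩ := h hb
    exact ⟨t + 1, by omega, s', .branch_true hb hr, hq⟩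
  · obtain ⟨t, ht, s', hr, hq⟩ := h' hb
    exact ⟨t + 1, by omega, s', .branch_false hb hr, hq⟩

/-- A loop with exactly `m - j` remaining rounds. -/
theorem Halts.loop {b : Test} {P : Program} {T m : ℕ} (I : ℕ → State → Prop)
    (hend : ∀ s, I m s → ¬ b.holds s)
    (hstep : ∀ j s, j < m → I j s → b.holds s ∧ Halts P T s (I (j + 1)))
    (n : ℕ) {j : ℕ} {s : State} (hj : j + n = m) (h : I j s) :
    Halts (.loop b P) (n * (T + 1) + 1) s (I m) := by
  induction n generalizing j s with
  | zero =>
    obtain rfl : j = m := by omega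
    exact ⟨1, by omega, s, .loop_done (hend s h), h⟩
  | succ n ih =>
    obtain ⟨hb, t, ht, s', hr, hq⟩ := hstep j s (by omega) h
    obtain ⟨t', ht', s'', hr', hq'⟩ := ih (by omega) hq
    exact ⟨t + t' + 1, by ring_nf; ring_nf at ht'; omega, s'', .loop_step hb hr hr', hq'⟩

/-- Straight-line programs. -/
def block (a : Instr) : List Instr → Program
  | [] => .instr a
  | b :: l => .seq (.instr a) (block b l)

theorem halts_block (a : Instr) (l : List Instr) (s : State) (Q : State → Prop)
    (h : Q ((a :: l).foldl (fun s b => b.apply s) s)) :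
    Halts (block a l) (l.length + 1) s Q := by
  induction l generalizing a s with
  | nil => exact ⟨1, le_rfl, _, .instr a s, h⟩
  | cons b l ih =>
    have := ih b (a.apply s) h
    have h1 : Halts (.instr a) 1 s (fun s' => s' = a.apply s) := ⟨1, le_rfl, _, .instr a s, rfl⟩
    refine (h1.seq (T' := l.length + 1) (R := Q) ?_).mono (by simp; omega) (fun _ h => h)
    rintro _ rfl
    exact this

theorem halts_block_seq {P : Program} {T : ℕ} (a : Instr) (l : List Instr) (s : State)
    (Q : State → Prop) (h : Halts P T ((a :: l).foldl (fun s b => b.apply s) s) Q) :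
    Halts (.seq (block a l) P) (l.length + 1 + T) s Q :=
  (halts_block a l s _ h).seq fun _ h => h

/-- Running `P` with the counter in cell `i` going from `0` to the content of cell `n`. The cell
`2` has to hold the number one. -/
def forLoop (i n : ℕ) (P : Program) : Program :=
  .seq (.instr (.natConst i 0)) (.loop (.natLt i n) (.seq P (.instr (.natAdd i i 2))))

/-- The invariant `I j` describes the state just before the test of round `j`, so the step
hypothesis includes the increment of the counter. A round costs `T` steps, one for the test and one
for the increment; the remaining `2` are the initialization and the last test. -/
theorem halts_forLoop {i n m T : ℕ} {P : Program} (I : ℕ → State → Prop)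
    (hI : ∀ j s, I j s → s.nat i = j ∧ s.nat n = m)
    (hstep : ∀ j s, j < m → I j s →
      Halts P T s (fun s' => I (j + 1) ((Instr.natAdd i i 2).apply s')))
    {s : State} (h : I 0 ((Instr.natConst i 0).apply s)) :
    Halts (forLoop i n P) (m * (T + 2) + 2) s (I m) := by
  have h1 : Halts (.instr (.natConst i 0)) 1 s (I 0) := ⟨1, le_rfl, _, .instr _ s, h⟩
  refine (h1.seq (T' := m * (T + 1 + 1) + 1) (R := I m) ?_).mono (le_of_eq (by ring)) (fun _ h => h)
  intro s' hs'
  refine Halts.loop (T := T + 1) (m := m) I ?_ ?_ m (by omega) hs'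
  · intro s hs
    have := hI _ _ hs
    simp [Test.holds, this.1, this.2]
  · intro j s hj hs
    have := hI _ _ hs
    refine ⟨by simp [Test.holds, this.1, this.2, hj], ?_⟩
    refine (hstep j s hj hs).seq ?_
    intro s' h'
    exact ⟨1, le_rfl, _, .instr _ s', h'⟩

/-! ### Multiplying a table of coefficients by an affine form -/

/-- The table of coefficients of `(A + ∑ i, w i * z ^ (b ^ i)) * f`, where `f` is the power series
in `z` with the given table of coefficients. -/
noncomputable def stepTab (d b : ℕ) (w : ℕ → ℝ) (A : ℝ) (f : ℕ → ℝ) (x : ℕ) : ℝ :=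
  A * f x + ∑ i ∈ Finset.range d, if x < b ^ i then 0 else w i * f (x - b ^ i)

/-- The pairing of a table with the table of moments. -/
def pair (M : ℕ) (inp f : ℕ → ℝ) : ℝ := ∑ x ∈ Finset.range M, f x * inp (x + 1)

/-! ### Memory layout and the cells left unchanged by a program -/

/-- The constants kept in memory. -/
structure Env (d k N : ℕ) (cM : ℝ) (inp : ℕ → ℝ) (s : State) : Prop where
  n0 : s.nat 0 = d
  n1 : s.nat 1 = k
  n2 : s.nat 2 = 1
  n3 : s.nat 3 = k + 3
  n4 : s.nat 4 = (k + 3) ^ d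
  n6 : s.nat 6 = 2 * N + 1
  n7 : s.nat 7 = 0
  n10 : s.nat 10 = d + 2
  n11 : s.nat 11 = 100
  n12 : s.nat 12 = 102 + d
  pow : ∀ i, i ≤ d → s.nat (100 + i) = (k + 3) ^ i
  r0 : s.real 0 = 2 ^ k
  r1 : s.real 1 = cM
  r2 : s.real 2 = d
  r3 : s.real 3 = -N
  r4 : s.real 4 = 1
  r5 : s.real 5 = 0
  inp : s.input = inp

/-- The states agree except for the cells `a, …, b - 1`, the real cells from `e` on and the output. -/
structure Frame (e a b : ℕ) (s s' : State) : Prop where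
  nat : ∀ r, r < a ∨ b ≤ r → s'.nat r = s.nat r
  real : ∀ r, r < e → r < a ∨ b ≤ r → s'.real r = s.real r
  input : s'.input = s.input

theorem Frame.refl (e a b : ℕ) (s : State) : Frame e a b s s :=
  ⟨fun _ _ => rfl, fun _ _ _ => rfl, rfl⟩

theorem Frame.trans {e a b : ℕ} {s s' s'' : State} (h : Frame e a b s s')
    (h' : Frame e a b s' s'') : Frame e a b s s'' :=
  ⟨fun r hr => (h'.nat r hr).trans (h.nat r hr),
    fun r hr hr' => (h'.real r hr hr').trans (h.real r hr hr'), h'.input.trans h.input⟩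

theorem Frame.widen {e a b a' b' : ℕ} {s s' : State} (h : Frame e a b s s') (ha : a' ≤ a)
    (hb : b ≤ b') : Frame e a' b' s s' :=
  ⟨fun r hr => h.nat r (by omega), fun r hr hr' => h.real r hr (by omega), h.input⟩

theorem Env.frame {d k N e a b : ℕ} {cM : ℝ} {inp : ℕ → ℝ} {s s' : State}
    (h : Env d k N cM inp s) (hf : Frame e a b s s') (he : 100 ≤ e) (ha : 13 ≤ a) (hb : b ≤ 100) :
    Env d k N cM inp s' where
  n0 := (hf.nat _ (by omega)).trans h.n0
  n1 := (hf.nat _ (by omega)).trans h.n1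
  n2 := (hf.nat _ (by omega)).trans h.n2
  n3 := (hf.nat _ (by omega)).trans h.n3
  n4 := (hf.nat _ (by omega)).trans h.n4
  n6 := (hf.nat _ (by omega)).trans h.n6
  n7 := (hf.nat _ (by omega)).trans h.n7
  n10 := (hf.nat _ (by omega)).trans h.n10
  n11 := (hf.nat _ (by omega)).trans h.n11
  n12 := (hf.nat _ (by omega)).trans h.n12
  pow i hi := (hf.nat _ (by omega)).trans (h.pow i hi)
  r0 := (hf.real _ (by omega) (by omega)).trans h.r0
  r1 := (hf.real _ (by omega) (by omega)).trans h.r1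
  r2 := (hf.real _ (by omega) (by omega)).trans h.r2
  r3 := (hf.real _ (by omega) (by omega)).trans h.r3
  r4 := (hf.real _ (by omega) (by omega)).trans h.r4
  r5 := (hf.real _ (by omega) (by omega)).trans h.r5
  inp := hf.input.trans h.inp

/-- The fixed cells lie below `100`, while the arrays live at addresses `100 + i` and `102 + d + y`.
As simp lemmas, these four facts separate the two kinds of addresses when memory updates are
evaluated. -/
theorem add_eq_iff_false {a n : ℕ} (i : ℕ) (h : n < a) : a + i = n ↔ False :=
  iff_false_intro (by omega)

theorem add_add_eq_iff_false {a n : ℕ} (i j : ℕ) (h : n < a) : a + i + j = n ↔ False :=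
  iff_false_intro (by omega)

theorem eq_add_iff_false {a n : ℕ} (i : ℕ) (h : n < a) : n = a + i ↔ False :=
  iff_false_intro (by omega)

theorem eq_add_add_iff_false {a n : ℕ} (i j : ℕ) (h : n < a) : n = a + i + j ↔ False :=
  iff_false_intro (by omega)

/-- The instruction writes to the cells `a, …, b - 1`, to a real cell from `e` on or to the output. -/
def Instr.Writes (e a b : ℕ) : Instr → State → Prop
  | .natConst i _, _ | .natAdd i _ _, _ | .natSub i _ _, _ | .natLoad i _, _
  | .realConst i _, _ | .realAdd i _ _, _ | .realSub i _ _, _ | .realMul i _ _, _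
  | .realDiv i _ _, _ | .realLoad i _, _ | .read i _, _ => a ≤ i ∧ i < b
  | .natStore i _, s => a ≤ s.nat i ∧ s.nat i < b
  | .realStore i _, s => e ≤ s.nat i ∨ a ≤ s.nat i ∧ s.nat i < b
  | .write _ _, _ => True

theorem Frame.apply {e a b : ℕ} {s s' : State} {I : Instr} (h : Frame e a b s s')
    (hI : I.Writes e a b s') : Frame e a b s (I.apply s') := by
  refine h.trans ?_
  cases I <;> simp only [Instr.Writes] at hI <;>
  · refine ⟨fun r hr => ?_, fun r hr hr' => ?_, rfl⟩ <;>
    · simp only [Instr.apply]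
      try exact Function.update_of_ne (by omega) _ _

/-! ### Subprogram: multiplying the table by an affine form -/

section Machine

attribute [local simp] Function.update_apply Instr.apply add_eq_iff_false add_add_eq_iff_false
  eq_add_iff_false eq_add_add_iff_false Instr.Writes Test.holds

/-- One new entry of the table, in real cell `20`. -/
def entryProg : Program :=
  forLoop 21 0 (.seq (block (.natAdd 23 11 21) [.natLoad 24 23])
    (.branch (.natLt 20 24) (block (.natConst 25 0) [])
      (block (.realLoad 23 23) [.natSub 25 20 24, .natAdd 25 12 25, .realLoad 24 25,
        .realMul 23 23 24, .realAdd 20 20 23])))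

/-- Replaces the table `f` by `(A + ∑ i, w i * z ^ (b ^ i)) * f`, where `A` is in real cell `13`,
and leaves the pairing of the new table with the moments in real cell `22`. -/
def stepProg : Program :=
  .seq (block (.natAdd 20 4 7) [.realConst 22 0])
    (.loop (.natLt 7 20)
      (.seq (block (.natSub 20 20 2) [.natAdd 22 12 20, .realLoad 21 22, .realMul 20 13 21])
        (.seq entryProg
          (block (.natAdd 22 12 20) [.realStore 22 20, .natAdd 25 20 2, .read 21 25,
            .realMul 21 20 21, .realAdd 22 22 21]))))

theorem halts_entryProg {d k N : ℕ} {cM : ℝ} {inp : ℕ → ℝ} {s : State}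
    (he : Env d k N cM inp s) (f : ℕ → ℝ) (x : ℕ) (hx : s.nat 20 = x)
    (hf : ∀ y, y ≤ x → s.real (102 + d + y) = f y) :
    Halts entryProg (d * 11 + 2) s (fun s' => Frame (102 + d) 20 30 s s' ∧ s'.nat 20 = x ∧
      (∀ y, s'.real (102 + d + y) = s.real (102 + d + y)) ∧ s'.real 22 = s.real 22 ∧
      s'.output = s.output ∧
      s'.real 20 = s.real 20 + ∑ i ∈ Finset.range d,
        if x < (k + 3) ^ i then 0 else s.real (100 + i) * f (x - (k + 3) ^ i)) := by
  refine (halts_forLoop (m := d) (T := 9) (fun j s' => s'.nat 21 = j ∧ Frame (102 + d) 20 30 s s' ∧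
      s'.nat 20 = x ∧
      (∀ y, s'.real (102 + d + y) = s.real (102 + d + y)) ∧ s'.real 22 = s.real 22 ∧
      s'.output = s.output ∧
      s'.real 20 = s.real 20 + ∑ i ∈ Finset.range j,
        if x < (k + 3) ^ i then 0 else s.real (100 + i) * f (x - (k + 3) ^ i)) ?_ ?_ ?_).mono
    (by omega) (fun s' h => h.2)
  · rintro j s' ⟨h1, h2, -⟩
    exact ⟨h1, (he.frame h2 (by omega) (by omega) (by omega)).n0⟩
  · rintro j s' hj ⟨h1, h2, h3, h4, h5, h6, h7⟩
    have he' := he.frame h2 (by omega) (by omega) (by omega)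
    have hp := he'.pow j hj.le
    refine (halts_block_seq (T := 7) _ _ _ _ ?_).mono (by simp) (fun _ h => h)
    refine (Halts.branch (T := 6) (fun hb => ?_) (fun hb => ?_)).mono (by simp) (fun _ h => h)
    · simp [h3, hp, he'.n11, h1] at hb
      refine (halts_block _ _ _ _ ?_).mono (by simp) (fun _ h => h)
      refine ⟨by simp [h1, he'.n2], ?_, by simp [h3],
        by simpa using h4, by simpa using h5, by simpa using h6, ?_⟩
      · simp only [List.foldl_cons, List.foldl_nil]
        iterate 4 refine Frame.apply ?_ (by simp)
        exact h2
      · simp [Finset.sum_range_succ, h7, hb]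
    · simp [h3, hp, he'.n11, h1] at hb
      refine (halts_block _ _ _ _ ?_).mono (by simp) (fun _ h => h)
      have h8 := h2.real (100 + j) (by omega) (by omega)
      have h9 := hf (x - (k + 3) ^ j) (by omega)
      rw [← h4] at h9
      refine ⟨by simp [h1, he'.n2], ?_, by simp [h3],
        by simpa using h4, by simpa using h5, by simpa using h6, ?_⟩
      · simp only [List.foldl_cons, List.foldl_nil]
        iterate 9 refine Frame.apply ?_ (by simp)
        exact h2
      · simp [Finset.sum_range_succ, h7, not_lt.mpr hb, h8, h9, he'.n12, h3, h1, he'.n11, hp]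
        ring
  · refine ⟨by simp, Frame.apply (Frame.refl _ _ _ _) (by simp), by simp [hx], by simp, by simp,
      by simp, by simp⟩

/-- The table is overwritten in place from the top down. This is sound because entry `x` of the new
table depends only on the old entries at `x` and at the smaller positions `x - (k + 3) ^ i`, which
have not been touched yet. The pairing with the moments is accumulated on the way. -/
theorem halts_stepProg {d k N : ℕ} {cM : ℝ} {inp : ℕ → ℝ} {s : State}
    (he : Env d k N cM inp s) (w : ℕ → ℝ) (hw : ∀ i < d, s.real (100 + i) = w i) (f : ℕ → ℝ)
    (hf : ∀ y, y < (k + 3) ^ d → s.real (102 + d + y) = f y) :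
    Halts stepProg ((k + 3) ^ d * (d * 11 + 13) + 3) s (fun s' => Frame (102 + d) 20 30 s s' ∧
      s'.output = s.output ∧
      (∀ y, y < (k + 3) ^ d →
        s'.real (102 + d + y) = stepTab d (k + 3) w (s.real 13) f y) ∧
      s'.real 22 = pair ((k + 3) ^ d) inp (stepTab d (k + 3) w (s.real 13) f)) := by
  set g := stepTab d (k + 3) w (s.real 13) f with hg
  set M := (k + 3) ^ d with hM
  refine (halts_block_seq (T := M * (d * 11 + 13) + 1) _ _ _ _ ?_).mono (by simp; omega)
    (fun _ h => h)
  refine (Halts.loop (T := d * 11 + 12) (m := M) (j := 0) (fun j s' => s'.nat 20 = M - j ∧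
    Frame (102 + d) 20 30 s s' ∧ s'.output = s.output ∧
    (∀ y, y < M - j → s'.real (102 + d + y) = f y) ∧
    (∀ y, M - j ≤ y → y < M → s'.real (102 + d + y) = g y) ∧
    s'.real 22 = ∑ x ∈ Finset.Ico (M - j) M, g x * inp (x + 1)) ?_ ?_ M (by omega) ?_).mono
    (by ring_nf; omega) ?_
  · rintro s' ⟨h1, h2, -⟩
    simp [h1]
  · rintro j s' hj ⟨h1, h2, h3, h4, h5, h6⟩
    have he' := he.frame h2 (by omega) (by omega) (by omega)
    refine ⟨by simp [h1, he'.n7, hj], ?_⟩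
    obtain ⟨x, hx⟩ : ∃ x, M - j = x + 1 := ⟨M - j - 1, by omega⟩
    have hx' : M - (j + 1) = x := by omega
    rw [hx] at h1 h4 h5 h6
    rw [hx']
    refine (halts_block_seq (T := d * 11 + 8) _ _ _ _ ?_).mono (by simp; omega) (fun _ h => h)
    have hfr : Frame (102 + d) 20 30 s' (List.foldl (fun s b => Instr.apply b s) s'
      [.natSub 20 20 2, .natAdd 22 12 20, .realLoad 21 22, .realMul 20 13 21]) := by
      simp only [List.foldl_cons, List.foldl_nil]
      iterate 4 refine Frame.apply ?_ (by simp)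
      exact Frame.refl _ _ _ _
    have hn := he'.n2
    have hn' := he'.n12
    have h13 := h2.real 13 (by omega) (by omega)
    refine ((halts_entryProg (he'.frame hfr (by omega) (by omega) (by omega)) f x ?_ ?_).seq (T' := 6)
      ?_).mono (by omega) (fun _ h => h)
    · simp [h1, hn]
    · intro y hy
      simp [h4 y (by omega)]
    rintro t ⟨t1, t2, t3, t4, t5, t6⟩
    have he'' := (he'.frame hfr (by omega) (by omega) (by omega)).frame t1 (by omega) (by omega) (by omega)
    have e2 := he''.n2
    have e12 := he''.n12
    have einp := he''.inp
    replace t6 : t.real 20 = g x := by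
      rw [t6, hg]
      simp [h1, hn, hn', h4 x (by omega), stepTab, h13]
      refine Finset.sum_congr rfl fun i hi => ?_
      rw [Finset.mem_range] at hi
      rw [h2.real (100 + i) (by omega) (by omega), hw i hi]
    have t3' : ∀ y, t.real (102 + d + y) = s'.real (102 + d + y) := fun y => by
      rw [t3]; simp
    replace t4 : t.real 22 = s'.real 22 := by rw [t4]; simp
    replace t5 : t.output = s'.output := by rw [t5]; simp
    refine (halts_block _ _ _ _ ?_).mono (by simp) (fun _ h => h)
    refine ⟨by simp [t2], ?_, by simp [t5, h3], ?_, ?_, ?_⟩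
    · simp only [List.foldl_cons, List.foldl_nil]
      iterate 4 refine Frame.apply ?_ (by simp)
      refine Frame.apply ?_ (by simp [e12])
      refine Frame.apply ?_ (by simp)
      exact h2.trans (hfr.trans t1)
    · intro y hy
      simp [e12, t2, t3', h4 y (by omega), hy.ne]
    · intro y hy hy'
      rcases hy.eq_or_lt with rfl | hy
      · simp [e12, t2, t6]
      · simp [e12, t2, t3', h5 y (by omega) hy', hy.ne']
    · rw [Finset.sum_eq_sum_Ico_succ_bot (by omega)]
      simp [e12, t2, t6, t4, h6, e2, einp, add_assoc]
      ring
  · refine ⟨by simp [he.n4, he.n7, hM], ?_, by simp, ?_, ?_, by simp⟩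
    · simp only [List.foldl_cons, List.foldl_nil]
      iterate 2 refine Frame.apply ?_ (by simp)
      exact Frame.refl _ _ _ _
    · intro y hy
      simpa using hf y hy
    · intro y hy hy'
      omega
  · rintro s' ⟨h1, h2, h3, h4, h5, h6⟩
    refine ⟨h2, h3, fun y hy => h5 y (by omega) hy, ?_⟩
    rw [h6, pair, Nat.sub_self, Nat.Ico_zero_eq_range]

/-! ### Subprogram: decoding the number of a candidate -/

/-- Splits off the lowest digit in base `nat 6` of `nat 30`, leaving the digit in `nat 31`, the
digit minus `N` in `real 30` and the quotient in `nat 33`. -/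
def digitProg : Program :=
  .seq (block (.natAdd 34 30 2) [.natConst 33 0])
  (.seq (.loop (.natLt 6 34) (block (.natSub 34 34 6) [.natAdd 33 33 2]))
  (.seq (block (.natSub 31 34 2) [.natSub 35 34 2, .realAdd 30 3 5])
  (.loop (.natLt 7 35) (block (.natSub 35 35 2) [.realAdd 30 30 4]))))

theorem halts_digitProg {d k N : ℕ} {cM : ℝ} {inp : ℕ → ℝ} {s : State}
    (he : Env d k N cM inp s) (x : ℕ) (hx : s.nat 30 = x) :
    Halts digitProg (x * 3 + (2 * N + 1) * 3 + 7) s (fun s' => Frame 100 30 40 s s' ∧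
      s'.nat 32 = s.nat 32 ∧ (∀ r, 100 ≤ r → s'.real r = s.real r) ∧
      s'.nat 31 = x % (2 * N + 1) ∧ s'.nat 33 = x / (2 * N + 1) ∧
      s'.real 30 = (x % (2 * N + 1) : ℕ) - N) := by
  set B := 2 * N + 1 with hB
  have hdm := Nat.div_add_mod x B
  have hlt : x % B < B := Nat.mod_lt _ (by omega)
  have hle : x / B ≤ x := Nat.div_le_self _ _
  refine (halts_block_seq (T := x * 3 + B * 3 + 5) _ _ _ _ ?_).mono (by simp; omega) (fun _ h => h)
  -- Division by repeated subtraction. Cell `34` holds the remainder plus one, so that the strict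
  -- test `B < r + 1` decides `B ≤ r` and the loop makes exactly `x / B` rounds.
  refine ((Halts.loop (T := 2) (m := x / B) (j := 0) (fun j s' => s'.nat 34 = x + 1 - B * j ∧
    s'.nat 33 = j ∧ Frame 100 30 40 s s' ∧
      s'.nat 32 = s.nat 32 ∧ (∀ r, 100 ≤ r → s'.real r = s.real r)) ?_ ?_ (x / B)
      (by omega) ?_).seq (T' := B * 3 + 4) ?_).mono (by omega) (fun _ h => h)
  · rintro s' ⟨h1, h2, h3, h4⟩
    have he' := he.frame h3 (by omega) (by omega) (by omega)
    simp [h1, he'.n6]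
    omega
  · rintro j s' hj ⟨h1, h2, h3, h4, h5⟩
    have he' := he.frame h3 (by omega) (by omega) (by omega)
    have hmul : B * (j + 1) ≤ B * (x / B) := Nat.mul_le_mul_left _ hj
    rw [mul_add, mul_one] at hmul
    refine ⟨by simp [h1, he'.n6]; omega, ?_⟩
    refine (halts_block _ _ _ _ ?_).mono (by simp) (fun _ h => h)
    refine ⟨?_, by simp [h2, he'.n2], ?_, by simp [h4], by simpa using h5⟩
    · simp [h1, he'.n6, mul_add]
      omega
    · simp only [List.foldl_cons, List.foldl_nil]
      iterate 2 refine Frame.apply ?_ (by simp)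
      exact h3
  · refine ⟨by simp [hx, he.n2], by simp, ?_, by simp, by simp⟩
    simp only [List.foldl_cons, List.foldl_nil]
    iterate 2 refine Frame.apply ?_ (by simp)
    exact Frame.refl _ _ _ _
  rintro s1 ⟨h1, h2, h3, h4, h5⟩
  replace h1 : s1.nat 34 = x % B + 1 := by omega
  have he1 := he.frame h3 (by omega) (by omega) (by omega)
  refine (halts_block_seq (T := B * 3 + 1) _ _ _ _ ?_).mono (by simp; omega) (fun _ h => h)
  -- Naturals cannot be copied into real cells, so the digit minus `N` is produced by counting up
  -- from `-N`.
  refine (Halts.loop (T := 2) (m := x % B) (j := 0) (fun j s' => s'.nat 35 = x % B - j ∧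
    s'.real 30 = j - N ∧
    s'.nat 33 = x / B ∧ s'.nat 31 = x % B ∧ Frame 100 30 40 s s' ∧
      s'.nat 32 = s.nat 32 ∧ (∀ r, 100 ≤ r → s'.real r = s.real r)) ?_ ?_ (x % B)
      (by omega) ?_).mono (by omega) ?_
  · rintro s' ⟨h1, h2, h3, h4, h5, h6⟩
    simp [h1]
  · rintro j s' hj ⟨h1, h2, h3, h4, h5, h6, h7⟩
    have he' := he.frame h5 (by omega) (by omega) (by omega)
    refine ⟨by simp [h1, he'.n7]; omega, ?_⟩
    refine (halts_block _ _ _ _ ?_).mono (by simp) (fun _ h => h)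
    refine ⟨by simp [h1, he'.n2]; omega, by simp [h2, he'.r4]; ring, by simp [h3], by simp [h4],
      ?_, by simp [h6], ?_⟩
    · simp only [List.foldl_cons, List.foldl_nil]
      iterate 2 refine Frame.apply ?_ (by simp)
      exact h5
    · intro r hr
      simp [h7 r hr]
      omega
  · refine ⟨by simp [h1, he1.n2], by simp [he1.r3, he1.r5], by simp [h2], by simp [h1, he1.n2], ?_,
      by simp [h4], ?_⟩
    · simp only [List.foldl_cons, List.foldl_nil]
      iterate 3 refine Frame.apply ?_ (by simp)
      exact h3
    · intro r hr
      simp [h5 r hr]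
      omega
  · rintro s' ⟨h1, h2, h3, h4, h5, h6, h7⟩
    exact ⟨h5, h6, h7, h4, h3, h2⟩

/-- Writes the digits of `nat 50` minus `N` to the real cells `100, …, 101 + d`. The last digit is
left in `nat 31`. -/
def decodeProg : Program :=
  .seq (block (.natAdd 30 50 7) [])
    (forLoop 32 10 (.seq digitProg (block (.natAdd 36 11 32) [.realStore 36 30, .natAdd 30 33 7])))

theorem halts_decodeProg {d k N : ℕ} {cM : ℝ} {inp : ℕ → ℝ} {s : State}
    (he : Env d k N cM inp s) (c : ℕ) (hc : s.nat 50 = c) :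
    Halts decodeProg ((d + 2) * (c * 3 + (2 * N + 1) * 3 + 12) + 3) s
      (fun s' => Frame 100 30 40 s s' ∧
      (∀ i, i < d + 2 → s'.real (100 + i) = (c / (2 * N + 1) ^ i % (2 * N + 1) : ℕ) - N) ∧
      s'.nat 31 = c / (2 * N + 1) ^ (d + 1) % (2 * N + 1)) := by
  set B := 2 * N + 1 with hB
  refine (halts_block_seq (T := (d + 2) * (c * 3 + B * 3 + 12) + 2) _ _ _ _ ?_).mono
    (by simp; omega) (fun _ h => h)
  -- The last digit is needed as a natural number, since it encodes the exponent; the final clause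
  -- of the invariant keeps the copy that the last round leaves in cell `31`.
  refine (halts_forLoop (m := d + 2) (T := c * 3 + B * 3 + 10) (fun j s' => s'.nat 32 = j ∧
      Frame 100 30 40 s s' ∧ s'.nat 30 = c / B ^ j ∧
      (∀ i, i < j → s'.real (100 + i) = (c / B ^ i % B : ℕ) - N) ∧
      (j = d + 2 → s'.nat 31 = c / B ^ (d + 1) % B)) ?_ ?_ ?_).mono
    (by ring_nf; omega) (fun s' h => ⟨h.2.1, h.2.2.2.1, h.2.2.2.2 rfl⟩)
  · rintro j s' ⟨h1, h2, -⟩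
    exact ⟨h1, (he.frame h2 (by omega) (by omega) (by omega)).n10⟩
  · rintro j s' hj ⟨h1, h2, h3, h4, -⟩
    have he' := he.frame h2 (by omega) (by omega) (by omega)
    have hle : c / B ^ j ≤ c := Nat.div_le_self _ _
    refine ((halts_digitProg he' _ h3).seq (T' := 3) ?_).mono (by omega) (fun _ h => h)
    rintro t ⟨t1, t2, t3, t4, t5, t6⟩
    rw [← hB] at t4 t5 t6
    have he'' := he'.frame t1 (by omega) (by omega) (by omega)
    refine (halts_block _ _ _ _ ?_).mono (by simp) (fun _ h => h)
    refine ⟨by simp [t2, h1, he''.n2], ?_, ?_, ?_, ?_⟩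
    · simp only [List.foldl_cons, List.foldl_nil]
      refine Frame.apply ?_ (by simp)
      refine Frame.apply ?_ (by simp)
      refine Frame.apply ?_ (by simp [he''.n11])
      refine Frame.apply ?_ (by simp)
      exact h2.trans t1
    · simp [he''.n7, t5, pow_succ, Nat.div_div_eq_div_mul]
    · intro i hi
      rcases Nat.lt_succ_iff_lt_or_eq.mp hi with hi | rfl
      · simp [he''.n11, t2, h1, hi.ne, t3, h4 i hi]
      · simp [he''.n11, t2, h1, t6]
    · intro hj'
      obtain rfl : j = d + 1 := by omega
      simp [t4]
  · refine ⟨by simp, ?_, by simp [hc, he.n7], by simp, by simp⟩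
    simp only [List.foldl_cons, List.foldl_nil]
    iterate 2 refine Frame.apply ?_ (by simp)
    exact Frame.refl _ _ _ _

/-! ### Subprograms: norms, powers of the linear form and size bound -/

/-- The table of the polynomial `1`. -/
def oneTab (x : ℕ) : ℝ := if x = 0 then 1 else 0

/-- The sum of squares of the first `d` entries. -/
def sumSq (d : ℕ) (w : ℕ → ℝ) : ℝ := ∑ i ∈ Finset.range d, w i ^ 2

/-- The table of `u ^ j * (a + u) ^ i`. -/
noncomputable def mulTab (d b : ℕ) (w : ℕ → ℝ) (j i : ℕ) : ℕ → ℝ :=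
  (stepTab d b w (w d))^[i] ((stepTab d b w 0)^[j] oneTab)

/-- Leaves the sum of squares in `real 40`. -/
def sumSqProg : Program :=
  .seq (block (.realConst 40 0) [])
    (forLoop 42 0 (block (.natAdd 43 11 42) [.realLoad 41 43, .realMul 41 41 41, .realAdd 40 40 41]))

theorem halts_sumSqProg {d k N : ℕ} {cM : ℝ} {inp : ℕ → ℝ} {s : State}
    (he : Env d k N cM inp s) (w : ℕ → ℝ) (hw : ∀ i < d, s.real (100 + i) = w i) :
    Halts sumSqProg (d * 6 + 3) s (fun s' => Frame (102 + d) 40 50 s s' ∧ s'.nat 40 = s.nat 40 ∧ s'.real 40 = sumSq d w) := by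
  refine (halts_block_seq (T := d * 6 + 2) _ _ _ _ ?_).mono
    (by simp; omega) (fun _ h => h)
  refine (halts_forLoop (m := d) (T := 4) (fun j s' => s'.nat 42 = j ∧
      Frame (102 + d) 40 50 s s' ∧ s'.nat 40 = s.nat 40 ∧
      s'.real 40 = ∑ i ∈ Finset.range j, w i ^ 2) ?_ ?_ ?_).mono
    (by omega) (fun s' h => h.2)
  · rintro j s' ⟨h1, h2, -⟩
    exact ⟨h1, (he.frame h2 (by omega) (by omega) (by omega)).n0⟩
  · rintro j s' hj ⟨h1, h2, h3, h4⟩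
    have he' := he.frame h2 (by omega) (by omega) (by omega)
    have h5 := h2.real (100 + j) (by omega) (by omega)
    rw [hw j hj] at h5
    refine (halts_block _ _ _ _ ?_).mono (by simp) (fun _ h => h)
    refine ⟨by simp [h1, he'.n2], ?_, by simp [h3], ?_⟩
    · simp only [List.foldl_cons, List.foldl_nil]
      iterate 5 refine Frame.apply ?_ (by simp)
      exact h2
    · simp [he'.n11, h1, h5, h4, Finset.sum_range_succ, sq]
  · refine ⟨by simp, ?_, by simp, by simp⟩
    simp only [List.foldl_cons, List.foldl_nil]
    iterate 2 refine Frame.apply ?_ (by simp)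
    exact Frame.refl _ _ _ _

/-- Fills the table with the coefficients of the polynomial `1`. -/
def initProg : Program :=
  .seq (forLoop 42 4 (block (.natAdd 43 12 42) [.realStore 43 5])) (block (.realStore 12 4) [])

theorem halts_initProg {d k N : ℕ} {cM : ℝ} {inp : ℕ → ℝ} {s : State}
    (he : Env d k N cM inp s) :
    Halts initProg ((k + 3) ^ d * 4 + 3) s (fun s' =>
      Frame (102 + d) 42 50 s s' ∧ ∀ y, y < (k + 3) ^ d → s'.real (102 + d + y) = oneTab y) := by
  set M := (k + 3) ^ d with hM
  refine ((halts_forLoop (m := M) (T := 2) (fun j s' => s'.nat 42 = j ∧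
      Frame (102 + d) 42 50 s s' ∧ ∀ y, y < j → s'.real (102 + d + y) = 0) ?_ ?_ ?_).seq
      (T' := 1) ?_).mono (by omega) (fun s' h => h)
  · rintro j s' ⟨h1, h2, -⟩
    exact ⟨h1, (he.frame h2 (by omega) (by omega) (by omega)).n4⟩
  · rintro j s' hj ⟨h1, h2, h3⟩
    have he' := he.frame h2 (by omega) (by omega) (by omega)
    refine (halts_block _ _ _ _ ?_).mono (by simp) (fun _ h => h)
    refine ⟨by simp [h1, he'.n2], ?_, ?_⟩
    · simp only [List.foldl_cons, List.foldl_nil]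
      refine Frame.apply ?_ (by simp)
      refine Frame.apply ?_ (by simp [he'.n12])
      refine Frame.apply ?_ (by simp)
      exact h2
    · intro y hy
      rcases Nat.lt_succ_iff_lt_or_eq.mp hy with hy | rfl
      · simp [he'.n12, h1, hy.ne, h3 y hy]
      · simp [he'.n12, h1, he'.r5]
  · refine ⟨by simp, ?_, by simp⟩
    exact Frame.apply (Frame.refl _ _ _ _) (by simp)
  · rintro s' ⟨h1, h2, h3⟩
    have he' := he.frame h2 (by omega) (by omega) (by omega)
    refine (halts_block _ _ _ _ ?_).mono (by simp) (fun _ h => h)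
    refine ⟨Frame.apply (I := .realStore 12 4) h2 (by simp [he'.n12]), ?_⟩
    intro y hy
    simp [he'.n12, he'.r4, oneTab, h3 y hy]

/-- Multiplies the table `nat 40` times by the square of the linear form, and the content of
`real 43` as many times by that of `real 42`. -/
def powerProg : Program :=
  .seq (block (.realConst 13 0) [])
    (forLoop 44 40 (.seq stepProg (.seq stepProg (block (.realMul 43 43 42) []))))

/-- The time of one multiplication of the table. -/
def stepTime (d k : ℕ) : ℕ := (k + 3) ^ d * (d * 11 + 13) + 3

/-- The real cells `100, …, 101 + d` hold the candidate and only those from `102 + d` on hold the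
table, so programs framed with `e = 102 + d` preserve the candidate. -/
theorem Frame.real_eq {d a b : ℕ} {s s' : State} (h : Frame (102 + d) a b s s') (hb : b ≤ 100)
    {i n : ℕ} (hi : i < n) (hn : n ≤ d + 2) : s'.real (100 + i) = s.real (100 + i) :=
  h.real _ (by omega) (by omega)

theorem halts_powerProg {d k N : ℕ} {cM : ℝ} {inp : ℕ → ℝ} {s : State}
    (he : Env d k N cM inp s) (w : ℕ → ℝ) (hw : ∀ i < d, s.real (100 + i) = w i) (l : ℕ)
    (hl : s.nat 40 = l + 1)
    (hf : ∀ y, y < (k + 3) ^ d → s.real (102 + d + y) = oneTab y) :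
    Halts powerProg ((l + 1) * (stepTime d k * 2 + 3) + 3) s (fun s' =>
      Frame (102 + d) 13 50 s s' ∧ s'.nat 40 = l + 1 ∧ s'.real 40 = s.real 40 ∧
      s'.real 42 = s.real 42 ∧
      s'.real 43 = s.real 43 * s.real 42 ^ (l + 1) ∧
      (∀ y, y < (k + 3) ^ d →
        s'.real (102 + d + y) = mulTab d (k + 3) w (2 * (l + 1)) 0 y) ∧
      s'.real 22 = pair ((k + 3) ^ d) inp (mulTab d (k + 3) w (2 * (l + 1)) 0)) := by
  refine (halts_block_seq (T := (l + 1) * (stepTime d k * 2 + 3) + 2) _ _ _ _ ?_).mono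
    (by simp; omega) (fun _ h => h)
  -- Before the first multiplication the register for the pairing contains nothing meaningful, hence
  -- the premise `j ≠ 0`. It holds on exit because there are `l + 1 ≥ 1` rounds.
  refine (halts_forLoop (m := l + 1) (T := stepTime d k * 2 + 1) (fun j s' => s'.nat 44 = j ∧
      Frame (102 + d) 13 50 s s' ∧ s'.nat 40 = l + 1 ∧ s'.real 40 = s.real 40 ∧
      s'.real 42 = s.real 42 ∧ s'.real 13 = 0 ∧
      s'.real 43 = s.real 43 * s.real 42 ^ j ∧
      (∀ y, y < (k + 3) ^ d →
        s'.real (102 + d + y) = mulTab d (k + 3) w (2 * j) 0 y) ∧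
      (j ≠ 0 → s'.real 22 = pair ((k + 3) ^ d) inp (mulTab d (k + 3) w (2 * j) 0)))
      ?_ ?_ ?_).mono
    (by ring_nf; omega) (fun s' h => ⟨h.2.1, h.2.2.1, h.2.2.2.1, h.2.2.2.2.1, h.2.2.2.2.2.2.1,
      h.2.2.2.2.2.2.2.1, h.2.2.2.2.2.2.2.2 (by omega)⟩)
  · rintro j s' ⟨h1, h2, h3, -⟩
    exact ⟨h1, h3⟩
  · rintro j s' hj ⟨h1, h2, h3, h4, h5, h6, h7, h8, -⟩
    have he' := he.frame h2 (by omega) (by omega) (by omega)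
    have hw' : ∀ i < d, s'.real (100 + i) = w i := fun i hi =>
      (h2.real_eq (by omega) hi (by omega)).trans (hw i hi)
    refine ((halts_stepProg he' w hw' _ h8).seq (T' := stepTime d k + 1) ?_).mono
      (by rw [stepTime]; omega) (fun _ h => h)
    rintro t ⟨t1, t2, t3, -⟩
    have he'' := he'.frame t1 (by omega) (by omega) (by omega)
    have hw'' : ∀ i < d, t.real (100 + i) = w i := fun i hi =>
      (t1.real_eq (by omega) hi (by omega)).trans (hw' i hi)
    refine ((halts_stepProg he'' w hw'' _ t3).seq (T' := 1) ?_).mono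
      (by rw [stepTime]) (fun _ h => h)
    rintro u ⟨u1, u2, u3, u4⟩
    rw [t1.real 13 (by omega) (by omega), h6] at u3 u4
    have hfr := t1.trans u1
    have hit : stepTab d (k + 3) w 0 (stepTab d (k + 3) w 0 (mulTab d (k + 3) w (2 * j) 0)) =
        mulTab d (k + 3) w (2 * (j + 1)) 0 := by
      simp only [mulTab, Function.iterate_zero, id]
      rw [show 2 * (j + 1) = 2 * j + 1 + 1 by ring, Function.iterate_succ_apply',
        Function.iterate_succ_apply']
    rw [hit] at u3 u4
    refine (halts_block _ _ _ _ ?_).mono (by simp) (fun _ h => h)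
    refine ⟨?_, ?_, ?_, ?_, ?_, ?_, ?_, ?_, ?_⟩
    · simp [hfr.nat 44 (by omega), h1, (he''.frame u1 (by omega) (by omega) (by omega)).n2]
    · simp only [List.foldl_cons, List.foldl_nil]
      iterate 2 refine Frame.apply ?_ (by simp)
      exact h2.trans (hfr.widen (by omega) (by omega))
    · simp [hfr.nat 40 (by omega), h3]
    · simp [hfr.real 40 (by omega) (by omega), h4]
    · simp [hfr.real 42 (by omega) (by omega), h5]
    · simp [hfr.real 13 (by omega) (by omega), h6]
    · simp [hfr.real 43 (by omega) (by omega), hfr.real 42 (by omega) (by omega), h7, h5,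
        pow_succ, mul_assoc]
    · intro y hy
      simpa using u3 y hy
    · intro
      simpa using u4
  · refine ⟨by simp, ?_, by simp [hl], by simp, by simp, by simp, by simp, ?_, by simp⟩
    · simp only [List.foldl_cons, List.foldl_nil]
      iterate 2 refine Frame.apply ?_ (by simp)
      exact Frame.refl _ _ _ _
    · intro y hy
      simpa [mulTab] using hf y hy

/-! ### The acceptance test for a candidate -/

/-- The first entry that has to be compared, the expectation of `u ^ (2 * l) * u ^ 2`. -/
noncomputable def secondMoment (T0 T1 T2 a : ℝ) : ℝ := a * (a * T0 - T1 - T1) + T2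

/-- The test that a candidate has to pass: `w` holds the `d` coefficients of the linear form `u`
and the shift `a`. -/
def Accept (d k : ℕ) (cM : ℝ) (inp w : ℕ → ℝ) (l : ℕ) : Prop :=
  let T (i : ℕ) : ℝ := pair ((k + 3) ^ d) inp (mulTab d (k + 3) w (2 * l) i)
  let S : ℝ := pair ((k + 3) ^ d) inp (stepTab d (k + 3) w 0 (mulTab d (k + 3) w (2 * l) 2))
  2 * l + 1 < k ∧ (d * sumSq d w) ^ (l + 1) < 2 ^ k * T 2 ∧
    cM * sumSq d w * T 0 ≤ secondMoment (T 0) (T 1) (T 2) (w d) ∧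
    cM * sumSq d w * T 2 * T 2 ≤ S * S

/-- Writes the table divided by `real 47` to the output. -/
def outputProg : Program :=
  forLoop 42 4 (block (.natAdd 41 12 42) [.realLoad 41 41, .realDiv 41 41 47, .write 42 41])

theorem halts_outputProg {d k N : ℕ} {cM : ℝ} {inp : ℕ → ℝ} {s : State}
    (he : Env d k N cM inp s) :
    Halts outputProg ((k + 3) ^ d * 6 + 2) s (fun s' =>
      Frame (102 + d) 41 43 s s' ∧
      (∀ y, y < (k + 3) ^ d → s'.real (102 + d + y) = s.real (102 + d + y)) ∧
      ∀ y, y < (k + 3) ^ d → s'.output y = s.real (102 + d + y) / s.real 47) := by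
  set M := (k + 3) ^ d with hM
  refine (halts_forLoop (m := M) (T := 4) (fun j s' => s'.nat 42 = j ∧
      Frame (102 + d) 41 43 s s' ∧
      (∀ y, y < M → s'.real (102 + d + y) = s.real (102 + d + y)) ∧
      ∀ y, y < j → s'.output y = s.real (102 + d + y) / s.real 47) ?_ ?_ ?_).mono
      (by omega) (fun s' h => h.2)
  · rintro j s' ⟨h1, h2, -⟩
    exact ⟨h1, (he.frame h2 (by omega) (by omega) (by omega)).n4⟩
  · rintro j s' hj ⟨h1, h2, h3, h4⟩
    have he' := he.frame h2 (by omega) (by omega) (by omega)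
    refine (halts_block _ _ _ _ ?_).mono (by simp) (fun _ h => h)
    refine ⟨by simp [h1, he'.n2], ?_, ?_, ?_⟩
    · simp only [List.foldl_cons, List.foldl_nil]
      iterate 5 refine Frame.apply ?_ (by simp)
      exact h2
    · intro y hy
      simp [h3 y hy]
    · intro y hy
      rcases Nat.lt_succ_iff_lt_or_eq.mp hy with hy | rfl
      · simp [h1, hy.ne, h4 y hy]
      · simp [h1, h3 y hj, he'.n12, h2.real 47 (by omega) (by omega)]
  · refine ⟨by simp, ?_, by simp, by simp⟩
    exact Frame.apply (Frame.refl _ _ _ _) (by simp)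

/-- An instruction that only takes time. -/
def skipProg : Program := block (.natConst 40 0) []

/-- Compares the moments and records the success in `nat 51`. -/
def compareProg : Program :=
  .seq (block (.realMul 41 0 47) [])
  (.branch (.realLt 43 41)
    (.seq (block (.realMul 48 45 44) [.realSub 48 48 46, .realSub 48 48 46, .realMul 48 45 48,
      .realAdd 48 48 47, .realMul 49 1 40, .realMul 41 49 44])
    (.branch (.realLt 48 41) skipProg
      (.seq (block (.realMul 49 49 47) [.realMul 49 49 47, .realMul 48 22 22])
        (.branch (.realLt 48 49) skipProg (block (.natConst 51 1) [])))))
    skipProg)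

theorem halts_compareProg {d k N : ℕ} {cM : ℝ} {inp : ℕ → ℝ} {s : State}
    (he : Env d k N cM inp s) (hs : s.nat 51 = 0) (P : Prop) [Decidable P]
    (hP : P ↔ s.real 43 < 2 ^ k * s.real 47 ∧
      cM * s.real 40 * s.real 44 ≤
        secondMoment (s.real 44) (s.real 46) (s.real 47) (s.real 45) ∧
      cM * s.real 40 * s.real 47 * s.real 47 ≤ s.real 22 * s.real 22) :
    Halts compareProg 16 s (fun s' => Env d k N cM inp s' ∧ s'.nat 50 = s.nat 50 ∧
      s'.output = s.output ∧ s'.nat 51 = if P then 1 else 0) := by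
  -- The three ways to fail end alike: cell `51` keeps its value zero.
  have hskip : ∀ s' : State, Frame (102 + d) 40 50 s s' → s'.output = s.output → ¬ P →
      Halts skipProg 1 s' (fun s' => Env d k N cM inp s' ∧ s'.nat 50 = s.nat 50 ∧
      s'.output = s.output ∧ s'.nat 51 = if P then 1 else 0) := by
    intro s' hf ho hP
    refine halts_block _ _ _ _ ?_
    have hf' : Frame (102 + d) 40 50 s ((Instr.natConst 40 0).apply s') := hf.apply (by simp)
    refine ⟨he.frame hf' (by omega) (by omega) (by omega), ?_, ho, ?_⟩
    · exact hf'.nat 50 (by omega)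
    · simpa [hP, hs] using hf'.nat 51 (by omega)
  have h0 := he.r0
  have h1 := he.r1
  have hf1 := (Frame.refl (102 + d) 40 50 s).apply (I := .realMul 41 0 47) (by simp)
  refine (halts_block_seq (T := 15) _ _ _ _ ?_).mono (by simp) (fun _ h => h)
  refine (Halts.branch (T := 14) (fun hb => ?_) (fun hb => ?_)).mono (by simp) (fun _ h => h)
  swap
  · refine (hskip _ hf1 (by simp) ?_).mono (by omega) (fun _ h => h)
    simp [h0] at hb
    rw [hP]
    intro h
    exact absurd h.1 (not_lt.mpr hb)
  refine (halts_block_seq (T := 7) _ _ _ _ ?_).mono (by simp) (fun _ h => h)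
  simp [h0] at hb
  have hf2 : Frame (102 + d) 40 50 s (List.foldl (fun s b => Instr.apply b s)
      (Instr.apply (.realMul 41 0 47) s)
      [.realMul 48 45 44, .realSub 48 48 46, .realSub 48 48 46, .realMul 48 45 48,
      .realAdd 48 48 47, .realMul 49 1 40, .realMul 41 49 44]) := by
    simp only [List.foldl_cons, List.foldl_nil]
    iterate 7 refine Frame.apply ?_ (by simp)
    exact hf1
  -- Only strict comparisons are available, so a non-strict inequality is confirmed by the failure
  -- of the opposite strict test.
  refine (Halts.branch (T := 6) (fun hb' => ?_) (fun hb' => ?_)).mono (by simp) (fun _ h => h)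
  · refine (hskip _ hf2 (by simp) ?_).mono (by omega) (fun _ h => h)
    simp [h1] at hb'
    rw [hP]
    intro h
    refine absurd h.2.1 (not_le.mpr ?_)
    simpa [secondMoment] using hb'
  simp [h1] at hb'
  refine (halts_block_seq (T := 2) _ _ _ _ ?_).mono (by simp) (fun _ h => h)
  have hf3 : Frame (102 + d) 40 50 s (List.foldl (fun s b => Instr.apply b s)
      (List.foldl (fun s b => Instr.apply b s)
      (Instr.apply (.realMul 41 0 47) s)
      [.realMul 48 45 44, .realSub 48 48 46, .realSub 48 48 46, .realMul 48 45 48,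
      .realAdd 48 48 47, .realMul 49 1 40, .realMul 41 49 44])
      [.realMul 49 49 47, .realMul 49 49 47, .realMul 48 22 22]) := by
    rw [List.foldl_cons, List.foldl_cons, List.foldl_cons, List.foldl_nil]
    iterate 3 refine Frame.apply ?_ (by simp only [Instr.Writes]; omega)
    exact hf2
  refine (Halts.branch (T := 1) (fun hb'' => ?_) (fun hb'' => ?_)).mono (by simp) (fun _ h => h)
  · refine (hskip _ hf3 (by simp) ?_).mono (by omega) (fun _ h => h)
    simp [h1] at hb''
    rw [hP]
    intro h
    refine absurd h.2.2 (not_le.mpr ?_)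
    simpa [mul_assoc] using hb''
  simp [h1] at hb''
  have hPt : P := hP.mpr ⟨hb, by simpa [secondMoment] using hb', by simpa [mul_assoc] using hb''⟩
  refine (halts_block _ _ _ _ ?_).mono (by simp) (fun _ h => h)
  refine ⟨?_, ?_, by simp, by simp [hPt]⟩
  · have hf4 := (hf3.widen (b' := 52) le_rfl (by omega)).apply (I := .natConst 51 1)
      (by simp only [Instr.Writes]; omega)
    exact he.frame hf4 (by omega) (by omega) (by omega)
  · simp

/-- Computes the moments of a candidate and writes its polynomial to the output, provided that the
degree is small enough. -/
def momentsProg : Program :=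
  .seq sumSqProg (.seq initProg (.seq (block (.realMul 42 2 40) [.realAdd 43 42 5])
  (.seq powerProg (.seq (block (.realAdd 44 22 5) [.natAdd 43 11 0, .realLoad 45 43, .realAdd 13 45 5])
  (.seq stepProg (.seq (block (.realAdd 46 22 5) []) (.seq stepProg (.seq (block (.realAdd 47 22 5) [])
  (.seq outputProg (.seq (block (.realConst 13 0) []) stepProg))))))))))

/-- The time of `momentsProg`. -/
def momentsTime (d k l : ℕ) : ℕ :=
  (d * 6 + 3) + ((k + 3) ^ d * 4 + 3) + 2 + ((l + 1) * (stepTime d k * 2 + 3) + 3) + 4 +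
    stepTime d k + 1 + stepTime d k + 1 + ((k + 3) ^ d * 6 + 2) + 1 + stepTime d k

/-- The output is written before the last multiplication by `u`, which destroys the table and is
performed only for its pairing. Writing takes place for every candidate that reaches this program;
since the search stops at the first success, the final content of the output belongs to the accepted
candidate. -/
theorem halts_momentsProg {d k N : ℕ} {cM : ℝ} {inp : ℕ → ℝ} {s : State}
    (he : Env d k N cM inp s) (w : ℕ → ℝ) (hw : ∀ i < d + 1, s.real (100 + i) = w i) (l : ℕ)
    (hl : s.nat 40 = l + 1) :
    Halts momentsProg (momentsTime d k l) s (fun s' =>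
      Frame (102 + d) 13 50 s s' ∧ s'.real 40 = sumSq d w ∧
      s'.real 43 = (d * sumSq d w) ^ (l + 2) ∧ s'.real 45 = w d ∧
      s'.real 44 = pair ((k + 3) ^ d) inp (mulTab d (k + 3) w (2 * (l + 1)) 0) ∧
      s'.real 46 = pair ((k + 3) ^ d) inp (mulTab d (k + 3) w (2 * (l + 1)) 1) ∧
      s'.real 47 = pair ((k + 3) ^ d) inp (mulTab d (k + 3) w (2 * (l + 1)) 2) ∧
      s'.real 22 = pair ((k + 3) ^ d) inp
        (stepTab d (k + 3) w 0 (mulTab d (k + 3) w (2 * (l + 1)) 2)) ∧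
      ∀ y, y < (k + 3) ^ d → s'.output y = mulTab d (k + 3) w (2 * (l + 1)) 2 y /
        pair ((k + 3) ^ d) inp (mulTab d (k + 3) w (2 * (l + 1)) 2)) := by
  have hw0 : ∀ i < d, s.real (100 + i) = w i := fun i hi => hw i (by omega)
  refine ((halts_sumSqProg he w hw0).seq (T' := ((k + 3) ^ d * 4 + 3) + 2 +
    ((l + 1) * (stepTime d k * 2 + 3) + 3) + 4 +
    stepTime d k + 1 + stepTime d k + 1 + ((k + 3) ^ d * 6 + 2) + 1 + stepTime d k) ?_).mono
    (by rw [momentsTime]; omega) (fun _ h => h)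
  rintro s1 ⟨a1, a2, a3⟩
  have f1 := a1.widen (a' := 13) (by omega) le_rfl
  have e1 := he.frame f1 (by omega) (by omega) (by omega)
  refine ((halts_initProg e1).seq (T' := 2 +
    ((l + 1) * (stepTime d k * 2 + 3) + 3) + 4 +
    stepTime d k + 1 + stepTime d k + 1 + ((k + 3) ^ d * 6 + 2) + 1 + stepTime d k) ?_).mono
    (by omega) (fun _ h => h)
  rintro s2 ⟨b1, b2⟩
  have f2 := f1.trans (b1.widen (a' := 13) (by omega) le_rfl)
  have e2 := he.frame f2 (by omega) (by omega) (by omega)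
  rw [← b1.real 40 (by omega) (by omega)] at a3
  rw [← b1.nat 40 (by omega), hl] at a2
  refine (halts_block_seq (T := ((l + 1) * (stepTime d k * 2 + 3) + 3) + 4 +
    stepTime d k + 1 + stepTime d k + 1 + ((k + 3) ^ d * 6 + 2) + 1 + stepTime d k) _ _ _ _
    ?_).mono (by simp; omega) (fun _ h => h)
  have f3 : Frame (102 + d) 13 50 s (List.foldl (fun s b => Instr.apply b s) s2
      [.realMul 42 2 40, .realAdd 43 42 5]) := by
    simp only [List.foldl_cons, List.foldl_nil]
    iterate 2 refine Frame.apply ?_ (by simp)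
    exact f2
  have e3 := he.frame f3 (by omega) (by omega) (by omega)
  refine ((halts_powerProg e3 w (fun i hi => (f3.real_eq (by omega) hi (by omega)).trans
    (hw0 i hi)) l (by simp [a2]) (fun y hy => by simpa using b2 y hy)).seq (T' := 4 +
    stepTime d k + 1 + stepTime d k + 1 + ((k + 3) ^ d * 6 + 2) + 1 + stepTime d k) ?_).mono
    (by omega) (fun _ h => h)
  rintro s4 ⟨c1, c2, c3, c4, c5, c6, c7⟩
  have f4 := f3.trans c1
  have e4 := he.frame f4 (by omega) (by omega) (by omega)
  replace c3 : s4.real 40 = sumSq d w := by rw [c3]; simp [a3]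
  -- The accumulator started at `d W` and was multiplied by `d W` in each of the `l + 1` rounds,
  -- which gives the exponent `l + 2`, one more than the exponent `l + 1` of the candidate.
  replace c5 : s4.real 43 = (d * sumSq d w) ^ (l + 2) := by
    rw [c5]
    simp [a3, e2.r2, e2.r5]
    ring
  have hwd : s4.real (100 + d) = w d := (f4.real_eq (by omega) (by omega) le_rfl).trans
    (hw d (by omega))
  have hn11 := e4.n11
  have hn0 := e4.n0
  have hr5 := e4.r5
  refine (halts_block_seq (T :=
    stepTime d k + 1 + stepTime d k + 1 + ((k + 3) ^ d * 6 + 2) + 1 + stepTime d k) _ _ _ _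
    ?_).mono (by simp; omega) (fun _ h => h)
  set s5 := List.foldl (fun s b => Instr.apply b s) s4
      [.realAdd 44 22 5, .natAdd 43 11 0, .realLoad 45 43, .realAdd 13 45 5] with hs5
  have f5 : Frame (102 + d) 13 50 s s5 := by
    rw [hs5]
    simp only [List.foldl_cons, List.foldl_nil]
    iterate 4 refine Frame.apply ?_ (by simp)
    exact f4
  have e5 := he.frame f5 (by omega) (by omega) (by omega)
  have g13 : s5.real 13 = w d := by simp [hs5, hn11, hn0, hwd, hr5]
  have g44 : s5.real 44 = pair ((k + 3) ^ d) inp (mulTab d (k + 3) w (2 * (l + 1)) 0) := by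
    simp [hs5, c7, hr5]
  have g45 : s5.real 45 = w d := by simp [hs5, hn11, hn0, hwd]
  have g40 : s5.real 40 = sumSq d w := by simp [hs5, c3]
  have g43 : s5.real 43 = (d * sumSq d w) ^ (l + 2) := by simp [hs5, c5]
  have g6 : ∀ y, y < (k + 3) ^ d →
      s5.real (102 + d + y) = mulTab d (k + 3) w (2 * (l + 1)) 0 y := by
    intro y hy
    simpa [hs5] using c6 y hy
  clear_value s5
  refine ((halts_stepProg e5 w (fun i hi => (f5.real_eq (by omega) hi (by omega)).trans
    (hw0 i hi)) _ g6).seq (T' := 1 + stepTime d k + 1 + ((k + 3) ^ d * 6 + 2) + 1 + stepTime d k)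
    ?_).mono (by simp only [stepTime]; omega) (fun _ h => h)
  have hs : ∀ i, stepTab d (k + 3) w (w d) (mulTab d (k + 3) w (2 * (l + 1)) i) =
      mulTab d (k + 3) w (2 * (l + 1)) (i + 1) := by
    intro i
    simp only [mulTab, Function.iterate_succ_apply']
  rw [g13, hs]
  rintro s6 ⟨i1, i2, i3, i4⟩
  have i5 := i1.widen (a' := 13) (b' := 50) (by omega) (by omega)
  have f6 := f5.trans i5
  have e6 := he.frame f6 (by omega) (by omega) (by omega)
  have hr6 := e6.r5
  refine (halts_block_seq (T := stepTime d k + 1 + ((k + 3) ^ d * 6 + 2) + 1 + stepTime d k) _ _ _ _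
    ?_).mono (by simp; omega) (fun _ h => h)
  set s7 := List.foldl (fun s b => Instr.apply b s) s6 [.realAdd 46 22 5] with hs7
  have f7 : Frame (102 + d) 13 50 s s7 := by
    rw [hs7]
    simp only [List.foldl_cons, List.foldl_nil]
    exact f6.apply (by simp)
  have e7 := he.frame f7 (by omega) (by omega) (by omega)
  have j46 : s7.real 46 = pair ((k + 3) ^ d) inp (mulTab d (k + 3) w (2 * (l + 1)) 1) := by
    simp [hs7, i4, hr6]
  have hold : ∀ r, r < 46 → r < 20 ∨ 30 ≤ r → s7.real r = s5.real r := by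
    intro r hr hr'
    simp [hs7, hr.ne, i1.real r (by omega) hr']
  have j6 : ∀ y, y < (k + 3) ^ d →
      s7.real (102 + d + y) = mulTab d (k + 3) w (2 * (l + 1)) 1 y := by
    intro y hy
    simpa [hs7] using i3 y hy
  clear_value s7
  refine ((halts_stepProg e7 w (fun i hi => (f7.real_eq (by omega) hi (by omega)).trans
    (hw0 i hi)) _ j6).seq (T' := 1 + ((k + 3) ^ d * 6 + 2) + 1 + stepTime d k)
    ?_).mono (by simp only [stepTime]; omega) (fun _ h => h)
  rw [hold 13 (by omega) (by omega), g13, hs]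
  rintro s8 ⟨k1, k2, k3, k4⟩
  have f8 := f7.trans (k1.widen (a' := 13) (b' := 50) (by omega) (by omega))
  have e8 := he.frame f8 (by omega) (by omega) (by omega)
  have hr8 := e8.r5
  refine (halts_block_seq (T := ((k + 3) ^ d * 6 + 2) + 1 + stepTime d k) _ _ _ _
    ?_).mono (by simp; omega) (fun _ h => h)
  set s9 := List.foldl (fun s b => Instr.apply b s) s8 [.realAdd 47 22 5] with hs9
  have f9 : Frame (102 + d) 13 50 s s9 := by
    rw [hs9]
    simp only [List.foldl_cons, List.foldl_nil]
    exact f8.apply (by simp)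
  have e9 := he.frame f9 (by omega) (by omega) (by omega)
  have j47 : s9.real 47 = pair ((k + 3) ^ d) inp (mulTab d (k + 3) w (2 * (l + 1)) 2) := by
    simp [hs9, k4, hr8]
  have hold' : ∀ r, r < 47 → r < 20 ∨ 30 ≤ r → s9.real r = s7.real r := by
    intro r hr hr'
    simp [hs9, hr.ne, k1.real r (by omega) hr']
  have k6 : ∀ y, y < (k + 3) ^ d →
      s9.real (102 + d + y) = mulTab d (k + 3) w (2 * (l + 1)) 2 y := by
    intro y hy
    simpa [hs9] using k3 y hy
  clear_value s9
  refine ((halts_outputProg e9).seq (T' := 1 + stepTime d k) ?_).mono (by omega) (fun _ h => h)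
  rintro s10 ⟨l1, l2, l3⟩
  have f10 := f9.trans (l1.widen (a' := 13) (b' := 50) (by omega) (by omega))
  have hw10 : ∀ i < d, s10.real (100 + i) = w i := fun i hi =>
    (f10.real_eq (by omega) hi (by omega)).trans (hw0 i hi)
  refine (halts_block_seq (T := stepTime d k) _ _ _ _ ?_).mono (by simp) (fun _ h => h)
  set s11 := List.foldl (fun s b => Instr.apply b s) s10 [.realConst 13 0] with hs11
  have f11 : Frame (102 + d) 13 50 s s11 := by
    rw [hs11]
    simp only [List.foldl_cons, List.foldl_nil]
    exact f10.apply (by simp)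
  have e11 := he.frame f11 (by omega) (by omega) (by omega)
  have m13 : s11.real 13 = 0 := by simp [hs11]
  have mr : ∀ r, 13 < r → s11.real r = s10.real r := by
    intro r hr
    simp [hs11, hr.ne']
  have mo : s11.output = s10.output := by simp [hs11]
  clear_value s11
  refine (halts_stepProg e11 w (fun i hi => (mr _ (by omega)).trans (hw10 i hi))
    (mulTab d (k + 3) w (2 * (l + 1)) 2) (fun y hy => by
      rw [mr _ (by omega), l2 y hy, k6 y hy])).mono (by simp [stepTime]) ?_
  rw [m13]
  rintro s12 ⟨n1, n2, n3, n4⟩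
  have key : ∀ r, 44 ≤ r → r < 50 → s12.real r = s9.real r := fun r hr hr' => by
    rw [n1.real r (by omega) (by omega), mr r (by omega), l1.real r (by omega) (by omega)]
  refine ⟨f11.trans (n1.widen (by omega) (by omega)), ?_, ?_, ?_, ?_, ?_, ?_, n4, ?_⟩
  · rw [n1.real _ (by omega) (by omega), mr _ (by omega), l1.real _ (by omega) (by omega),
      hold' _ (by omega) (by omega), hold _ (by omega) (by omega), g40]
  · rw [n1.real _ (by omega) (by omega), mr _ (by omega), l1.real _ (by omega) (by omega),
      hold' _ (by omega) (by omega), hold _ (by omega) (by omega), g43]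
  · rw [key _ (by omega) (by omega), hold' _ (by omega) (by omega), hold _ (by omega) (by omega),
      g45]
  · rw [key _ (by omega) (by omega), hold' _ (by omega) (by omega), hold _ (by omega) (by omega),
      g44]
  · rw [key _ (by omega) (by omega), hold' _ (by omega) (by omega), j46]
  · rw [key _ (by omega) (by omega), j47]
  · intro y hy
    rw [n2, mo, l3 y hy, k6 y hy, j47]

/-- Tests a candidate. -/
def evalProg : Program :=
  .seq (block (.natAdd 40 31 2) [.natAdd 41 40 40, .natAdd 41 41 2])
    (.branch (.natLt 41 1) (.seq momentsProg compareProg) skipProg)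

/-- The values of a candidate, read off from the digits of its number. -/
noncomputable def candidate (N c i : ℕ) : ℝ := (c / (2 * N + 1) ^ i % (2 * N + 1) : ℕ) - N

/-- The exponent of a candidate, read off from the last digit of its number. -/
def candidateExp (N d c : ℕ) : ℕ := c / (2 * N + 1) ^ (d + 1) % (2 * N + 1) + 1

open Classical in
theorem halts_evalProg {d k N : ℕ} {cM : ℝ} {inp : ℕ → ℝ} {s : State}
    (he : Env d k N cM inp s) (w : ℕ → ℝ) (hw : ∀ i < d + 1, s.real (100 + i) = w i) (l : ℕ)
    (hl : s.nat 31 = l) (hs : s.nat 51 = 0) :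
    Halts evalProg (momentsTime d k l + 20) s (fun s' => Env d k N cM inp s' ∧
      s'.nat 50 = s.nat 50 ∧ s'.nat 51 = (if Accept d k cM inp w (l + 1) then 1 else 0) ∧
      (Accept d k cM inp w (l + 1) →
        ∀ y, y < (k + 3) ^ d → s'.output y = mulTab d (k + 3) w (2 * (l + 1)) 2 y /
          pair ((k + 3) ^ d) inp (mulTab d (k + 3) w (2 * (l + 1)) 2))) := by
  have e2 := he.n2
  refine (halts_block_seq (T := momentsTime d k l + 17) _ _ _ _ ?_).mono
    (by simp; omega) (fun _ h => h)
  set s1 := List.foldl (fun s b => Instr.apply b s) s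
      [.natAdd 40 31 2, .natAdd 41 40 40, .natAdd 41 41 2] with hs1
  have f1 : Frame (102 + d) 13 50 s s1 := by
    rw [hs1]
    simp only [List.foldl_cons, List.foldl_nil]
    iterate 3 refine Frame.apply ?_ (by simp)
    exact Frame.refl _ _ _ _
  have e1 := he.frame f1 (by omega) (by omega) (by omega)
  have h40 : s1.nat 40 = l + 1 := by simp [hs1, hl, e2]
  have h41 : s1.nat 41 = 2 * (l + 1) + 1 := by simp [hs1, hl, e2]; ring
  clear_value s1
  -- The guard is the first clause of `Accept`; it keeps the degree of the candidate polynomial at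
  -- most `k`, and its failure rejects the candidate without any computation.
  refine (Halts.branch (T := momentsTime d k l + 16) (fun hb => ?_) (fun hb => ?_)).mono
    (by omega) (fun _ h => h)
  · simp [h41, e1.n1] at hb
    refine (halts_momentsProg e1 w (fun i hi => (f1.real_eq (by omega) hi (by omega)).trans
      (hw i hi)) l h40).seq ?_
    rintro t ⟨t1, t2, t3, t4, t5, t6, t7, t8, t9⟩
    have f2 := f1.trans t1
    have e2 := he.frame f2 (by omega) (by omega) (by omega)
    refine (halts_compareProg e2 ((f2.nat _ (by omega)).trans hs)
      (Accept d k cM inp w (l + 1)) ?_).mono le_rfl ?_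
    · rw [t2, t3, t4, t5, t6, t7, t8]
      simp only [Accept]
      exact ⟨fun h => h.2, fun h => ⟨hb, h⟩⟩
    · rintro s' ⟨h1, h2, h3, h4⟩
      refine ⟨h1, h2.trans (f2.nat _ (by omega)), h4, fun _ y hy => ?_⟩
      rw [h3, t9 y hy]
  · simp [h41, e1.n1] at hb
    have hn : ¬ Accept d k cM inp w (l + 1) := fun h => absurd h.1 (not_lt.mpr hb)
    refine (halts_block _ _ _ _ ?_).mono (by simp) (fun _ h => h)
    have f2 : Frame (102 + d) 13 50 s ((Instr.natConst 40 0).apply s1) := f1.apply (by simp)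
    refine ⟨he.frame f2 (by omega) (by omega) (by omega), f2.nat 50 (by omega), ?_,
      fun h => absurd h hn⟩
    rw [if_neg hn, ← hs]
    exact f2.nat 51 (by omega)

/-! ### The exhaustive search -/

/-- Goes through the candidates until one of them passes the test. -/
def searchProg : Program :=
  .loop (.natLt 51 2) (.seq decodeProg (.seq evalProg (block (.natAdd 50 50 2) [])))

/-- The time for one candidate. -/
def roundTime (d k N c : ℕ) : ℕ :=
  ((d + 2) * (c * 3 + (2 * N + 1) * 3 + 12) + 3) + (momentsTime d k (2 * N) + 20) + 2

theorem momentsTime_mono (d k : ℕ) {l l' : ℕ} (h : l ≤ l') :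
    momentsTime d k l ≤ momentsTime d k l' := by
  unfold momentsTime
  gcongr

open Classical in
theorem halts_searchProg {d k N : ℕ} {cM : ℝ} {inp : ℕ → ℝ} {s : State}
    (he : Env d k N cM inp s) (h50 : s.nat 50 = 0) (h51 : s.nat 51 = 0) (c : ℕ)
    (hc : Accept d k cM inp (candidate N c) (candidateExp N d c)) :
    Halts searchProg ((c + 1) * roundTime d k N c + 1) s (fun s' => ∃ c' ≤ c,
      Accept d k cM inp (candidate N c') (candidateExp N d c') ∧
      ∀ y, y < (k + 3) ^ d →
        s'.output y = mulTab d (k + 3) (candidate N c') (2 * candidateExp N d c') 2 y /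
          pair ((k + 3) ^ d) inp
            (mulTab d (k + 3) (candidate N c') (2 * candidateExp N d c') 2)) := by
  have hex : ∃ c, Accept d k cM inp (candidate N c) (candidateExp N d c) := ⟨c, hc⟩
  -- The loop stops at the least accepted number. The number `c` in the hypothesis only guarantees
  -- termination and bounds the time; the output may come from a smaller one.
  set c' := Nat.find hex with hc'
  have hle : c' ≤ c := Nat.find_min' hex hc
  have hacc : Accept d k cM inp (candidate N c') (candidateExp N d c') := Nat.find_spec hex
  -- Every number below `c'` is rejected by minimality, so cell `51` becomes one exactly after round
  -- `c'`.
  refine (Halts.loop (T := roundTime d k N c - 1) (m := c' + 1) (j := 0) (fun j s' =>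
    Env d k N cM inp s' ∧ s'.nat 50 = j ∧ s'.nat 51 = (if j = c' + 1 then 1 else 0) ∧
    (j = c' + 1 → ∀ y, y < (k + 3) ^ d →
        s'.output y = mulTab d (k + 3) (candidate N c') (2 * candidateExp N d c') 2 y /
          pair ((k + 3) ^ d) inp
            (mulTab d (k + 3) (candidate N c') (2 * candidateExp N d c') 2)))
    ?_ ?_ (c' + 1) (by omega) ?_).mono ?_ ?_
  · rintro s' ⟨h1, h2, h3, -⟩
    simp [h3, h1.n2]
  · rintro j s' hj ⟨h1, h2, h3, -⟩
    rw [if_neg hj.ne] at h3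
    refine ⟨by simp [h3, h1.n2], ?_⟩
    refine ((halts_decodeProg h1 j h2).seq (T' := momentsTime d k (2 * N) + 21) ?_).mono ?_
      (fun _ h => h)
    swap
    · unfold roundTime
      have : (d + 2) * (j * 3 + (2 * N + 1) * 3 + 12) ≤
          (d + 2) * (c * 3 + (2 * N + 1) * 3 + 12) := by
        have : j ≤ c := by omega
        gcongr
      omega
    rintro t ⟨t1, t2, t3⟩
    have e1 := h1.frame t1 (by omega) (by omega) (by omega)
    refine ((halts_evalProg e1 (candidate N j) (fun i hi => t2 i (by omega)) _ t3
      ((t1.nat _ (by omega)).trans h3)).seq (T' := 1) ?_).mono ?_ (fun _ h => h)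
    swap
    · have hlt := Nat.mod_lt (j / (2 * N + 1) ^ (d + 1)) (show 2 * N + 1 > 0 by omega)
      have := momentsTime_mono d k (Nat.le_of_lt_succ hlt)
      omega
    rintro u ⟨u1, u2, u3, u4⟩
    have hu : Frame 100 50 51 u ((Instr.natAdd 50 50 2).apply u) :=
      (Frame.refl _ _ _ _).apply (by simp)
    refine (halts_block _ _ _ _ ?_).mono (by simp) (fun _ h => h)
    refine ⟨u1.frame hu (by omega) (by omega) (by omega), ?_, ?_, ?_⟩
    · have h50' := t1.nat 50 (by omega)
      simp [u2, u1.n2, h50', h2]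
    · have : Accept d k cM inp (candidate N j) (candidateExp N d j) ↔ j + 1 = c' + 1 := by
        constructor
        · intro h
          have := Nat.find_min' hex h
          omega
        · intro h
          obtain rfl : j = c' := by omega
          exact hacc
      rw [← candidateExp] at u3
      simp only [this] at u3
      simp [u3]
    · intro hj'
      obtain rfl : j = c' := by omega
      exact u4 hacc
  · exact ⟨he, h50, by simp [h51], by simp⟩
  · have : roundTime d k N c - 1 + 1 = roundTime d k N c := by unfold roundTime; omega
    rw [this]
    gcongr
  · rintro s' ⟨-, -, -, h⟩
    exact ⟨c', hle, hacc, h rfl⟩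

/-! ### Computing the constants -/

/-- The state while the constants are being computed. -/
structure PreEnv (d k n4 n5 cnt : ℕ) (r0 r1 r2 r3 : ℝ) (inp : ℕ → ℝ) (s : State) : Prop where
  n0 : s.nat 0 = d
  n1 : s.nat 1 = k
  n2 : s.nat 2 = 1
  n3 : s.nat 3 = k + 3
  n4 : s.nat 4 = n4
  n5 : s.nat 5 = n5
  n7 : s.nat 7 = 0
  n10 : s.nat 10 = d + 2
  n11 : s.nat 11 = 100
  n12 : s.nat 12 = 102 + d
  n50 : s.nat 50 = 0
  n51 : s.nat 51 = 0
  pow : ∀ i, i ≤ cnt → s.nat (100 + i) = (k + 3) ^ i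
  r0 : s.real 0 = r0
  r1 : s.real 1 = r1
  r2 : s.real 2 = r2
  r3 : s.real 3 = r3
  r4 : s.real 4 = 1
  r5 : s.real 5 = 0
  inp : s.input = inp

theorem PreEnv.frame {d k n4 n5 cnt : ℕ} {r0 r1 r2 r3 : ℝ} {inp : ℕ → ℝ} {s s' : State}
    (h : PreEnv d k n4 n5 cnt r0 r1 r2 r3 inp s) (hf : Frame 100 40 50 s s') :
    PreEnv d k n4 n5 cnt r0 r1 r2 r3 inp s' where
  n0 := (hf.nat _ (by omega)).trans h.n0
  n1 := (hf.nat _ (by omega)).trans h.n1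
  n2 := (hf.nat _ (by omega)).trans h.n2
  n3 := (hf.nat _ (by omega)).trans h.n3
  n4 := (hf.nat _ (by omega)).trans h.n4
  n5 := (hf.nat _ (by omega)).trans h.n5
  n7 := (hf.nat _ (by omega)).trans h.n7
  n10 := (hf.nat _ (by omega)).trans h.n10
  n11 := (hf.nat _ (by omega)).trans h.n11
  n12 := (hf.nat _ (by omega)).trans h.n12
  n50 := (hf.nat _ (by omega)).trans h.n50
  n51 := (hf.nat _ (by omega)).trans h.n51
  pow i hi := (hf.nat _ (by omega)).trans (h.pow i hi)
  r0 := (hf.real _ (by omega) (by omega)).trans h.r0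
  r1 := (hf.real _ (by omega) (by omega)).trans h.r1
  r2 := (hf.real _ (by omega) (by omega)).trans h.r2
  r3 := (hf.real _ (by omega) (by omega)).trans h.r3
  r4 := (hf.real _ (by omega) (by omega)).trans h.r4
  r5 := (hf.real _ (by omega) (by omega)).trans h.r5
  inp := hf.input.trans h.inp

/-- Computes the constants. -/
def setupProg : Program :=
  .seq (block (.natConst 2 1) [.natConst 3 3, .natAdd 3 1 3, .natConst 11 100, .natConst 12 102,
    .natAdd 12 12 0, .natConst 10 2, .natAdd 10 10 0, .realConst 4 1, .natConst 100 1,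
    .realConst 0 1, .realConst 3 (-1), .natConst 5 1])
  (.seq (forLoop 42 0 (.seq (block (.natAdd 43 11 42) [.natLoad 44 43, .natConst 45 0])
    (.seq (forLoop 46 3 (block (.natAdd 45 45 44) []))
      (block (.natAdd 43 43 2) [.natStore 43 45]))))
  (.seq (block (.natAdd 43 11 0) [.natLoad 4 43])
  (.seq (forLoop 42 1 (block (.realAdd 0 0 0) []))
  (.seq (forLoop 42 0 (block (.realAdd 2 2 4) []))
  (.seq (block (.natAdd 43 1 2) [])
  (.seq (.loop (.natLt 0 43) (block (.natSub 43 43 0) [.natAdd 5 5 5, .realAdd 3 3 3]))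
  (.seq (forLoop 42 0 (block (.natAdd 43 11 42) [.natLoad 44 43, .natAdd 44 44 44, .natAdd 44 44 2,
    .read 40 44, .realAdd 1 1 40]))
  (block (.read 40 7) [.realSub 40 4 40, .realMul 1 40 1, .natAdd 6 5 5, .natAdd 6 6 2]))))))))

theorem halts_setupProg {d k : ℕ} (hd : 0 < d) {inp : ℕ → ℝ} {s : State}
    (hn : ∀ r, s.nat r = if r = 0 then d else if r = 1 then k else 0) (hr : ∀ r, s.real r = 0)
    (hi : s.input = inp) :
    Halts setupProg (13 + (d * ((k + 3) * 3 + 9) + 2) + 2 + (k * 3 + 2) + (d * 3 + 2) + 1 +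
      (k * 4 + 1) + (d * 8 + 2) + 5) s (fun s' =>
        Env d k (2 ^ (k / d)) ((1 - inp 0) * ∑ i ∈ Finset.range d, inp (2 * (k + 3) ^ i + 1))
          inp s' ∧ s'.nat 50 = 0 ∧ s'.nat 51 = 0) := by
  refine (halts_block_seq (T := (d * ((k + 3) * 3 + 9) + 2) + 2 + (k * 3 + 2) + (d * 3 + 2) + 1 +
      (k * 4 + 1) + (d * 8 + 2) + 5) _ _ _ _ ?_).mono (by simp; omega) (fun _ h => h)
  have p1 : PreEnv d k 0 1 0 1 0 0 (-1) inp (List.foldl (fun s b => Instr.apply b s) s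
      [.natConst 2 1, .natConst 3 3, .natAdd 3 1 3, .natConst 11 100, .natConst 12 102,
    .natAdd 12 12 0, .natConst 10 2, .natAdd 10 10 0, .realConst 4 1, .natConst 100 1,
    .realConst 0 1, .realConst 3 (-1), .natConst 5 1]) := by
    constructor <;> simp [hn, hr, hi, add_comm]
  refine ((halts_forLoop (m := d) (T := (k + 3) * 3 + 7) (fun j s' => s'.nat 42 = j ∧
    PreEnv d k 0 1 j 1 0 0 (-1) inp s') ?_ ?_ ?_).seq (T' := 2 + (k * 3 + 2) + (d * 3 + 2) + 1 +
      (k * 4 + 1) + (d * 8 + 2) + 5) ?_).mono (by rw [add_assoc _ 7 2]; omega) (fun _ h => h)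
  · rintro j s' ⟨h1, h2⟩
    exact ⟨h1, h2.n0⟩
  · rintro j s' hj ⟨h1, h⟩
    refine (halts_block_seq (T := (k + 3) * 3 + 4) _ _ _ _ ?_).mono
      (by simp; omega) (fun _ h => h)
    refine ((halts_forLoop (m := k + 3) (T := 1) (fun i s' => s'.nat 46 = i ∧ s'.nat 42 = j ∧
      s'.nat 43 = 100 + j ∧ s'.nat 44 = (k + 3) ^ j ∧ s'.nat 45 = i * (k + 3) ^ j ∧
      PreEnv d k 0 1 j 1 0 0 (-1) inp s') ?_ ?_ ?_).seq (T' := 2) ?_).mono (by omega)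
      (fun _ h => h)
    · rintro i s' ⟨h1, h2, h3, h4, h5, h6⟩
      exact ⟨h1, h6.n3⟩
    · rintro i s' hi ⟨h1, h2, h3, h4, h5, h6⟩
      refine (halts_block _ _ _ _ ?_).mono (by simp) (fun _ h => h)
      refine ⟨by simp [h1, h6.n2], by simp [h2], by simp [h3], by simp [h4],
        by simp [h4, h5]; ring, h6.frame ?_⟩
      simp only [List.foldl_cons, List.foldl_nil]
      iterate 2 refine Frame.apply ?_ (by simp)
      exact Frame.refl _ _ _ _
    · refine ⟨by simp, by simp [h1], by simp [h1, h.n11], by simp [h1, h.n11, h.pow j le_rfl],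
        by simp, h.frame ?_⟩
      simp only [List.foldl_cons, List.foldl_nil]
      iterate 4 refine Frame.apply ?_ (by simp)
      exact Frame.refl _ _ _ _
    · rintro s' ⟨h1, h2, h3, h4, h5, h6⟩
      refine (halts_block _ _ _ _ ?_).mono (by simp) (fun _ h => h)
      refine ⟨by simp [h2, h3, h6.n2, add_assoc], ?_⟩
      constructor <;> simp [h6.n0, h6.n1, h6.n2, h6.n3, h6.n4, h6.n5, h6.n7, h6.n10, h6.n11,
        h6.n12, h6.n50, h6.n51, h6.r0, h6.r1, h6.r2, h6.r3, h6.r4, h6.r5, h6.inp, h3, add_assoc]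
      intro i hi
      rcases hi.eq_or_lt with rfl | hi
      · simp [h5, pow_succ, mul_comm]
      · simp [hi.ne, h6.pow i (by omega)]
  · exact ⟨by simp, p1.frame (Frame.apply (Frame.refl _ _ _ _) (by simp))⟩
  rintro s1 ⟨-, h1⟩
  refine (halts_block_seq (T := (k * 3 + 2) + (d * 3 + 2) + 1 +
      (k * 4 + 1) + (d * 8 + 2) + 5) _ _ _ _ ?_).mono (by simp; omega) (fun _ h => h)
  have p2 : PreEnv d k ((k + 3) ^ d) 1 d 1 0 0 (-1) inp (List.foldl
      (fun s b => Instr.apply b s) s1 [.natAdd 43 11 0, .natLoad 4 43]) := by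
    constructor <;> simp [h1.n0, h1.n1, h1.n2, h1.n3, h1.n4, h1.n5, h1.n7, h1.n10, h1.n11,
        h1.n12, h1.n50, h1.n51, h1.r0, h1.r1, h1.r2, h1.r3, h1.r4, h1.r5, h1.inp, h1.pow d le_rfl]
    exact h1.pow
  refine ((halts_forLoop (m := k) (T := 1) (fun j s' => s'.nat 42 = j ∧
    PreEnv d k ((k + 3) ^ d) 1 d (2 ^ j) 0 0 (-1) inp s') ?_ ?_ ?_).seq (T' := (d * 3 + 2) + 1 +
      (k * 4 + 1) + (d * 8 + 2) + 5) ?_).mono (by omega) (fun _ h => h)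
  · rintro j s' ⟨h1, h2⟩
    exact ⟨h1, h2.n1⟩
  · rintro j s' hj ⟨h1, h⟩
    refine (halts_block _ _ _ _ ?_).mono (by simp) (fun _ h => h)
    refine ⟨by simp [h1, h.n2], PreEnv.frame (s := (Instr.realAdd 0 0 0).apply s') ?_
      (Frame.apply (Frame.refl _ _ _ _) (by simp))⟩
    constructor <;> simp [h.n0, h.n1, h.n2, h.n3, h.n4, h.n5, h.n7, h.n10, h.n11,
        h.n12, h.n50, h.n51, h.r0, h.r1, h.r2, h.r3, h.r4, h.r5, h.inp]
    · exact h.pow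
    · ring
  · rw [pow_zero]
    exact ⟨by simp, p2.frame (Frame.apply (Frame.refl _ _ _ _) (by simp))⟩
  rintro s2 ⟨-, p3⟩
  refine ((halts_forLoop (m := d) (T := 1) (fun j s' => s'.nat 42 = j ∧
    PreEnv d k ((k + 3) ^ d) 1 d (2 ^ k) 0 j (-1) inp s') ?_ ?_ ?_).seq (T' := 1 +
      (k * 4 + 1) + (d * 8 + 2) + 5) ?_).mono (by omega) (fun _ h => h)
  · rintro j s' ⟨h1, h2⟩
    exact ⟨h1, h2.n0⟩
  · rintro j s' hj ⟨h1, h⟩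
    refine (halts_block _ _ _ _ ?_).mono (by simp) (fun _ h => h)
    refine ⟨by simp [h1, h.n2], PreEnv.frame (s := (Instr.realAdd 2 2 4).apply s') ?_
      (Frame.apply (Frame.refl _ _ _ _) (by simp))⟩
    constructor <;> simp [h.n0, h.n1, h.n2, h.n3, h.n4, h.n5, h.n7, h.n10, h.n11,
        h.n12, h.n50, h.n51, h.r0, h.r1, h.r2, h.r3, h.r4, h.r5, h.inp]
    exact h.pow
  · rw [Nat.cast_zero]
    exact ⟨by simp, p3.frame (Frame.apply (Frame.refl _ _ _ _) (by simp))⟩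
  rintro s3 ⟨-, p4⟩
  refine (halts_block_seq (T := (k * 4 + 1) + (d * 8 + 2) + 5) _ _ _ _ ?_).mono
    (by simp; omega) (fun _ h => h)
  have hkd : d * (k / d) ≤ k := Nat.mul_div_le k d
  have hkd' : k < d * (k / d) + d := by
    have := Nat.lt_mul_div_succ k hd
    rwa [mul_add, mul_one] at this
  have hkd'' : k / d ≤ k := Nat.div_le_self _ _
  -- Starting from `k + 1` instead of `k` turns the strict test into `d ≤ k - d j`, so there are `k
  -- / d` rounds. Each doubles cells `nat 5` and `real 3`, which end as `2 ^ (k / d)` and its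
  -- negative.
  refine ((Halts.loop (T := 3) (m := k / d) (j := 0) (fun j s' => s'.nat 43 = k + 1 - d * j ∧
    PreEnv d k ((k + 3) ^ d) (2 ^ j) d (2 ^ k) 0 d (-2 ^ j) inp s') ?_ ?_ (k / d) (by omega)
    ?_).seq (T' := (d * 8 + 2) + 5) ?_).mono (by omega) (fun _ h => h)
  · rintro s' ⟨h1, h2⟩
    simp [h1, h2.n0]
    omega
  · rintro j s' hj ⟨h1, h⟩
    have hmul : d * (j + 1) ≤ d * (k / d) := Nat.mul_le_mul_left _ hj
    rw [mul_add, mul_one] at hmul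
    refine ⟨by simp [h1, h.n0]; omega, ?_⟩
    refine (halts_block _ _ _ _ ?_).mono (by simp) (fun _ h => h)
    refine ⟨by simp [h1, h.n0, mul_add]; omega, ?_⟩
    constructor <;> simp [h.n0, h.n1, h.n2, h.n3, h.n4, h.n5, h.n7, h.n10, h.n11,
        h.n12, h.n50, h.n51, h.r0, h.r1, h.r2, h.r3, h.r4, h.r5, h.inp]
    · ring
    · exact h.pow
    · ring
  · refine ⟨by simp [p4.n1, p4.n2], ?_⟩
    rw [pow_zero, pow_zero]
    exact p4.frame (Frame.apply (I := .natAdd 43 1 2) (Frame.refl _ _ _ _) (by simp))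
  rintro s4 ⟨-, p5⟩
  -- The monomial `x i ^ 2` has the number `2 * (k + 3) ^ i`, and the moments start at input cell
  -- `1`, behind `δ`; the loop thus sums up the expectation of the squared norm.
  refine ((halts_forLoop (m := d) (T := 6) (fun j s' => s'.nat 42 = j ∧
    PreEnv d k ((k + 3) ^ d) (2 ^ (k / d)) d (2 ^ k)
      (∑ i ∈ Finset.range j, inp (2 * (k + 3) ^ i + 1)) d (-2 ^ (k / d)) inp s') ?_ ?_ ?_).seq
      (T' := 5) ?_).mono (by omega) (fun _ h => h)
  · rintro j s' ⟨h1, h2⟩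
    exact ⟨h1, h2.n0⟩
  · rintro j s' hj ⟨h1, h⟩
    refine (halts_block _ _ _ _ ?_).mono (by simp) (fun _ h => h)
    refine ⟨by simp [h1, h.n2], ?_⟩
    constructor <;> simp [h.n0, h.n1, h.n2, h.n3, h.n4, h.n5, h.n7, h.n10, h.n11,
        h.n12, h.n50, h.n51, h.r0, h.r1, h.r2, h.r3, h.r4, h.r5, h.inp, h1, h.pow j hj.le,
        Finset.sum_range_succ, two_mul]
    exact h.pow
  · rw [Finset.sum_range_zero]
    exact ⟨by simp, p5.frame (Frame.apply (Frame.refl _ _ _ _) (by simp))⟩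
  rintro s5 ⟨-, h⟩
  refine (halts_block _ _ _ _ ?_).mono (by simp) (fun _ h => h)
  refine ⟨?_, by simp [h.n50], by simp [h.n51]⟩
  constructor <;> simp [h.n0, h.n1, h.n2, h.n3, h.n4, h.n5, h.n7, h.n10, h.n11,
        h.n12, h.n50, h.n51, h.r0, h.r1, h.r2, h.r3, h.r4, h.r5, h.inp]
  · ring
  · exact h.pow

end Machine

/-! ### Tables of polynomials -/

/-- Kronecker substitution. -/
noncomputable def kron (d b : ℕ) : MvPolynomial (Fin d) ℝ →ₐ[ℝ] Polynomial ℝ :=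
  aeval (fun i : Fin d => (Polynomial.X : Polynomial ℝ) ^ (b ^ (i : ℕ)))

/-- The table of the coefficients of a polynomial. -/
noncomputable def tab (d b : ℕ) (p : MvPolynomial (Fin d) ℝ) (x : ℕ) : ℝ := (kron d b p).coeff x

/-- The linear form with the coefficients `w 0, …, w (d - 1)`. -/
noncomputable def formOf (d : ℕ) (w : ℕ → ℝ) : MvPolynomial (Fin d) ℝ :=
  ∑ i : Fin d, C (w i) * X i

theorem tab_one (d b : ℕ) : tab d b 1 = oneTab := by
  funext x
  simp [tab, oneTab, Polynomial.coeff_one]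

/-- Kronecker substitution sends `X i` to a power of one variable, so multiplication by `X i` shifts
the table by `b ^ i`. It is an algebra homomorphism, so this needs no condition on `b` or on the
degree; those matter only when coefficients are read off. -/
theorem stepTab_tab (d b : ℕ) (w : ℕ → ℝ) (A : ℝ) (p : MvPolynomial (Fin d) ℝ) :
    stepTab d b w A (tab d b p) = tab d b ((C A + formOf d w) * p) := by
  funext x
  have hC : ∀ a : ℝ, kron d b (C a) = Polynomial.C a := fun a => by
    simp [kron, ← MvPolynomial.algebraMap_eq]
  have hX : ∀ i : Fin d, kron d b (X i) = Polynomial.X ^ (b ^ (i : ℕ)) := fun i => by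
    simp [kron]
  simp only [tab, stepTab, formOf, map_mul, map_add, map_sum, hC, hX, add_mul, Finset.sum_mul,
    Polynomial.coeff_add, Polynomial.finsetSum_coeff, mul_assoc, Polynomial.coeff_C_mul,
    Polynomial.coeff_X_pow_mul']
  rw [Finset.sum_range]
  congr 1
  refine Finset.sum_congr rfl fun i _ => ?_
  by_cases h : x < b ^ (i : ℕ)
  · simp [h, not_le.mpr h]
  · simp [h, not_lt.mp h]

theorem mulTab_eq (d b : ℕ) (w : ℕ → ℝ) (j i : ℕ) :
    mulTab d b w j i = tab d b (formOf d w ^ j * (C (w d) + formOf d w) ^ i) := by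
  have h0 : (stepTab d b w 0)^[j] oneTab = tab d b (formOf d w ^ j) := by
    induction j with
    | zero => rw [Function.iterate_zero, pow_zero, tab_one]; rfl
    | succ j ih =>
      rw [Function.iterate_succ_apply', ih, stepTab_tab, C_0, zero_add, pow_succ, mul_comm]
  induction i with
  | zero => rw [mulTab, h0, pow_zero, mul_one, Function.iterate_zero]; rfl
  | succ i ih =>
    rw [mulTab, Function.iterate_succ_apply', ← mulTab, ih, stepTab_tab]
    congr 1
    ring

/-- The exponent vectors with entries below `k + 3` and their numbers. -/
theorem exponent_inj {d k : ℕ} {a a' : ℕ} (ha : a < (k + 3) ^ d) (ha' : a' < (k + 3) ^ d)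
    (h : exponent d k a = exponent d k a') : a = a' := by
  have := (finFunctionFinEquiv (m := k + 3) (n := d)).symm.injective
    (a₁ := ⟨a, ha⟩) (a₂ := ⟨a', ha'⟩) (by
      funext i
      apply Fin.ext
      have := DFunLike.congr_fun h i
      simpa [exponent] using this)
  simpa using this

/-- The number of an exponent vector. -/
def number (d k : ℕ) (α : Fin d →₀ ℕ) : ℕ := ∑ i, α i * (k + 3) ^ (i : ℕ)

theorem number_spec {d k : ℕ} (α : Fin d →₀ ℕ) (h : ∀ i, α i < k + 3) :
    number d k α < (k + 3) ^ d ∧ exponent d k (number d k α) = α := by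
  set e := finFunctionFinEquiv (m := k + 3) (n := d) with he
  have hv : (e (fun i => ⟨α i, h i⟩) : ℕ) = number d k α := by
    simp [he, number]
  refine ⟨hv ▸ (e _).2, ?_⟩
  ext i
  have := congrArg Fin.val (congrFun (e.symm_apply_apply (fun i => ⟨α i, h i⟩)) i)
  rw [he, finFunctionFinEquiv_symm_apply_val, ← he, hv] at this
  simpa [exponent] using this

theorem number_exponent {d k a : ℕ} (ha : a < (k + 3) ^ d) :
    number d k (exponent d k a) = a := by
  have h : ∀ i, exponent d k a i < k + 3 := fun i => by
    simpa [exponent] using Nat.mod_lt _ (by omega)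
  obtain ⟨h1, h2⟩ := number_spec _ h
  exact exponent_inj h1 ha h2

theorem degree_le_of_mem_support {d : ℕ} {p : MvPolynomial (Fin d) ℝ}
    {α : Fin d →₀ ℕ} (hα : α ∈ p.support) : α.degree ≤ p.totalDegree :=
  le_totalDegree hα

theorem lt_of_mem_support {d k : ℕ} {p : MvPolynomial (Fin d) ℝ} (hp : p.totalDegree ≤ k + 2)
    {α : Fin d →₀ ℕ} (hα : α ∈ p.support) (i : Fin d) : α i < k + 3 := by
  have h1 : α i ≤ α.degree := Finsupp.le_degree i α
  have h2 := degree_le_of_mem_support hα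
  omega

/-- In degree at most `k + 2` all exponents are digits in base `k + 3`, so distinct monomials are
sent to distinct powers and no coefficients are merged. -/
theorem tab_eq_coeff {d k : ℕ} {p : MvPolynomial (Fin d) ℝ} (hp : p.totalDegree ≤ k + 2) {a : ℕ}
    (ha : a < (k + 3) ^ d) : tab d (k + 3) p a = p.coeff (exponent d k a) := by
  have h1 : kron d (k + 3) p = ∑ α ∈ p.support,
      Polynomial.C (p.coeff α) * Polynomial.X ^ number d k α := by
    rw [kron, aeval_def, eval₂_eq']
    refine Finset.sum_congr rfl fun α _ => ?_
    rw [Polynomial.algebraMap_eq, number, ← Finset.prod_pow_eq_pow_sum]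
    congr 1
    refine Finset.prod_congr rfl fun i _ => ?_
    rw [← pow_mul, mul_comm]
  rw [tab, h1, Polynomial.finsetSum_coeff]
  simp only [Polynomial.coeff_C_mul, Polynomial.coeff_X_pow, mul_ite, mul_one, mul_zero]
  rw [Finset.sum_eq_single (exponent d k a)]
  · rw [number_exponent ha, if_pos rfl]
  · intro α hα hne
    rw [if_neg]
    rintro rfl
    exact hne (number_spec α (lt_of_mem_support hp hα)).2.symm
  · intro h
    rw [notMem_support_iff.mp h, ite_self]

/-- The entries of `inp` at exponents of degree above `k + 2` are unconstrained, but there the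
coefficient of `p` vanishes. -/
theorem pair_tab {d k : ℕ} {p : MvPolynomial (Fin d) ℝ} (hp : p.totalDegree ≤ k + 2)
    (L : MvPolynomial (Fin d) ℝ →ₗ[ℝ] ℝ) (inp : ℕ → ℝ)
    (hinp : ∀ a, (exponent d k a).degree ≤ k + 2 →
      inp (a + 1) = L (monomial (exponent d k a) 1)) :
    pair ((k + 3) ^ d) inp (tab d (k + 3) p) = L p := by
  have h1 : pair ((k + 3) ^ d) inp (tab d (k + 3) p) = ∑ a ∈ Finset.range ((k + 3) ^ d),
      p.coeff (exponent d k a) * L (monomial (exponent d k a) 1) := by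
    refine Finset.sum_congr rfl fun a ha => ?_
    rw [tab_eq_coeff hp (Finset.mem_range.mp ha)]
    by_cases h : exponent d k a ∈ p.support
    · rw [hinp a ((degree_le_of_mem_support h).trans hp)]
    · rw [notMem_support_iff.mp h, zero_mul, zero_mul]
  rw [h1]
  conv_rhs => rw [p.as_sum, map_sum]
  symm
  have h2 : ∀ α : Fin d →₀ ℕ, L (monomial α (p.coeff α)) = p.coeff α * L (monomial α 1) := by
    intro α
    rw [← smul_eq_mul, ← map_smul, smul_monomial, smul_eq_mul, mul_one]
  simp_rw [h2]
  refine Finset.sum_of_injOn (number d k) ?_ ?_ ?_ ?_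
  · intro α hα β hβ h
    rw [← (number_spec α (lt_of_mem_support hp hα)).2, h,
      (number_spec β (lt_of_mem_support hp hβ)).2]
  · intro α hα
    simpa using (number_spec α (lt_of_mem_support hp hα)).1
  · intro a ha ha'
    rw [notMem_support_iff.mp, zero_mul]
    intro h
    exact ha' ⟨_, h, number_exponent (Finset.mem_range.mp ha)⟩
  · intro α hα
    rw [(number_spec α (lt_of_mem_support hp hα)).2]

/-! ### Pseudo-expectations of polynomials -/

/-- The properties of a (pseudo-)expectation over the unit ball, on polynomials. -/
structure BallFunctional (d m : ℕ) (L : MvPolynomial (Fin d) ℝ →ₗ[ℝ] ℝ) : Prop where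
  one : L 1 = 1
  sq_nonneg : ∀ f : MvPolynomial (Fin d) ℝ, 2 * f.totalDegree ≤ m → 0 ≤ L (f ^ 2)
  ball_nonneg : ∀ f : MvPolynomial (Fin d) ℝ, 2 + 2 * f.totalDegree ≤ m →
    0 ≤ L ((1 - ∑ i, X i ^ 2) * f ^ 2)

/-- The squared norm as a polynomial. -/
noncomputable def normSq (d : ℕ) : MvPolynomial (Fin d) ℝ := ∑ i, X i ^ 2

theorem totalDegree_mul_le_of {d a b : ℕ} {f g : MvPolynomial (Fin d) ℝ}
    (hf : f.totalDegree ≤ a) (hg : g.totalDegree ≤ b) : (f * g).totalDegree ≤ a + b :=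
  (totalDegree_mul _ _).trans (add_le_add hf hg)

theorem totalDegree_pow_le_of {d a : ℕ} {f : MvPolynomial (Fin d) ℝ}
    (hf : f.totalDegree ≤ a) (n : ℕ) : (f ^ n).totalDegree ≤ n * a :=
  (totalDegree_pow _ _).trans (Nat.mul_le_mul_left _ hf)

theorem totalDegree_add_le_of {d a : ℕ} {f g : MvPolynomial (Fin d) ℝ}
    (hf : f.totalDegree ≤ a) (hg : g.totalDegree ≤ a) : (f + g).totalDegree ≤ a :=
  (totalDegree_add _ _).trans (max_le hf hg)

theorem totalDegree_formOf (d : ℕ) (w : ℕ → ℝ) : (formOf d w).totalDegree ≤ 1 := by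
  refine totalDegree_finsetSum_le fun i _ => ?_
  refine (totalDegree_mul_le_of (a := 0) (b := 1) ?_ ?_)
  · rw [totalDegree_C]
  · rw [totalDegree_X]

theorem totalDegree_normSq (d : ℕ) : (normSq d).totalDegree ≤ 2 := by
  refine totalDegree_finsetSum_le fun i _ => ?_
  rw [totalDegree_X_pow]

/-- The monomial with the given exponents. -/
noncomputable def mono {d : ℕ} (β : Fin d → ℕ) : MvPolynomial (Fin d) ℝ := ∏ i, X i ^ β i

theorem totalDegree_mono {d : ℕ} (β : Fin d → ℕ) : (mono β).totalDegree ≤ ∑ i, β i := by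
  refine (totalDegree_finsetProd _ _).trans (Finset.sum_le_sum fun i _ => ?_)
  rw [totalDegree_X_pow]

theorem mono_double {d : ℕ} (α : Fin d → ℕ) : mono (fun i => 2 * α i) = mono α ^ 2 := by
  simp only [mono, ← Finset.prod_pow, ← pow_mul, mul_comm]

/-- The multinomial theorem for the pseudo-expectation of a power of a linear form. -/
theorem map_formOf_pow {d : ℕ} (L : MvPolynomial (Fin d) ℝ →ₗ[ℝ] ℝ) (w : ℕ → ℝ) (m : ℕ) :
    L (formOf d w ^ m) = ∑ β ∈ Finset.piAntidiag Finset.univ m,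
      (Nat.multinomial Finset.univ β : ℝ) * (∏ i : Fin d, w i ^ β i) * L (mono β) := by
  rw [formOf, Finset.sum_pow_eq_sum_piAntidiag, map_sum]
  refine Finset.sum_congr rfl fun β _ => ?_
  have : (Nat.multinomial Finset.univ β : MvPolynomial (Fin d) ℝ) *
      ∏ i : Fin d, (C (w i) * X i) ^ β i =
      ((Nat.multinomial Finset.univ β : ℝ) * ∏ i : Fin d, w i ^ β i) • mono β := by
    simp only [mul_pow, Finset.prod_mul_distrib, smul_eq_C_mul, C_mul, mono, map_prod, map_pow,
      map_natCast, mul_assoc]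
  rw [this, map_smul, smul_eq_mul]

theorem map_normSq_pow {d : ℕ} (L : MvPolynomial (Fin d) ℝ →ₗ[ℝ] ℝ) (n : ℕ) :
    L (normSq d ^ n) = ∑ α ∈ Finset.piAntidiag Finset.univ n,
      (Nat.multinomial Finset.univ α : ℝ) * L (mono α ^ 2) := by
  rw [normSq, Finset.sum_pow_eq_sum_piAntidiag, map_sum]
  refine Finset.sum_congr rfl fun α _ => ?_
  have : (Nat.multinomial Finset.univ α : MvPolynomial (Fin d) ℝ) *
      ∏ i : Fin d, (X i ^ 2) ^ α i =
      (Nat.multinomial Finset.univ α : ℝ) • mono α ^ 2 := by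
    rw [← mono_double]
    simp only [smul_eq_C_mul, mono, ← pow_mul, map_natCast]
  rw [this, map_smul, smul_eq_mul]

/-- One of the signs of the coordinates makes the pseudo-expectation of `u ^ (2 * n)` at least the
part of one even monomial. -/
theorem exists_sign {d m n : ℕ} {L : MvPolynomial (Fin d) ℝ →ₗ[ℝ] ℝ} (hL : BallFunctional d m L)
    (hn : 2 * n ≤ m) (w : Fin d → ℝ) (α : Fin d → ℕ) (hα : ∑ i, α i = n) :
    ∃ σ : Fin d → Bool, ∀ w' : ℕ → ℝ, (∀ i : Fin d, w' i = (if σ i then w i else - w i)) →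
      (Nat.multinomial Finset.univ (fun i => 2 * α i) : ℝ) * (∏ i, w i ^ (2 * α i)) *
        L (mono α ^ 2) ≤ L (formOf d w' ^ (2 * n)) := by
  classical
  set A := (Nat.multinomial Finset.univ (fun i => 2 * α i) : ℝ) * (∏ i, w i ^ (2 * α i)) *
        L (mono α ^ 2) with hA
  set v : (Fin d → Bool) → Fin d → ℝ := fun σ i => if σ i then w i else - w i with hv
  set G : (Fin d → Bool) → ℝ := fun σ => ∑ β ∈ Finset.piAntidiag Finset.univ (2 * n),
      (Nat.multinomial Finset.univ β : ℝ) * (∏ i : Fin d, v σ i ^ β i) * L (mono β) with hG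
  -- Sum over all `2 ^ d` sign patterns. Monomials with an odd exponent cancel; those with only even
  -- exponents are squares and contribute nonnegatively. Dropping all of them except `2 α` gives a
  -- lower bound, and some pattern reaches the average.
  have hsum : ∑ _σ : Fin d → Bool, A ≤ ∑ σ, G σ := by
    have h1 : ∑ σ, G σ = ∑ β ∈ Finset.piAntidiag Finset.univ (2 * n),
      (Nat.multinomial Finset.univ β : ℝ) * (∏ i : Fin d, (w i ^ β i + (- w i) ^ β i)) *
        L (mono β) := by
      rw [hG, Finset.sum_comm]
      refine Finset.sum_congr rfl fun β _ => ?_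
      rw [← Finset.sum_mul, ← Finset.mul_sum]
      congr 2
      have := Fintype.prod_sum (fun (i : Fin d) (b : Bool) => (if b then w i else - w i) ^ β i)
      rw [← this]
      refine Finset.prod_congr rfl fun i _ => ?_
      simp
    have h2 : ∀ β ∈ Finset.piAntidiag Finset.univ (2 * n), 0 ≤
        (Nat.multinomial Finset.univ β : ℝ) * (∏ i : Fin d, (w i ^ β i + (- w i) ^ β i)) *
        L (mono β) := by
      intro β hβ
      by_cases hev : ∀ i, Even (β i)
      · choose γ hγ using hev
        have hβγ : β = fun i => 2 * γ i := by
          funext i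
          rw [hγ i, two_mul]
        have hs : ∑ i, β i = 2 * n := (Finset.mem_piAntidiag.mp hβ).1
        have hs' : ∑ i, γ i = n := by
          rw [hβγ, ← Finset.mul_sum] at hs
          omega
        rw [hβγ, mono_double]
        refine mul_nonneg (mul_nonneg (Nat.cast_nonneg _) (Finset.prod_nonneg fun i _ => ?_))
          (hL.sq_nonneg _ ?_)
        · rw [pow_mul, pow_mul]
          positivity
        · have := totalDegree_mono γ
          omega
      · push Not at hev
        obtain ⟨i, hi⟩ := hev
        have : ∏ i : Fin d, (w i ^ β i + (- w i) ^ β i) = 0 := by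
          refine Finset.prod_eq_zero (Finset.mem_univ i) ?_
          rw [(Nat.not_even_iff_odd.mp hi).neg_pow, add_neg_cancel]
        rw [this, mul_zero, zero_mul]
    rw [h1]
    refine le_trans ?_ (Finset.single_le_sum h2 (a := fun i => 2 * α i) ?_)
    · have : ∏ i : Fin d, (w i ^ (2 * α i) + (- w i) ^ (2 * α i)) =
          2 ^ d * ∏ i, w i ^ (2 * α i) := by
        have h3 : (2 : ℝ) ^ d = ∏ _i : Fin d, 2 := by simp
        rw [h3, ← Finset.prod_mul_distrib]
        refine Finset.prod_congr rfl fun i _ => ?_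
        rw [(even_two_mul (α i)).neg_pow]
        ring
      rw [this, mono_double, Finset.sum_const, hA, Finset.card_univ, Fintype.card_fun,
        Fintype.card_bool, Fintype.card_fin, nsmul_eq_mul]
      push_cast
      exact le_of_eq (by ring)
    · simp [← Finset.mul_sum, hα]
  obtain ⟨σ, -, hσ⟩ := Finset.exists_le_of_sum_le Finset.univ_nonempty hsum
  refine ⟨σ, fun w' hw' => ?_⟩
  rw [map_formOf_pow]
  refine hσ.trans (le_of_eq ?_)
  rw [hG]
  simp only [hw', hv]

/-! ### Multinomial coefficients -/

/-- As a function of `b`, the quantity `a ^ b / b!` is largest at `b = a`. This is the one-variable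
form of locating the largest multinomial term. -/
theorem factorial_mul_pow_le (a b : ℕ) : a.factorial * a ^ b ≤ b.factorial * a ^ a := by
  rcases le_total a b with h | h
  · calc a.factorial * a ^ b = a.factorial * a ^ (b - a) * a ^ a := by
          rw [mul_assoc, ← pow_add, Nat.sub_add_cancel h]
      _ ≤ b.factorial * a ^ a := Nat.mul_le_mul_right _ (Nat.factorial_mul_pow_sub_le_factorial h)
  · have h1 : a.factorial ≤ b.factorial * a ^ (a - b) := by
      obtain ⟨t, rfl⟩ := Nat.exists_eq_add_of_le h
      rw [← Nat.factorial_mul_ascFactorial, Nat.add_sub_cancel_left]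
      exact Nat.mul_le_mul_left _ (Nat.ascFactorial_le_pow_add b t)
    calc a.factorial * a ^ b ≤ b.factorial * a ^ (a - b) * a ^ b := Nat.mul_le_mul_right _ h1
      _ = b.factorial * a ^ a := by rw [mul_assoc, ← pow_add, Nat.sub_add_cancel h]

theorem card_piAntidiag_le (d m : ℕ) :
    (Finset.piAntidiag (Finset.univ : Finset (Fin d)) m).card ≤ (m + 1) ^ d := by
  classical
  have : Finset.piAntidiag (Finset.univ : Finset (Fin d)) m ⊆
      Fintype.piFinset fun _ => Finset.range (m + 1) := by
    intro β hβ
    rw [Fintype.mem_piFinset]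
    intro i
    have h1 := (Finset.mem_piAntidiag.mp hβ).1
    have h2 := Finset.single_le_sum (f := β) (fun _ _ => Nat.zero_le _) (Finset.mem_univ i)
    rw [Finset.mem_range]
    have h3 : Finset.univ.sum β = ∑ i, β i := rfl
    omega
  refine (Finset.card_le_card this).trans ?_
  rw [Fintype.card_piFinset]
  simp

/-- In the multinomial expansion of `(∑ γ i) ^ m` the term with exponent `γ` is the largest, and
there are at most `(m + 1) ^ d` terms. -/
theorem sum_pow_le_multinomial {d m : ℕ} (γ : Fin d → ℕ) (h : ∑ i, γ i = m) :
    m ^ m ≤ (m + 1) ^ d * (Nat.multinomial Finset.univ γ * ∏ i, γ i ^ γ i) := by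
  have h1 : ∀ β ∈ Finset.piAntidiag (Finset.univ : Finset (Fin d)) m,
      Nat.multinomial Finset.univ β * ∏ i, γ i ^ β i ≤
      Nat.multinomial Finset.univ γ * ∏ i, γ i ^ γ i := by
    intro β hβ
    have hs : ∑ i, β i = m := (Finset.mem_piAntidiag.mp hβ).1
    have e1 := Nat.multinomial_spec (Finset.univ : Finset (Fin d)) β
    have e2 := Nat.multinomial_spec (Finset.univ : Finset (Fin d)) γ
    rw [hs] at e1
    rw [h] at e2
    have p1 : 0 < ∏ i, (β i).factorial := Finset.prod_pos fun i _ => Nat.factorial_pos _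
    have p2 : 0 < ∏ i, (γ i).factorial := Finset.prod_pos fun i _ => Nat.factorial_pos _
    have h2 : (∏ i, (γ i).factorial) * ∏ i, γ i ^ β i ≤
        (∏ i, (β i).factorial) * ∏ i, γ i ^ γ i := by
      rw [← Finset.prod_mul_distrib, ← Finset.prod_mul_distrib]
      exact Finset.prod_le_prod' fun i _ => factorial_mul_pow_le _ _
    refine Nat.le_of_mul_le_mul_left ?_ (Nat.mul_pos p1 p2)
    calc _ = m.factorial * ((∏ i, (γ i).factorial) * ∏ i, γ i ^ β i) := by rw [← e1]; ring
      _ ≤ m.factorial * ((∏ i, (β i).factorial) * ∏ i, γ i ^ γ i) := Nat.mul_le_mul_left _ h2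
      _ = _ := by rw [← e2]; ring
  calc m ^ m = (∑ i, γ i) ^ m := by rw [h]
    _ = ∑ β ∈ Finset.piAntidiag (Finset.univ : Finset (Fin d)) m,
        Nat.multinomial Finset.univ β * ∏ i, γ i ^ β i := by
          rw [Finset.sum_pow_eq_sum_piAntidiag]; simp
    _ ≤ _ := Finset.sum_le_card_nsmul _ _ _ h1
    _ ≤ _ := by
      rw [smul_eq_mul]
      exact Nat.mul_le_mul_right _ (card_piAntidiag_le d m)

/-- A single term of the expansion of `(∑ γ i) ^ m` is at most the whole sum. -/
theorem multinomial_mul_le {d m : ℕ} (γ : Fin d → ℕ) (h : ∑ i, γ i = m) :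
    Nat.multinomial Finset.univ γ * ∏ i, γ i ^ γ i ≤ m ^ m := by
  calc _ ≤ ∑ β ∈ Finset.piAntidiag (Finset.univ : Finset (Fin d)) m,
        Nat.multinomial Finset.univ β * ∏ i, γ i ^ β i := by
          refine Finset.single_le_sum (f := fun β : Fin d → ℕ =>
            Nat.multinomial Finset.univ β * ∏ i, γ i ^ β i) (fun _ _ => Nat.zero_le _) ?_
          simp [h]
    _ = (∑ i, γ i) ^ m := by rw [Finset.sum_pow_eq_sum_piAntidiag]; simp
    _ = m ^ m := by rw [h]

/-- Comparison of the coefficients of `x ^ (2 α)` in `(∑ √(α i / n) x i) ^ (2 n)` and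
`(∑ x i ^ 2) ^ n`. -/
theorem multinomial_le_multinomial_double {d n : ℕ} (α : Fin d → ℕ) (h : ∑ i, α i = n) :
    n ^ n * Nat.multinomial Finset.univ α ≤ (2 * n + 1) ^ d *
      (Nat.multinomial Finset.univ (fun i => 2 * α i) * ∏ i, α i ^ α i) := by
  set P := ∏ i, α i ^ α i with hP
  have hpos : 0 < P := Finset.prod_pos fun i _ => by
    rcases Nat.eq_zero_or_pos (α i) with h | h
    · simp [h]
    · positivity
  -- The largest-term bound is used at `2 α` and the single-term bound at `α`; the powers of two
  -- cancel.
  have h1 := sum_pow_le_multinomial (fun i => 2 * α i) (m := 2 * n) (by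
    rw [← Finset.mul_sum, h])
  have h2 : ∏ i, (2 * α i) ^ (2 * α i) = 2 ^ (2 * n) * (P * P) := by
    simp only [mul_pow, Finset.prod_mul_distrib, Finset.prod_pow_eq_pow_sum]
    rw [← Finset.mul_sum, h, hP, ← Finset.prod_mul_distrib]
    congr 1
    refine Finset.prod_congr rfl fun i _ => ?_
    rw [two_mul, pow_add]
  rw [h2, mul_pow] at h1
  have h3 := multinomial_mul_le α h
  rw [← hP] at h3
  set B := Nat.multinomial Finset.univ (fun i => 2 * α i)
  have h4 : n ^ n * n ^ n ≤ (2 * n + 1) ^ d * (B * (P * P)) := by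
    refine Nat.le_of_mul_le_mul_left ?_ (show 0 < 2 ^ (2 * n) by positivity)
    calc 2 ^ (2 * n) * (n ^ n * n ^ n) = 2 ^ (2 * n) * n ^ (2 * n) := by rw [two_mul n, pow_add n]
      _ ≤ _ := h1
      _ = _ := by ring
  refine Nat.le_of_mul_le_mul_left ?_ hpos
  calc P * (n ^ n * Nat.multinomial Finset.univ α) =
      n ^ n * (Nat.multinomial Finset.univ α * P) := by ring
    _ ≤ n ^ n * n ^ n := Nat.mul_le_mul_left _ h3
    _ ≤ _ := h4
    _ = _ := by ring

/-! ### Logarithmically convex sequences -/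

/-- The ratios of consecutive terms are nondecreasing and begin with `m 1 / m 0 = m 1`; terms equal
to zero are treated separately. -/
theorem mul_le_succ_of_logConvex {m : ℕ → ℝ} {n : ℕ} (h0 : m 0 = 1)
    (hpos : ∀ j, j ≤ n → 0 ≤ m j) (hlog : ∀ j, j + 2 ≤ n → m (j + 1) ^ 2 ≤ m j * m (j + 2)) :
    ∀ j, j + 1 ≤ n → m 1 * m j ≤ m (j + 1) := by
  intro j
  induction j with
  | zero => intro _; simp [h0]
  | succ j ih =>
    intro hj
    have ih' := ih (by omega)
    have h1 := hlog j hj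
    have p0 := hpos j (by omega)
    have p1 := hpos (j + 1) (by omega)
    have p2 := hpos (j + 2) (by omega)
    rcases p1.eq_or_lt with h | h
    · rw [← h, mul_zero]; exact p2
    · have : 0 < m j := by
        rcases p0.eq_or_lt with h' | h'
        · rw [← h', zero_mul] at h1
          nlinarith
        · exact h'
      have h2 : m 1 * m (j + 1) * m j ≤ m (j + 1 + 1) * m j := by nlinarith
      exact le_of_mul_le_mul_right h2 this

theorem pow_le_of_logConvex {m : ℕ → ℝ} {n : ℕ} (h0 : m 0 = 1)
    (hpos : ∀ j, j ≤ n → 0 ≤ m j) (hlog : ∀ j, j + 2 ≤ n → m (j + 1) ^ 2 ≤ m j * m (j + 2))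
    (hn : 1 ≤ n) : ∀ j, j ≤ n → m 1 ^ j ≤ m j := by
  intro j
  induction j with
  | zero => intro _; simp [h0]
  | succ j ih =>
    intro hj
    have h1 := mul_le_succ_of_logConvex h0 hpos hlog j hj
    have := mul_le_mul_of_nonneg_left (ih (by omega)) (hpos 1 hn)
    rw [pow_succ, mul_comm]
    linarith

/-- In a logarithmically convex sequence, `f n ≥ T ^ n` forces `f (n + 1) ≥ T * f n`. -/
theorem mul_le_of_pow_le {f : ℕ → ℝ} {n : ℕ} {T : ℝ} (hT : 0 < T) (hn : 1 ≤ n) (h0 : f 0 = 1)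
    (hpos : ∀ j, j ≤ n + 1 → 0 ≤ f j)
    (hlog : ∀ j, j + 1 ≤ n → f (j + 1) ^ 2 ≤ f j * f (j + 2)) (h : T ^ n ≤ f n) :
    T * f n ≤ f (n + 1) := by
  -- If the last ratio were below `T`, then by log-convexity all earlier ones would be too, and
  -- multiplying them up from `f 0 = 1` gives `f n < T ^ n`. The ratios make sense because
  -- positivity of `f n` passes down to all earlier terms.
  by_contra! hlt
  have hfn : 0 < f n := lt_of_lt_of_le (by positivity) h
  have hp : ∀ t, t ≤ n → 0 < f (n - t) := by
    intro t
    induction t with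
    | zero => intro _; simpa using hfn
    | succ t ih =>
      intro ht
      have h1 := ih (by omega)
      have h2 := hlog (n - (t + 1)) (by omega)
      rw [show n - (t + 1) + 1 = n - t by omega] at h2
      have h3 := hpos (n - (t + 1)) (by omega)
      rcases h3.eq_or_lt with h4 | h4
      · rw [← h4, zero_mul] at h2
        nlinarith
      · exact h4
  have hs : ∀ t, t ≤ n → f (n - t + 1) < T * f (n - t) := by
    intro t
    induction t with
    | zero => intro _; simpa using hlt
    | succ t ih =>
      intro ht
      have h1 := ih (by omega)
      have h2 := hlog (n - (t + 1)) (by omega)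
      rw [show n - (t + 1) + 1 = n - t by omega,
        show n - (t + 1) + 2 = n - t + 1 by omega] at h2
      have h3 := hp (t + 1) ht
      have h4 := hp t (by omega)
      rw [show n - (t + 1) + 1 = n - t by omega]
      have h5 : f (n - t) * f (n - t) < T * f (n - (t + 1)) * f (n - t) := by nlinarith
      exact lt_of_mul_lt_mul_right h5 h4.le
  have hu : ∀ j, j < n → f (j + 1) < T ^ (j + 1) := by
    intro j
    induction j with
    | zero =>
      intro _
      have := hs n le_rfl
      simpa [h0] using this
    | succ j ih =>
      intro hj
      have h1 := ih (by omega)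
      have h2 := hs (n - (j + 1)) (by omega)
      rw [show n - (n - (j + 1)) = j + 1 by omega] at h2
      have h3 := mul_lt_mul_of_pos_left h1 hT
      have h4 : T ^ (j + 1 + 1) = T * T ^ (j + 1) := by ring
      rw [h4]
      linarith
  have := hu (n - 1) (by omega)
  rw [show n - 1 + 1 = n by omega] at this
  linarith

/-! ### Moment inequalities for pseudo-expectations -/

section

variable {d m : ℕ} {L : MvPolynomial (Fin d) ℝ →ₗ[ℝ] ℝ}

theorem map_C_mul (L : MvPolynomial (Fin d) ℝ →ₗ[ℝ] ℝ) (a : ℝ) (p : MvPolynomial (Fin d) ℝ) :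
    L (C a * p) = a * L p := by
  rw [← smul_eq_C_mul, map_smul, smul_eq_mul]

/-- A nonnegative quadratic polynomial in the shift `x` has nonpositive discriminant. Only constant
shifts are needed, so the degree is controlled by that of `P * g ^ 2`, and `P` need not be a square.
-/
theorem cauchy_schwarz (P g : MvPolynomial (Fin d) ℝ)
    (h : ∀ x : ℝ, 0 ≤ L (P * (C x + g) ^ 2)) : L (P * g) ^ 2 ≤ L P * L (P * g ^ 2) := by
  have h' : ∀ x : ℝ, 0 ≤ L P * (x * x) + 2 * L (P * g) * x + L (P * g ^ 2) := by
    intro x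
    have := h x
    have e : P * (C x + g) ^ 2 = C (x * x) * P + C (2 * x) * (P * g) + P * g ^ 2 := by
      simp only [C_mul]
      have : (C 2 : MvPolynomial (Fin d) ℝ) = 2 := map_ofNat C 2
      rw [this]
      ring
    rw [e, map_add, map_add, map_C_mul, map_C_mul] at this
    linarith
  have := discrim_le_zero h'
  rw [discrim] at this
  nlinarith

/-- Multiplying a square by `‖x‖²` gives a sum of the squares `(x i f)²`, so the factors can be
absorbed one at a time. -/
theorem BallFunctional.normSq_mul_nonneg (hL : BallFunctional d m L) (j : ℕ) :
    ∀ f : MvPolynomial (Fin d) ℝ, 2 * j + 2 * f.totalDegree ≤ m → 0 ≤ L (normSq d ^ j * f ^ 2) := by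
  induction j with
  | zero => intro f hf; simpa using hL.sq_nonneg f (by omega)
  | succ j ih =>
    intro f hf
    have : normSq d ^ (j + 1) * f ^ 2 = ∑ i, normSq d ^ j * (X i * f) ^ 2 := by
      rw [← Finset.mul_sum, pow_succ, mul_assoc]
      congr 1
      rw [normSq, Finset.sum_mul]
      exact Finset.sum_congr rfl fun i _ => by ring
    rw [this, map_sum]
    refine Finset.sum_nonneg fun i _ => ih _ ?_
    have := totalDegree_mul_le_of (f := X i) (g := f) (totalDegree_X (R := ℝ) i).le le_rfl
    omega

/-- Jensen's inequality for `‖x‖²`, which for pseudo-expectations comes from log-convexity of the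
moments `L(‖x‖^(2j))`. -/
theorem BallFunctional.normSq_pow_le (hL : BallFunctional d m L) {n : ℕ} (hn : 2 * n ≤ m) :
    L (normSq d) ^ n ≤ L (normSq d ^ n) := by
  rcases Nat.eq_zero_or_pos n with rfl | hn'
  · simp [hL.one]
  have := pow_le_of_logConvex (m := fun j => L (normSq d ^ j)) (n := n) (by simp [hL.one])
    (fun j hj => by
      have := hL.normSq_mul_nonneg j 1 (by simp; omega)
      simpa using this)
    (fun j hj => by
      have := cauchy_schwarz (L := L) (normSq d ^ j) (normSq d) (fun x =>
        hL.normSq_mul_nonneg j _ (by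
          have := totalDegree_add_le_of (f := C x) (g := normSq d) (a := 2)
            (by simp) (totalDegree_normSq d)
          omega))
      simpa [← pow_succ, ← pow_add] using this) hn' n le_rfl
  simpa using this

theorem BallFunctional.even_nonneg (hL : BallFunctional d m L) {u : MvPolynomial (Fin d) ℝ}
    (hu : u.totalDegree ≤ 1) {j : ℕ} (hj : 2 * j ≤ m) : 0 ≤ L (u ^ (2 * j)) := by
  rw [mul_comm, pow_mul]
  refine hL.sq_nonneg _ ?_
  have := totalDegree_pow_le_of hu j
  omega

theorem BallFunctional.logConvex (hL : BallFunctional d m L) {u : MvPolynomial (Fin d) ℝ}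
    (hu : u.totalDegree ≤ 1) {j : ℕ} (hj : 2 * (j + 2) ≤ m) :
    L (u ^ (2 * (j + 1))) ^ 2 ≤ L (u ^ (2 * j)) * L (u ^ (2 * (j + 2))) := by
  have := cauchy_schwarz (L := L) (u ^ (2 * j)) (u ^ 2) (fun x => by
    have e : u ^ (2 * j) * (C x + u ^ 2) ^ 2 = (u ^ j * (C x + u ^ 2)) ^ 2 := by ring
    rw [e]
    refine hL.sq_nonneg _ ?_
    have h1 := totalDegree_pow_le_of hu j
    have h2 := totalDegree_add_le_of (f := C x) (g := u ^ 2) (a := 2)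
      (by simp) (totalDegree_pow_le_of hu 2)
    have := totalDegree_mul_le_of h1 h2
    omega)
  have e1 : u ^ (2 * j) * u ^ 2 = u ^ (2 * (j + 1)) := by ring
  have e2 : u ^ (2 * j) * (u ^ 2) ^ 2 = u ^ (2 * (j + 2)) := by ring
  rwa [e1, e2] at this

/-- Lagrange's identity: the `g i j` are the minors `w i x j - w j x i`, and each pair is counted
twice, whence the factor `1 / 2`. It is the sum-of-squares proof of the Cauchy–Schwarz inequality,
which a pseudo-expectation can use. -/
theorem formOf_sq_le (w : ℕ → ℝ) : ∃ g : Fin d → Fin d → MvPolynomial (Fin d) ℝ,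
    (∀ i j, (g i j).totalDegree ≤ 1) ∧
    C (sumSq d w) * normSq d - formOf d w ^ 2 = C (1 / 2) * ∑ i, ∑ j, g i j ^ 2 := by
  refine ⟨fun i j => C (w i) * X j - C (w j) * X i, fun i j => ?_, ?_⟩
  · refine (totalDegree_sub _ _).trans (max_le ?_ ?_)
    · exact totalDegree_mul_le_of (a := 0) (b := 1) (by simp) (by simp)
    · exact totalDegree_mul_le_of (a := 0) (b := 1) (by simp) (by simp)
  · have hC : (C (sumSq d w) : MvPolynomial (Fin d) ℝ) = ∑ i : Fin d, C (w i) ^ 2 := by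
      rw [sumSq, Finset.sum_range, map_sum]
      simp
    have h2 : (C (1 / 2) : MvPolynomial (Fin d) ℝ) * 2 = 1 := by
      have : (2 : MvPolynomial (Fin d) ℝ) = C 2 := (map_ofNat C 2).symm
      rw [this, ← C_mul]
      norm_num
    have e : ∀ i j : Fin d, ((C (w i) * X j - C (w j) * X i : MvPolynomial (Fin d) ℝ)) ^ 2 =
        C (w i) ^ 2 * X j ^ 2 + C (w j) ^ 2 * X i ^ 2 -
          2 * ((C (w i) * X i) * (C (w j) * X j)) := fun i j => by ring
    simp only [e, Finset.sum_sub_distrib, Finset.sum_add_distrib, ← Finset.mul_sum,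
      ← Finset.sum_mul]
    rw [hC, normSq, formOf]
    linear_combination (-1 + 0 * C (1 / 2) : MvPolynomial (Fin d) ℝ) *
      ((∑ i : Fin d, C (w i) ^ 2) * (∑ i : Fin d, X i ^ 2) - (∑ i : Fin d, C (w i) * X i) ^ 2) * h2

/-- Write `W - u² = W (1 - ‖x‖²) + (W ‖x‖² - u²)` and multiply by `u^(2j)`: the first part is
nonnegative by the ball constraint, the second by Lagrange's identity. -/
theorem BallFunctional.pow_succ_le (hL : BallFunctional d m L) (w : ℕ → ℝ) {j : ℕ}
    (hj : 2 * (j + 1) ≤ m) :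
    L (formOf d w ^ (2 * (j + 1))) ≤ sumSq d w * L (formOf d w ^ (2 * j)) := by
  set u := formOf d w with hu
  obtain ⟨g, hg, hgs⟩ := formOf_sq_le (d := d) w
  have hud : u.totalDegree ≤ 1 := totalDegree_formOf d w
  have h1 := hL.ball_nonneg (u ^ j) (by
    have := totalDegree_pow_le_of hud j
    omega)
  have h2 : 0 ≤ ∑ i, ∑ i', L ((u ^ j * g i i') ^ 2) := by
    refine Finset.sum_nonneg fun i _ => Finset.sum_nonneg fun i' _ => hL.sq_nonneg _ ?_
    have := totalDegree_mul_le_of (totalDegree_pow_le_of hud j) (hg i i')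
    omega
  have hW : 0 ≤ sumSq d w := Finset.sum_nonneg fun i _ => _root_.sq_nonneg _
  have e : C (sumSq d w) * u ^ (2 * j) - u ^ (2 * (j + 1)) =
      C (sumSq d w) * ((1 - ∑ i, X i ^ 2) * (u ^ j) ^ 2) +
        C (1 / 2) * ∑ i, ∑ i', (u ^ j * g i i') ^ 2 := by
    simp only [mul_pow, ← Finset.mul_sum]
    have : C (1 / 2) * ((u ^ j) ^ 2 * ∑ i, ∑ i', g i i' ^ 2) =
      (u ^ j) ^ 2 * (C (1 / 2) * ∑ i, ∑ i', g i i' ^ 2) := by ring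
    rw [this, ← hgs, normSq]
    ring
  have e' := congrArg L e
  rw [map_sub, map_add, map_C_mul, map_C_mul, map_C_mul, map_sum] at e'
  simp only [map_sum] at e'
  nlinarith [mul_nonneg hW h1]

theorem BallFunctional.normSq_le_one (hL : BallFunctional d m L) (hm : 2 ≤ m) :
    L (normSq d) ≤ 1 := by
  have := hL.ball_nonneg 1 (by simpa using hm)
  rw [one_pow, mul_one, map_sub, hL.one] at this
  rw [normSq]
  linarith

end

/-! ### A direction with a large moment -/

/-- Take `ω i = ⌈N0 √(α i / n)⌉`. Rounding up can only increase the weights, which the moment bound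
requires, and it costs at most `∑ (2 N0 + 1) ≤ 2 N0 d + d²` in the squared norm. -/
theorem exists_rounding {d n : ℕ} (N0 : ℕ) (hn : 0 < n) (α : Fin d → ℕ) (h : ∑ i, α i = n) :
    ∃ ω : Fin d → ℕ, (∀ i, ω i ≤ N0) ∧ (∀ i, (N0 : ℝ) ^ 2 * α i / n ≤ (ω i : ℝ) ^ 2) ∧
      ∑ i, (ω i : ℝ) ^ 2 ≤ ((N0 : ℝ) + d) ^ 2 := by
  have hn' : (0 : ℝ) < n := by exact_mod_cast hn
  have ht : ∀ i, (α i : ℝ) / n ≤ 1 := fun i => by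
    rw [div_le_one hn']
    have := Finset.single_le_sum (f := α) (fun _ _ => Nat.zero_le _) (Finset.mem_univ i)
    rw [h] at this
    exact_mod_cast this
  set t : Fin d → ℝ := fun i => √((α i : ℝ) / n) with htdef
  have ht0 : ∀ i, 0 ≤ t i := fun i => Real.sqrt_nonneg _
  have ht1 : ∀ i, t i ≤ 1 := fun i => Real.sqrt_le_one.mpr (ht i)
  have hsq : ∀ i, t i ^ 2 = (α i : ℝ) / n := fun i => Real.sq_sqrt (by positivity)
  have hN : (0 : ℝ) ≤ N0 := Nat.cast_nonneg _
  refine ⟨fun i => ⌈N0 * t i⌉₊, fun i => ?_, fun i => ?_, ?_⟩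
  · rw [Nat.ceil_le]
    nlinarith [ht1 i, ht0 i]
  · have h1 := Nat.le_ceil (N0 * t i)
    have h2 : (N0 : ℝ) ^ 2 * α i / n = (N0 * t i) ^ 2 := by rw [mul_pow, hsq]; ring
    rw [h2]
    exact pow_le_pow_left₀ (mul_nonneg hN (ht0 i)) h1 2
  · have h1 : ∀ i, ((⌈N0 * t i⌉₊ : ℕ) : ℝ) ^ 2 ≤ (N0 : ℝ) ^ 2 * ((α i : ℝ) / n) + (2 * N0 + 1) := by
      intro i
      have h2 := (Nat.ceil_lt_add_one (mul_nonneg hN (ht0 i))).le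
      have h3 : ((⌈N0 * t i⌉₊ : ℕ) : ℝ) ^ 2 ≤ (N0 * t i + 1) ^ 2 :=
        pow_le_pow_left₀ (Nat.cast_nonneg _) h2 2
      have := hsq i
      nlinarith [ht1 i, ht0 i, mul_le_mul_of_nonneg_left (ht1 i) hN]
    refine (Finset.sum_le_sum fun i _ => h1 i).trans ?_
    rw [Finset.sum_add_distrib, ← Finset.mul_sum, ← Finset.sum_div, ← Nat.cast_sum, h,
      div_self hn'.ne', Finset.sum_const, Finset.card_univ, Fintype.card_fin, nsmul_eq_mul]
    have : (d : ℝ) ≤ (d : ℝ) ^ 2 := by exact_mod_cast Nat.le_self_pow (by norm_num) d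
    nlinarith

/-- The right direction is read off from the heaviest monomial `x^(2α)` of `‖x‖^(2n)`: the weights
`√(α i / n)` are those for which `u^(2n)` carries almost as much of this monomial. One factor
`(2n+1)^d` is lost by choosing `α`, a second by comparing the multinomial coefficients. -/
theorem exists_large_moment {d m n : ℕ} {L : MvPolynomial (Fin d) ℝ →ₗ[ℝ] ℝ}
    (hL : BallFunctional d m L) (hn : 2 * n ≤ m) (hn0 : 0 < n) (hM : 0 < L (normSq d)) (N0 : ℕ) :
    ∃ ω : Fin d → ℤ, (∀ i, |ω i| ≤ N0) ∧ (N0 : ℝ) ^ 2 ≤ ∑ i, (ω i : ℝ) ^ 2 ∧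
      ∑ i, (ω i : ℝ) ^ 2 ≤ ((N0 : ℝ) + d) ^ 2 ∧
      ∀ w' : ℕ → ℝ, (∀ i : Fin d, w' i = ω i) →
        (N0 : ℝ) ^ (2 * n) * L (normSq d) ^ n ≤
          (2 * n + 1 : ℝ) ^ (2 * d) * L (formOf d w' ^ (2 * n)) := by
  have hn' : (0 : ℝ) < n := by exact_mod_cast hn0
  set A := Finset.piAntidiag (Finset.univ : Finset (Fin d)) n
  have hbase : (0 : ℝ) < (2 * n + 1 : ℝ) ^ d := by positivity
  have hcard : (A.card : ℝ) ≤ (2 * n + 1 : ℝ) ^ d := by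
    have h1 := card_piAntidiag_le d n
    have h2 : (A.card : ℝ) ≤ ((n + 1) ^ d : ℕ) := by exact_mod_cast h1
    refine h2.trans ?_
    push_cast
    gcongr
    linarith
  have hpow := hL.normSq_pow_le hn
  have hMn : 0 < L (normSq d) ^ n := by positivity
  -- Pigeonhole: the expansion of `‖x‖^(2n)` has at most `(2n+1)^d` terms and its value is at least
  -- `M^n`.
  obtain ⟨α, hα, hαle⟩ : ∃ α ∈ A, L (normSq d) ^ n ≤ (2 * n + 1 : ℝ) ^ d *
      ((Nat.multinomial Finset.univ α : ℝ) * L (mono α ^ 2)) := by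
    by_contra! hcon
    rw [map_normSq_pow] at hpow
    have hne : A.Nonempty := by
      rw [Finset.nonempty_iff_ne_empty]
      intro h
      rw [show Finset.piAntidiag (Finset.univ : Finset (Fin d)) n = ∅ from h,
        Finset.sum_empty] at hpow
      linarith
    have h1 := Finset.sum_lt_sum_of_nonempty hne hcon
    rw [← Finset.mul_sum, Finset.sum_const, nsmul_eq_mul] at h1
    have h2 := mul_le_mul_of_nonneg_left hpow hbase.le
    have h3 := mul_le_mul_of_nonneg_right hcard hMn.le
    linarith
  have hs : ∑ i, α i = n := (Finset.mem_piAntidiag.mp hα).1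
  obtain ⟨ω, hω1, hω2, hω3⟩ := exists_rounding N0 hn0 α hs
  obtain ⟨σ, hσ⟩ := exists_sign hL hn (fun i => (ω i : ℝ)) α hs
  have hsq : ∀ i, (((if σ i then (ω i : ℤ) else - (ω i : ℤ) : ℤ)) : ℝ) ^ 2 = (ω i : ℝ) ^ 2 := by
    intro i
    split_ifs <;> simp
  have hN : ∑ i, (N0 : ℝ) ^ 2 * α i / n = (N0 : ℝ) ^ 2 := by
    rw [← Finset.sum_div, ← Finset.mul_sum, ← Nat.cast_sum, hs]
    field_simp
  refine ⟨fun i => if σ i then (ω i : ℤ) else - (ω i : ℤ), fun i => ?_, ?_, ?_, fun w' hw' => ?_⟩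
  · have := hω1 i
    show |if σ i then (ω i : ℤ) else - (ω i : ℤ)| ≤ N0
    split_ifs <;> simp <;> omega
  · simp only [hsq]
    rw [← hN]
    exact Finset.sum_le_sum fun i _ => hω2 i
  · simpa only [hsq] using hω3
  · have h1 := hσ w' (fun i => by rw [hw' i]; by_cases h : σ i <;> simp [h])
    have hmono : 0 ≤ L (mono α ^ 2) := hL.sq_nonneg _ (by
      have := totalDegree_mono α
      omega)
    set B : ℝ := (Nat.multinomial Finset.univ (fun i => 2 * α i) : ℝ) with hB
    set P : ℝ := ∏ i, (α i : ℝ) ^ α i with hP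
    have hprod : (N0 : ℝ) ^ (2 * n) / n ^ n * P ≤ ∏ i, (ω i : ℝ) ^ (2 * α i) := by
      have : (N0 : ℝ) ^ (2 * n) / n ^ n * P = ∏ i, ((N0 : ℝ) ^ 2 * α i / n) ^ α i := by
        simp only [div_pow, mul_pow, Finset.prod_div_distrib, Finset.prod_mul_distrib,
          Finset.prod_pow_eq_pow_sum, hs, ← pow_mul, hP]
        rw [← Finset.mul_sum, hs]
        ring
      rw [this]
      refine Finset.prod_le_prod (fun i _ => by positivity) fun i _ => ?_
      rw [pow_mul]
      exact pow_le_pow_left₀ (by positivity) (hω2 i) _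
    have hmult : (n : ℝ) ^ n * (Nat.multinomial Finset.univ α : ℝ) ≤
        (2 * n + 1 : ℝ) ^ d * (B * P) := by
      have := multinomial_le_multinomial_double α hs
      rw [hB, hP]
      exact_mod_cast this
    have hNN : (0 : ℝ) ≤ (N0 : ℝ) ^ (2 * n) / n ^ n := by positivity
    calc (N0 : ℝ) ^ (2 * n) * L (normSq d) ^ n
        ≤ (N0 : ℝ) ^ (2 * n) * ((2 * n + 1 : ℝ) ^ d *
          ((Nat.multinomial Finset.univ α : ℝ) * L (mono α ^ 2))) := by gcongr
      _ = (2 * n + 1 : ℝ) ^ d * ((N0 : ℝ) ^ (2 * n) / n ^ n) *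
          ((n : ℝ) ^ n * (Nat.multinomial Finset.univ α : ℝ)) * L (mono α ^ 2) := by
          field_simp
      _ ≤ (2 * n + 1 : ℝ) ^ d * ((N0 : ℝ) ^ (2 * n) / n ^ n) *
          ((2 * n + 1 : ℝ) ^ d * (B * P)) * L (mono α ^ 2) := by gcongr
      _ = (2 * n + 1 : ℝ) ^ (2 * d) * (B * ((N0 : ℝ) ^ (2 * n) / n ^ n * P) * L (mono α ^ 2)) := by
          ring
      _ ≤ (2 * n + 1 : ℝ) ^ (2 * d) * (B * (∏ i, (ω i : ℝ) ^ (2 * α i)) * L (mono α ^ 2)) := by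
          gcongr
      _ ≤ _ := by gcongr

/-! ### Existence of a good candidate -/

/-- The properties that make a linear form and a shift suitable. -/
def Good (d k : ℕ) (L : MvPolynomial (Fin d) ℝ →ₗ[ℝ] ℝ) (cM : ℝ) (w : ℕ → ℝ) (l : ℕ) : Prop :=
  2 * l + 2 ≤ k ∧
  (d * sumSq d w) ^ (l + 1) < 2 ^ k * L (formOf d w ^ (2 * l) * (C (w d) + formOf d w) ^ 2) ∧
  cM * sumSq d w * L (formOf d w ^ (2 * l)) ≤ L (formOf d w ^ (2 * l + 2)) ∧
  cM * sumSq d w * L (formOf d w ^ (2 * l) * (C (w d) + formOf d w) ^ 2) ^ 2 ≤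
    L (formOf d w ^ (2 * l) * (C (w d) + formOf d w) ^ 2 * formOf d w) ^ 2

/-- Otherwise the ratio `f (j+1) / f j`, which is at least `T` at `j = n`, would grow by more than
`1 + ε` at each of `J` steps and exceed `W` at the end. -/
theorem exists_stationary {f : ℕ → ℝ} {n J : ℕ} {T W ε : ℝ} (hε : 0 ≤ ε)
    (hpos : ∀ j, n ≤ j → j ≤ n + J → 0 < f j)
    (hn : T * f n ≤ f (n + 1)) (hend : f (n + J + 1) ≤ W * f (n + J))
    (hJ : W < T * (1 + ε) ^ J) :
    ∃ l, n ≤ l ∧ l < n + J ∧ f (l + 2) * f l ≤ (1 + ε) * f (l + 1) ^ 2 := by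
  by_contra! hcon
  have h : ∀ t, t ≤ J → T * (1 + ε) ^ t * f (n + t) ≤ f (n + t + 1) := by
    intro t
    induction t with
    | zero => intro _; simpa using hn
    | succ t ih =>
      intro ht
      have h1 := ih (by omega)
      have h2 := hcon (n + t) (by omega) (by omega)
      have p0 := hpos (n + t) (by omega) (by omega)
      have p1 := hpos (n + t + 1) (by omega) (by omega)
      rw [show n + (t + 1) = n + t + 1 by ring, show n + t + 1 + 1 = n + t + 2 by ring]
      refine le_of_mul_le_mul_right (a := f (n + t)) ?_ p0
      calc T * (1 + ε) ^ (t + 1) * f (n + t + 1) * f (n + t) =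
          (1 + ε) * f (n + t + 1) * (T * (1 + ε) ^ t * f (n + t)) := by ring
        _ ≤ (1 + ε) * f (n + t + 1) * f (n + t + 1) := by gcongr
        _ = (1 + ε) * f (n + t + 1) ^ 2 := by ring
        _ ≤ _ := h2.le
  have h1 := h J le_rfl
  have p := hpos (n + J) (by omega) le_rfl
  nlinarith

/-- The correlation gained by the factor `(a + t) ^ 2` if `t ^ 2` is concentrated near `r ^ 2`. -/
theorem tilt_inequality {F e g3 r a γ : ℝ} (hF : 0 ≤ F) (he : 0 ≤ e) (hr : 0 < r) (hγ : 0 < γ)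
    (hγ1 : γ ≤ 1) (h1 : r ≤ a) (h2 : a ≤ (1 + γ) * r) (hg : r ^ 2 * e - γ * r ^ 3 * F ≤ g3) :
    (1 - γ) * r * (a ^ 2 * F + 2 * a * e + r ^ 2 * F) ≤ a ^ 2 * e + 2 * a * (r ^ 2 * F) + g3 := by
  have h3 : (a - r) ^ 2 ≤ γ ^ 2 * r ^ 2 := by
    rw [← mul_pow]
    exact pow_le_pow_left₀ (by linarith) (by linarith) 2
  -- Once the lower bound for `g3` is inserted, the difference of the two sides is `e` times this
  -- expression plus `r F` times the one in `h5`. The latter equals `γ a² - (a - r)²`, so `h3`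
  -- settles it.
  have h4 : 0 ≤ a ^ 2 + r ^ 2 - (1 - γ) * (2 * a * r) := by
    have : 0 ≤ γ * (a * r) := by have : 0 < a := by linarith
                                 positivity
    nlinarith [sq_nonneg (a - r)]
  have h5 : 0 ≤ 2 * a * r - γ * r ^ 2 - (1 - γ) * (a ^ 2 + r ^ 2) := by
    have h6 : r ^ 2 ≤ a ^ 2 := pow_le_pow_left₀ hr.le h1 2
    have h7 : 0 ≤ γ * (1 - γ) * r ^ 2 := by
      have : 0 ≤ 1 - γ := by linarith
      positivity
    nlinarith [mul_le_mul_of_nonneg_left h6 hγ.le]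
  nlinarith [mul_nonneg he h4, mul_nonneg (mul_nonneg hr.le hF) h5]

theorem formOf_neg (d : ℕ) {w w' : ℕ → ℝ} (h : ∀ i : Fin d, w' i = - w i) :
    formOf d w' = - formOf d w := by
  rw [formOf, formOf, ← Finset.sum_neg_distrib]
  refine Finset.sum_congr rfl fun i _ => ?_
  rw [h i, C_neg, neg_mul]

theorem sumSq_congr (d : ℕ) {w w' : ℕ → ℝ} (h : ∀ i : Fin d, w' i ^ 2 = w i ^ 2) :
    sumSq d w' = sumSq d w := by
  rw [sumSq, sumSq, Finset.sum_range, Finset.sum_range]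
  exact Finset.sum_congr rfl fun i _ => h i

theorem map_shift_sq {d : ℕ} (L : MvPolynomial (Fin d) ℝ →ₗ[ℝ] ℝ) (u : MvPolynomial (Fin d) ℝ)
    (a : ℝ) (j : ℕ) : L (u ^ j * (C a + u) ^ 2) =
      a ^ 2 * L (u ^ j) + 2 * a * L (u ^ (j + 1)) + L (u ^ (j + 2)) := by
  have h2 : (C 2 : MvPolynomial (Fin d) ℝ) = 2 := map_ofNat C 2
  have : u ^ j * (C a + u) ^ 2 = C (a ^ 2) * u ^ j + C (2 * a) * u ^ (j + 1) + u ^ (j + 2) := by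
    rw [C_mul, C_pow, h2]
    ring
  rw [this, map_add, map_add, map_C_mul, map_C_mul]

theorem map_shift_sq_mul {d : ℕ} (L : MvPolynomial (Fin d) ℝ →ₗ[ℝ] ℝ) (u : MvPolynomial (Fin d) ℝ)
    (a : ℝ) (j : ℕ) : L (u ^ j * (C a + u) ^ 2 * u) =
      a ^ 2 * L (u ^ (j + 1)) + 2 * a * L (u ^ (j + 2)) + L (u ^ (j + 3)) := by
  have : u ^ j * (C a + u) ^ 2 * u = u ^ (j + 1) * (C a + u) ^ 2 := by ring
  rw [this, map_shift_sq]

/-- The third moment is close to the value it has for a constant `u ^ 2`. -/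
theorem third_moment {d m l : ℕ} {L : MvPolynomial (Fin d) ℝ →ₗ[ℝ] ℝ} (hL : BallFunctional d m L)
    (hl : 2 * l + 4 ≤ m) {u : MvPolynomial (Fin d) ℝ} (hu : u.totalDegree ≤ 1) {r γ : ℝ}
    (hr : 0 < r) (hγ : 0 < γ) (h2 : L (u ^ (2 * l + 2)) = r ^ 2 * L (u ^ (2 * l)))
    (h4 : L (u ^ (2 * l + 4)) ≤ (1 + γ ^ 2) * r ^ 4 * L (u ^ (2 * l))) :
    r ^ 2 * L (u ^ (2 * l + 1)) - γ * r ^ 3 * L (u ^ (2 * l)) ≤ L (u ^ (2 * l + 3)) := by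
  -- Cauchy–Schwarz for `u` and `u² - r²` under the weight `u^(2l)`, as one square. The weighted
  -- second moments are `r² F` and at most `γ² r⁴ F`, with `F = L(u^(2l))`; the coefficient `γ r`
  -- balances the two.
  have h := hL.sq_nonneg (u ^ l * (C (γ * r) * u + u ^ 2 - C (r ^ 2))) (by
    have h1 := totalDegree_pow_le_of hu l
    have h3 : (C (γ * r) * u + u ^ 2 - C (r ^ 2)).totalDegree ≤ 2 := by
      refine (totalDegree_sub _ _).trans (max_le (totalDegree_add_le_of ?_ ?_)
        (by rw [totalDegree_C]; omega))
      · exact (totalDegree_mul_le_of (a := 0) (by rw [totalDegree_C]) hu).trans (by omega)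
      · exact totalDegree_pow_le_of hu 2
    have := totalDegree_mul_le_of h1 h3
    omega)
  have c2 : (C 2 : MvPolynomial (Fin d) ℝ) = 2 := map_ofNat C 2
  have e : (u ^ l * (C (γ * r) * u + u ^ 2 - C (r ^ 2))) ^ 2 =
      C ((γ * r) ^ 2) * u ^ (2 * l + 2) + C (2 * (γ * r)) * u ^ (2 * l + 3) + u ^ (2 * l + 4) -
      C (2 * (γ * r) * r ^ 2) * u ^ (2 * l + 1) - C (2 * r ^ 2) * u ^ (2 * l + 2) +
      C ((r ^ 2) ^ 2) * u ^ (2 * l) := by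
    simp only [C_mul, C_pow, c2]
    ring
  rw [e, map_add, map_sub, map_sub, map_add, map_add, map_C_mul, map_C_mul, map_C_mul, map_C_mul,
    map_C_mul, h2] at h
  have h5 : 0 ≤ 2 * (γ * r) * (L (u ^ (2 * l + 3)) -
      (r ^ 2 * L (u ^ (2 * l + 1)) - γ * r ^ 3 * L (u ^ (2 * l)))) := by
    nlinarith
  have := nonneg_of_mul_nonneg_right h5 (by positivity)
  linarith

theorem good_of_moments {d k l : ℕ} {L : MvPolynomial (Fin d) ℝ →ₗ[ℝ] ℝ} {γ r : ℝ}
    (hL : BallFunctional d (k + 2) L) (hγ : 0 < γ) (hγ1 : γ ≤ 1) (hl : 2 * l + 2 ≤ k)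
    {cM : ℝ} {w : ℕ → ℝ} (hF : 0 < L (formOf d w ^ (2 * l)))
    (he : 0 ≤ L (formOf d w ^ (2 * l + 1))) (hr : 0 < r)
    (h2 : L (formOf d w ^ (2 * l + 2)) = r ^ 2 * L (formOf d w ^ (2 * l)))
    (h4 : L (formOf d w ^ (2 * l + 4)) ≤ (1 + γ ^ 2) * r ^ 4 * L (formOf d w ^ (2 * l)))
    (ha1 : r ≤ w d) (ha2 : w d ≤ (1 + γ) * r) (hR : cM * sumSq d w ≤ (1 - γ) ^ 2 * r ^ 2)
    (hZ : (d * sumSq d w) ^ (l + 1) ≤ 2 ^ k * L (formOf d w ^ (2 * l + 2))) :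
    Good d k L cM w l := by
  have h3 := third_moment hL (l := l) (by omega) (totalDegree_formOf d w) hr hγ h2 h4
  set F := L (formOf d w ^ (2 * l))
  set e := L (formOf d w ^ (2 * l + 1))
  have htilt := tilt_inequality hF.le he hr hγ hγ1 ha1 ha2 h3
  set a := w d with ha
  have hapos : 0 < a := by linarith
  have hNn : L (formOf d w ^ (2 * l) * (C a + formOf d w) ^ 2) =
      a ^ 2 * F + 2 * a * e + r ^ 2 * F := by
    rw [map_shift_sq, h2]
  have h5 : 0 < a ^ 2 * F := by positivity
  have h6 : 0 ≤ 2 * a * e := by positivity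
  refine ⟨hl, ?_, ?_, ?_⟩
  -- The size test is strict because the shift adds the positive term `a² F` to the moment of order
  -- `2l + 2`.
  · rw [hNn]
    refine hZ.trans_lt ?_
    rw [h2]
    gcongr
    linarith
  · rw [h2]
    have h1 : (1 - γ) ^ 2 * r ^ 2 ≤ 1 * r ^ 2 := by
      have : (1 - γ) ^ 2 ≤ 1 := pow_le_one₀ (by linarith) (by linarith)
      gcongr
    rw [one_mul] at h1
    exact mul_le_mul_of_nonneg_right (hR.trans h1) hF.le
  · rw [hNn, map_shift_sq_mul, h2]
    have h7 := pow_le_pow_left₀ (by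
      have : 0 ≤ 1 - γ := by linarith
      positivity) htilt 2
    refine le_trans ?_ h7
    rw [mul_pow, mul_pow]
    exact mul_le_mul_of_nonneg_right hR (sq_nonneg _)

/-- The loss of the factor `d` in the size test is covered by `2 ^ k`. -/
theorem size_bound {d k l n' : ℕ} {M W T : ℝ} (hM : 0 < M) (hM1 : M ≤ 1) (hd : (1 : ℝ) ≤ d)
    (hW : 0 < W) (hT : M * W / 2 ≤ T) (hl : l + 1 ≤ n')
    (H : (2 * d : ℝ) ^ n' ≤ 2 ^ k * M ^ n') : (d * W) ^ (l + 1) ≤ 2 ^ k * T ^ (l + 1) := by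
  -- Since `M ≤ 1 ≤ 2 d`, the condition at the exponent `n'` implies the one at every smaller
  -- exponent.
  have h6 : (2 * d : ℝ) ^ (l + 1) ≤ 2 ^ k * M ^ (l + 1) := by
    have h7 : M ^ (n' - (l + 1)) ≤ (2 * d : ℝ) ^ (n' - (l + 1)) :=
      pow_le_pow_left₀ hM.le (by linarith) _
    have hsplit : n' = (l + 1) + (n' - (l + 1)) := by omega
    have hp : 0 < M ^ (n' - (l + 1)) := by positivity
    refine le_of_mul_le_mul_right ?_ hp
    calc (2 * d : ℝ) ^ (l + 1) * M ^ (n' - (l + 1))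
        ≤ (2 * d : ℝ) ^ (l + 1) * (2 * d : ℝ) ^ (n' - (l + 1)) := by gcongr
      _ = (2 * d : ℝ) ^ n' := by rw [← pow_add, ← hsplit]
      _ ≤ _ := H
      _ = 2 ^ k * M ^ (l + 1) * M ^ (n' - (l + 1)) := by
        rw [mul_assoc, ← pow_add, ← hsplit]
  calc (d * W) ^ (l + 1) = (2 * d : ℝ) ^ (l + 1) * (W / 2) ^ (l + 1) := by
        rw [← mul_pow]; ring
    _ ≤ 2 ^ k * M ^ (l + 1) * (W / 2) ^ (l + 1) := by gcongr
    _ = 2 ^ k * (M * W / 2) ^ (l + 1) := by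
        rw [mul_assoc, ← mul_pow]; ring
    _ ≤ 2 ^ k * T ^ (l + 1) := by gcongr

theorem one_sub_le_sq_mul {γ δ : ℝ} (hγ1 : γ ≤ 1 / 8) (hδ : 4 * γ ≤ δ) :
    1 - δ ≤ (1 - γ) ^ 2 * (1 - 2 * γ) := by
  have h1 : 1 - 2 * γ ≤ (1 - γ) ^ 2 := by nlinarith [sq_nonneg γ]
  have h2 := mul_le_mul_of_nonneg_right h1 (show 0 ≤ 1 - 2 * γ by linarith)
  nlinarith [sq_nonneg γ]

set_option maxHeartbeats 800000 in
-- The hypotheses have separate roles: `H2` turns the large moment into `f n ≥ T ^ n`, `H3` makes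
-- `J` steps enough for stationarity, `H4` keeps the degrees within `k`, `H5` makes `r` so large
-- that rounding it to an integer is harmless, `H6` gives the size test, and `H7` bounds the integer
-- shift.
theorem exists_good {d k n J N0 : ℕ} {L : MvPolynomial (Fin d) ℝ →ₗ[ℝ] ℝ} {γ δ : ℝ}
    (hL : BallFunctional d (k + 2) L) (hd : 0 < d) (hM : 0 < L (normSq d)) (hγ : 0 < γ)
    (hγ1 : γ ≤ 1 / 8) (hδ : 4 * γ ≤ δ) (hn : 1 ≤ n)
    (H2 : (2 * n + 1 : ℝ) ^ (2 * d) * ((1 - 2 * γ) * ((N0 : ℝ) + d) ^ 2) ^ n ≤ (N0 : ℝ) ^ (2 * n))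
    (H3 : 1 < (1 - 2 * γ) * L (normSq d) * (1 + γ ^ 2) ^ J)
    (H4 : 2 * (n + J) ≤ k)
    (H5 : 2 ≤ γ ^ 2 * L (normSq d) * (N0 : ℝ) ^ 2)
    (H6 : (2 * d : ℝ) ^ (n + J) ≤ 2 ^ k * L (normSq d) ^ (n + J))
    (H7 : d + 1 ≤ N0) :
    ∃ (ω : Fin d → ℤ) (a : ℤ) (l : ℕ), (∀ i, |ω i| ≤ 2 * N0) ∧ |a| ≤ 2 * N0 ∧ 1 ≤ l ∧ 2 * l ≤ k ∧
      ∀ w : ℕ → ℝ, (∀ i : Fin d, w i = ω i) → w d = a →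
        Good d k L ((1 - δ) * L (normSq d)) w l := by
  obtain ⟨ω, hω1, hω2, hω3, hω4⟩ := exists_large_moment (n := n) hL (by omega) hn hM N0
  set M := L (normSq d) with hMdef
  have hM1 : M ≤ 1 := hL.normSq_le_one (by omega)
  set w0 : ℕ → ℝ := fun i => if h : i < d then (ω ⟨i, h⟩ : ℝ) else 0 with hw0
  have hw0' : ∀ i : Fin d, w0 i = ω i := fun i => by simp [hw0]
  replace hω4 := hω4 w0 hw0'
  set u := formOf d w0 with hu
  set W := sumSq d w0 with hW
  have hWeq : W = ∑ i, (ω i : ℝ) ^ 2 := by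
    rw [hW, sumSq, Finset.sum_range]
    exact Finset.sum_congr rfl fun i _ => by rw [hw0']
  rw [← hWeq] at hω2 hω3
  have hud : u.totalDegree ≤ 1 := totalDegree_formOf d w0
  have hN0 : (d : ℝ) + 1 ≤ N0 := by exact_mod_cast H7
  have hd' : (1 : ℝ) ≤ d := by exact_mod_cast hd
  have hN0pos : (0 : ℝ) < N0 := by linarith
  have hWpos : 0 < W := lt_of_lt_of_le (by positivity) hω2
  set T := (1 - 2 * γ) * M * W with hT
  have hγ2 : 0 < 1 - 2 * γ := by linarith
  have hTpos : 0 < T := by positivity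
  set f : ℕ → ℝ := fun j => L (u ^ (2 * j)) with hf
  have hf0 : f 0 = 1 := by simp [hf, hL.one]
  have hnonneg : ∀ j, 2 * j ≤ k + 2 → 0 ≤ f j := fun j hj => hL.even_nonneg hud hj
  have hlog : ∀ j, 2 * (j + 2) ≤ k + 2 → f (j + 1) ^ 2 ≤ f j * f (j + 2) :=
    fun j hj => hL.logConvex hud hj
  have hbound : ∀ j, 2 * (j + 1) ≤ k + 2 → f (j + 1) ≤ W * f j :=
    fun j hj => hL.pow_succ_le w0 hj
  have hfn : T ^ n ≤ f n := by
    have hb : (0 : ℝ) < (2 * n + 1 : ℝ) ^ (2 * d) := by positivity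
    refine le_of_mul_le_mul_left ?_ hb
    calc (2 * n + 1 : ℝ) ^ (2 * d) * T ^ n
        ≤ (2 * n + 1 : ℝ) ^ (2 * d) * ((1 - 2 * γ) * M * ((N0 : ℝ) + d) ^ 2) ^ n := by
          rw [hT]
          gcongr
      _ = (2 * n + 1 : ℝ) ^ (2 * d) * ((1 - 2 * γ) * ((N0 : ℝ) + d) ^ 2) ^ n * M ^ n := by
          rw [mul_assoc _ _ (M ^ n), ← mul_pow]
          congr 2
          ring
      _ ≤ (N0 : ℝ) ^ (2 * n) * M ^ n := by gcongr
      _ ≤ _ := hω4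
  -- A bootstrap: `f j ≥ T ^ j` gives the ratio bound at `j`, and this gives `f (j + 1) ≥ T ^ (j +
  -- 1)`.
  have hsucc : ∀ t, t ≤ J → T ^ (n + t) ≤ f (n + t) ∧ T * f (n + t) ≤ f (n + t + 1) := by
    intro t
    induction t with
    | zero =>
      intro _
      exact ⟨hfn, mul_le_of_pow_le hTpos hn hf0 (fun j hj => hnonneg j (by omega))
        (fun j hj => hlog j (by omega)) hfn⟩
    | succ t ih =>
      intro ht
      obtain ⟨h1, h2⟩ := ih (by omega)
      have h3 : T ^ (n + (t + 1)) ≤ f (n + (t + 1)) := by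
        rw [show n + (t + 1) = n + t + 1 by ring, pow_succ, mul_comm]
        exact (mul_le_mul_of_nonneg_left h1 hTpos.le).trans h2
      exact ⟨h3, mul_le_of_pow_le hTpos (by omega) hf0 (fun j hj => hnonneg j (by omega))
        (fun j hj => hlog j (by omega)) h3⟩
  obtain ⟨l, hl1, hl2, hl3⟩ := exists_stationary (f := f) (n := n) (J := J) (T := T) (W := W)
    (ε := γ ^ 2) (sq_nonneg γ)
    (fun j hj hj' => by
      obtain ⟨t, rfl⟩ := Nat.exists_eq_add_of_le hj
      exact lt_of_lt_of_le (by positivity) (hsucc t (by omega)).1)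
    (hsucc 0 (by omega)).2 (hbound _ (by omega)) (by
      rw [hT]
      nlinarith)
  obtain ⟨t, rfl⟩ := Nat.exists_eq_add_of_le hl1
  obtain ⟨hl4, hl5⟩ := hsucc t (by omega)
  have hl6 := (hsucc (t + 1) (by omega)).1
  set l := n + t with hl
  rw [show n + (t + 1) = l + 1 by rw [hl]; ring] at hl6
  have hF : 0 < f l := lt_of_lt_of_le (by positivity) hl4
  have hF1 : 0 < f (l + 1) := lt_of_lt_of_le (by positivity) hl6
  set r := √(f (l + 1) / f l) with hr
  have hr2 : r ^ 2 = f (l + 1) / f l := Real.sq_sqrt (by positivity)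
  have hrpos : 0 < r := Real.sqrt_pos.mpr (by positivity)
  have hr2' : f (l + 1) = r ^ 2 * f l := by rw [hr2]; field_simp
  have hTr : T ≤ r ^ 2 := by rw [hr2, le_div_iff₀ hF]; exact hl5
  have hrW : r ^ 2 ≤ W := by
    rw [hr2, div_le_iff₀ hF]
    exact hbound l (by omega)
  -- Since `γ r ≥ 1`, the integer `⌈r⌉` lies between `r` and `(1 + γ) r`.
  have hγr : 1 ≤ γ * r := by
    have h1 : 1 ≤ (γ * r) ^ 2 := by
      have h2 : γ ^ 2 * M * (N0 : ℝ) ^ 2 ≤ γ ^ 2 * M * W := by gcongr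
      have h3 : M * W / 2 ≤ T := by
        rw [hT]
        have : 0 < M * W := by positivity
        nlinarith
      have h4 : γ ^ 2 * (M * W / 2) ≤ γ ^ 2 * r ^ 2 := by
        have := h3.trans hTr
        gcongr
      rw [mul_pow]
      linarith
    exact (one_le_sq_iff₀ (by positivity)).mp h1
  set a : ℕ := ⌈r⌉₊ with ha
  have ha1 : r ≤ a := Nat.le_ceil r
  have ha2 : (a : ℝ) < r + 1 := Nat.ceil_lt_add_one hrpos.le
  have haN : a ≤ 2 * N0 := by
    have h1 : r ≤ N0 + d := (abs_le_of_sq_le_sq' (hrW.trans hω3) (by positivity)).2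
    have h2 : (a : ℝ) < 2 * N0 := by linarith
    have h3 : (a : ℝ) < (2 * N0 : ℕ) := by push_cast; exact h2
    exact (Nat.cast_lt.mp h3).le
  have hR : (1 - δ) * M * W ≤ (1 - γ) ^ 2 * r ^ 2 := by
    have h1 := one_sub_le_sq_mul hγ1 hδ
    have h2 : (1 - γ) ^ 2 * T ≤ (1 - γ) ^ 2 * r ^ 2 := by gcongr
    have h3 : (1 - δ) * (M * W) ≤ (1 - γ) ^ 2 * (1 - 2 * γ) * (M * W) := by gcongr
    rw [hT] at h2
    linarith
  have hTMW : M * W / 2 ≤ T := by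
    rw [hT]
    have : 0 < M * W := by positivity
    nlinarith
  have hZ := size_bound (l := l) hM hM1 hd' hWpos hTMW (by omega) H6
  have hl7 : f (l + 2) ≤ (1 + γ ^ 2) * r ^ 4 * f l := by
    have : f (l + 2) * f l ≤ (1 + γ ^ 2) * r ^ 4 * f l * f l := by
      refine hl3.trans (le_of_eq ?_)
      rw [hr2']
      ring
    exact le_of_mul_le_mul_right this hF
  have main : ∀ w : ℕ → ℝ, sumSq d w = W → w d = a →
      (∀ j, L (formOf d w ^ (2 * j)) = f j) → 0 ≤ L (formOf d w ^ (2 * l + 1)) →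
      Good d k L ((1 - δ) * M) w l := by
    intro w hwW hwa hwf hwe
    have e2 : L (formOf d w ^ (2 * l + 2)) = f (l + 1) := hwf (l + 1)
    have e4 : L (formOf d w ^ (2 * l + 4)) = f (l + 2) := hwf (l + 2)
    refine good_of_moments hL hγ (by linarith) (by omega) (by rw [hwf]; exact hF) hwe hrpos
      (by rw [e2, hwf, hr2']) (by rw [e4, hwf]; exact hl7) (by rw [hwa]; exact ha1)
      (by rw [hwa]; linarith) (by rw [hwW]; exact hR) ?_
    rw [hwW, e2]
    exact hZ.trans (by gcongr)
  have hωN : ∀ i, |ω i| ≤ 2 * (N0 : ℤ) := fun i => (hω1 i).trans (by omega)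
  have haN' : |(a : ℤ)| ≤ 2 * (N0 : ℤ) := by
    rw [abs_of_nonneg (by positivity)]
    exact_mod_cast haN
  -- Replacing `w` by `-w` changes only the odd moments, so the odd moment may be taken nonnegative.
  rcases le_total 0 (L (u ^ (2 * l + 1))) with hsgn | hsgn
  · refine ⟨ω, a, l, hωN, haN', by omega, by omega, fun w hw hwa => ?_⟩
    have hform : formOf d w = u := by
      rw [hu, formOf, formOf]
      exact Finset.sum_congr rfl fun i _ => by rw [hw, hw0']
    refine main w (sumSq_congr d fun i => by rw [hw, hw0']) (by simpa using hwa)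
      (fun j => by rw [hform]) (by rwa [hform])
  · refine ⟨fun i => - ω i, a, l, fun i => by rw [abs_neg]; exact hωN i, haN', by omega, by omega,
      fun w hw hwa => ?_⟩
    have hform : formOf d w = - u := formOf_neg d fun i => by rw [hw, hw0']; push_cast; rfl
    refine main w (sumSq_congr d fun i => by rw [hw, hw0']; push_cast; ring) (by simpa using hwa)
      (fun j => by rw [hform, (even_two_mul j).neg_pow]) ?_
    rw [hform, (odd_two_mul_add_one l).neg_pow, map_neg]
    linarith

/-! ### The reweighting polynomial of a good candidate -/

theorem evalAt_linForm {d : ℕ} (v x : Vec d) : evalAt (linForm v) x = inner ℝ v x := by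
  simp [evalAt, linForm, PiLp.inner_apply, mul_comm]

theorem evalAt_formOf {d : ℕ} (w : ℕ → ℝ) (x : Vec d) :
    evalAt (formOf d w) x = ∑ i : Fin d, w i * x i := by
  simp [evalAt, formOf]

theorem evalAt_normSq {d : ℕ} (x : Vec d) : evalAt (normSq d) x = ‖x‖ ^ 2 := by
  simp [evalAt, normSq, EuclideanSpace.norm_sq_eq]

theorem evalAt_mul {d : ℕ} (p q : MvPolynomial (Fin d) ℝ) (x : Vec d) :
    evalAt (p * q) x = evalAt p x * evalAt q x := by
  simp [evalAt]

theorem evalAt_pow {d : ℕ} (p : MvPolynomial (Fin d) ℝ) (n : ℕ) (x : Vec d) :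
    evalAt (p ^ n) x = evalAt p x ^ n := by
  simp [evalAt]

/-- The unit vector in the direction of `w`. -/
noncomputable def unitVec (d : ℕ) (w : ℕ → ℝ) : Vec d :=
  WithLp.toLp 2 fun i : Fin d => w i / √(sumSq d w)

theorem sumSq_eq (d : ℕ) (w : ℕ → ℝ) : sumSq d w = ∑ i : Fin d, w i ^ 2 := by
  rw [sumSq, Finset.sum_range]

theorem norm_unitVec {d : ℕ} {w : ℕ → ℝ} (hW : 0 < sumSq d w) : ‖unitVec d w‖ = 1 := by
  rw [EuclideanSpace.norm_eq, Real.sqrt_eq_one]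
  simp only [unitVec, Real.norm_eq_abs, sq_abs, div_pow, Real.sq_sqrt hW.le]
  rw [← Finset.sum_div, ← sumSq_eq, div_self hW.ne']

theorem formOf_eq {d : ℕ} {w : ℕ → ℝ} (hW : 0 < sumSq d w) :
    formOf d w = C (√(sumSq d w)) * linForm (unitVec d w) := by
  rw [formOf, linForm, Finset.mul_sum]
  refine Finset.sum_congr rfl fun i _ => ?_
  rw [← mul_assoc, ← C_mul]
  congr 2
  simp only [unitVec]
  field_simp

theorem formOf_sq_le_eval {d : ℕ} (w : ℕ → ℝ) (x : Vec d) :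
    evalAt (formOf d w) x ^ 2 ≤ sumSq d w * ‖x‖ ^ 2 := by
  rw [evalAt_formOf, sumSq_eq, EuclideanSpace.norm_sq_eq]
  simp only [Real.norm_eq_abs, sq_abs]
  exact Finset.sum_mul_sq_le_sq_mul_sq _ _ _

/-- Every monomial of the product receives at most one contribution from the constant and one from
each variable. -/
theorem abs_coeff_affine_mul_le {d : ℕ} (w : ℕ → ℝ) (a : ℝ) {f : MvPolynomial (Fin d) ℝ} {b : ℝ}
    (hf : ∀ α, |f.coeff α| ≤ b) (α : Fin d →₀ ℕ) :
    |((C a + formOf d w) * f).coeff α| ≤ (|a| + ∑ i : Fin d, |w i|) * b := by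
  classical
  have hb : 0 ≤ b := (abs_nonneg _).trans (hf 0)
  rw [add_mul, coeff_add, coeff_C_mul, formOf, Finset.sum_mul, coeff_sum, add_mul, Finset.sum_mul]
  refine (abs_add_le _ _).trans (add_le_add ?_ ((Finset.abs_sum_le_sum_abs _ _).trans
    (Finset.sum_le_sum fun i _ => ?_)))
  · rw [abs_mul]
    exact mul_le_mul_of_nonneg_left (hf α) (abs_nonneg _)
  · rw [mul_assoc, coeff_C_mul, abs_mul, coeff_X_mul']
    refine mul_le_mul_of_nonneg_left ?_ (abs_nonneg _)
    split_ifs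
    · exact hf _
    · simpa using hb

theorem abs_coeff_pow_le {d : ℕ} (w : ℕ → ℝ) (j : ℕ) (α : Fin d →₀ ℕ) :
    |(formOf d w ^ j).coeff α| ≤ (∑ i : Fin d, |w i|) ^ j := by
  classical
  induction j generalizing α with
  | zero =>
    rw [pow_zero, pow_zero, coeff_one]
    split_ifs <;> simp
  | succ j ih =>
    have := abs_coeff_affine_mul_le w 0 ih α
    rw [C_0, zero_add, abs_zero, zero_add] at this
    rwa [pow_succ', pow_succ']

/-- Each affine factor multiplies the coefficient bound by its `ℓ¹` norm, and the square of the `ℓ¹`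
norm of `w` is at most `d` times the sum of squares. This is the origin of the factor `d` in the
size test. -/
theorem abs_coeff_le {d : ℕ} (w : ℕ → ℝ) (a : ℝ) (l : ℕ) (α : Fin d →₀ ℕ) :
    |(formOf d w ^ (2 * l) * (C a + formOf d w) ^ 2).coeff α| ≤
      (d * sumSq d w) ^ l * (2 * (a ^ 2 + d * sumSq d w)) := by
  set S := ∑ i : Fin d, |w i| with hS
  have hS0 : 0 ≤ S := Finset.sum_nonneg fun i _ => abs_nonneg _
  have hS2 : S ^ 2 ≤ d * sumSq d w := by
    have := sq_sum_le_card_mul_sum_sq (s := Finset.univ) (f := fun i : Fin d => |w i|)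
    rw [sumSq_eq]
    simpa using this
  have h1 := abs_coeff_affine_mul_le w a (abs_coeff_affine_mul_le w a
    (abs_coeff_pow_le (d := d) w (2 * l))) α
  rw [← hS] at h1
  have e : formOf d w ^ (2 * l) * (C a + formOf d w) ^ 2 =
    (C a + formOf d w) * ((C a + formOf d w) * formOf d w ^ (2 * l)) := by ring
  rw [e]
  refine h1.trans ?_
  have h2 : (|a| + S) ^ 2 ≤ 2 * (a ^ 2 + d * sumSq d w) := by
    have := sq_abs a
    nlinarith [sq_nonneg (|a| - S)]
  calc (|a| + S) * ((|a| + S) * S ^ (2 * l)) = (S ^ 2) ^ l * (|a| + S) ^ 2 := by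
        rw [← pow_mul]; ring
    _ ≤ _ := by
      have : 0 ≤ d * sumSq d w := (sq_nonneg S).trans hS2
      gcongr

theorem two_mul_four_pow_le {k : ℕ} (hk : 2 ≤ k) : 2 ^ k * (2 * (4 ^ k + 1)) ≤ (2 : ℝ) ^ (4 * k) := by
  have h1 : (1 : ℝ) ≤ 4 ^ k := one_le_pow₀ (by norm_num)
  have h2 : (4 : ℝ) ≤ 2 ^ k := by
    calc (4 : ℝ) = 2 ^ 2 := by norm_num
      _ ≤ 2 ^ k := pow_le_pow_right₀ (by norm_num) hk
  have h3 : (2 : ℝ) ^ (4 * k) = 2 ^ k * (2 ^ k * 4 ^ k) := by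
    have : (4 : ℝ) ^ k = 2 ^ k * 2 ^ k := by rw [← mul_pow]; norm_num
    rw [this]
    ring
  rw [h3]
  refine mul_le_mul_of_nonneg_left ?_ (by positivity)
  nlinarith

set_option maxHeartbeats 800000 in
-- Everything is deduced from the test itself and not from the way a good candidate was constructed,
-- because the search may stop at another one. Besides the test, only integrality of `w`, `l ≥ 1`
-- and the crude bound on `a` enter.
theorem good_reweighting {d k l K : ℕ} {L : MvPolynomial (Fin d) ℝ →ₗ[ℝ] ℝ}
    {E : (Vec d → ℝ) → ℝ} {δ : ℝ} {w : ℕ → ℝ} (hL : BallFunctional d (k + 2) L)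
    (hE : ∀ p, E (evalAt p) = L p) (hd : 0 < d) (hl : 1 ≤ l) (hK : 4 ≤ K)
    (hgood : Good d k L ((1 - δ) * L (normSq d)) w l)
    (hw : ∀ i : Fin d, ∃ z : ℤ, w i = z) (ha : w d ^ 2 ≤ 4 ^ k)
    {p : MvPolynomial (Fin d) ℝ}
    (hp : p = C (L (formOf d w ^ (2 * l) * (C (w d) + formOf d w) ^ 2))⁻¹ *
      (formOf d w ^ (2 * l) * (C (w d) + formOf d w) ^ 2)) :
    IsReweightingPoly k E p ∧
    (∃ g : MvPolynomial (Fin d) ℝ, p = g ^ 2 ∧ 2 * g.totalDegree ≤ k) ∧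
    (∃ v : Vec d, ‖v‖ = 1 ∧ (1 - δ) * L (normSq d) ≤ L (p * linForm v) ^ 2) ∧
    (∀ α, |p.coeff α| ≤ 2 ^ (K * k)) ∧ HasFixingShape K k δ E p := by
  obtain ⟨hk, hZ, hF1, hS⟩ := hgood
  set u := formOf d w with hu
  set W := sumSq d w with hWdef
  set a := w d with hadef
  set M := L (normSq d) with hMdef
  have hud : u.totalDegree ≤ 1 := totalDegree_formOf d w
  have hW0 : 0 ≤ W := Finset.sum_nonneg fun i _ => sq_nonneg _
  -- If `w = 0` then `u = 0`, and as `l ≥ 1` both sides of the strict size test vanish.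
  have hWpos : 0 < W := by
    rcases hW0.eq_or_lt with h | h
    · exfalso
      have h0 : ∀ i : Fin d, w i = 0 := by
        intro i
        rw [hWdef, sumSq_eq, eq_comm, Finset.sum_eq_zero_iff_of_nonneg fun i _ => sq_nonneg _] at h
        exact pow_eq_zero_iff (two_ne_zero) |>.mp (h i (Finset.mem_univ i))
      have hu0 : u = 0 := by
        rw [hu, formOf]
        exact Finset.sum_eq_zero fun i _ => by rw [h0 i, C_0, zero_mul]
      rw [hu0, ← h, zero_pow (by omega), zero_mul, map_zero] at hZ
      simp at hZ
    · exact h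
  have hW1 : 1 ≤ W := by
    choose z hz using hw
    have h1 : W = ((∑ i : Fin d, z i ^ 2 : ℤ) : ℝ) := by
      rw [hWdef, sumSq_eq]
      push_cast
      exact Finset.sum_congr rfl fun i _ => by rw [hz]
    rw [h1] at hWpos ⊢
    exact_mod_cast Int.cast_pos.mp hWpos
  have hd1 : (1 : ℝ) ≤ d := by exact_mod_cast hd
  have hdW : 0 < d * W := by positivity
  set P := u ^ (2 * l) * (C a + u) ^ 2 with hP
  set Nn := L P with hNn
  have hNpos : 0 < Nn := by
    have : 0 < 2 ^ k * Nn := lt_trans (by positivity) hZ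
    exact (mul_pos_iff_of_pos_left (by positivity)).mp this
  have hbig := two_mul_four_pow_le (k := k) (by omega)
  have hKk : (2 : ℝ) ^ (4 * k) ≤ 2 ^ (K * k) := pow_le_pow_right₀ (by norm_num) (by gcongr)
  have hkK : (2 : ℝ) ^ (K * k) ≤ (k : ℝ) ^ (K * k) := by
    have : (2 : ℝ) ≤ k := by exact_mod_cast (by omega : 2 ≤ k)
    gcongr
  set F0 := L (u ^ (2 * l)) with hF0
  set F1 := L (u ^ (2 * l + 2)) with hF1def
  -- This is `(a + u)² ≤ 2 a² + 2 u²` under the weight `u^(2l)`. It lets the size test, stated for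
  -- the full polynomial, also control the normalization of the homogeneous factor `u^(2l)`.
  have hNle : Nn ≤ 2 * (a ^ 2 + W) * F0 := by
    have h1 := hL.sq_nonneg (u ^ l * (C (-a) + u)) (by
      have h1 := totalDegree_pow_le_of hud l
      have h2 := totalDegree_mul_le_of h1
        (totalDegree_add_le_of (f := C (-a)) (by rw [totalDegree_C]; omega) hud)
      omega)
    have e : (u ^ l * (C (-a) + u)) ^ 2 = u ^ (2 * l) * (C (-a) + u) ^ 2 := by ring
    rw [e, map_shift_sq] at h1
    have h2 : Nn = a ^ 2 * F0 + 2 * a * L (u ^ (2 * l + 1)) + F1 := map_shift_sq _ _ _ _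
    have h3 : F1 ≤ W * F0 := hL.pow_succ_le w (j := l) (by omega)
    nlinarith
  have haW : a ^ 2 + W ≤ (4 ^ k + 1) * W := by nlinarith
  have haW' : a ^ 2 + d * W ≤ (4 ^ k + 1) * (d * W) := by nlinarith
  have haWpos : 0 < a ^ 2 + W := by positivity
  have hF0pos : 0 < F0 := by
    have : 0 < 2 * (a ^ 2 + W) * F0 := lt_of_lt_of_le hNpos hNle
    exact (mul_pos_iff_of_pos_left (by positivity)).mp this
  have hZW : W ^ (l + 1) ≤ 2 ^ k * Nn := by
    refine le_trans (pow_le_pow_left₀ hW0 ?_ _) hZ.le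
    nlinarith
  set v := unitVec d w with hv
  have hform : u = C (√W) * linForm v := formOf_eq hWpos
  have hsq : √W ^ 2 = W := Real.sq_sqrt hW0
  have hsqrt : 0 < √W := Real.sqrt_pos.mpr hWpos
  have hvpow : ∀ j, W ^ j * L (linForm v ^ (2 * j)) = L (u ^ (2 * j)) := by
    intro j
    rw [hform, mul_pow, ← C_pow, map_C_mul, pow_mul (√W), hsq]
  have hEv : ∀ j, E (fun x => inner ℝ v x ^ (2 * j)) = L (linForm v ^ (2 * j)) := by
    intro j
    rw [← hE]
    congr 1
    funext x
    rw [evalAt_pow, evalAt_linForm]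
  have hEn : E (fun x => ‖x‖ ^ 2) = M := by
    rw [hMdef, ← hE]
    congr 1
    funext x
    rw [evalAt_normSq]
  have hinner : ∀ x : Vec d, inner ℝ v x ^ 2 ≤ ‖x‖ ^ 2 := by
    intro x
    have h1 := abs_real_inner_le_norm v x
    rw [norm_unitVec hWpos, one_mul] at h1
    rw [← sq_abs]
    exact pow_le_pow_left₀ (abs_nonneg _) h1 2
  have hLp : L p = 1 := by rw [hp, map_C_mul, inv_mul_cancel₀ hNpos.ne']
  -- One square rather than a sum of squares: this makes the reweighted functional easy to test on
  -- squares later.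
  have hg : p = (C (√Nn⁻¹) * (u ^ l * (C a + u))) ^ 2 := by
    rw [hp, mul_pow, ← C_pow, Real.sq_sqrt (by positivity)]
    ring
  have hgdeg : 2 * (C (√Nn⁻¹) * (u ^ l * (C a + u))).totalDegree ≤ k := by
    have h1 := totalDegree_pow_le_of hud l
    have h2 := totalDegree_mul_le_of h1
      (totalDegree_add_le_of (f := C a) (by rw [totalDegree_C]; omega) hud)
    have h3 := totalDegree_mul_le_of (f := C (√Nn⁻¹)) (a := 0) (by rw [totalDegree_C]) h2
    omega
  refine ⟨⟨?_, ?_, ?_⟩, ⟨_, hg, hgdeg⟩, ⟨v, norm_unitVec hWpos, ?_⟩, ?_, ?_⟩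
  · rw [hg, sq]
    exact IsSumSq.mul_self _
  · rw [hg]
    exact (totalDegree_pow _ _).trans hgdeg
  · rw [hE, hLp]
  · have h1 : L (p * linForm v) = L (P * u) / (Nn * √W) := by
      have : P * u = C (√W) * (P * linForm v) := by
        conv_lhs => rw [hform]
        ring
      rw [this, hp, map_C_mul, mul_assoc, map_C_mul]
      field_simp
    rw [h1, div_pow, mul_pow, hsq, le_div_iff₀ (by positivity)]
    linarith
  · intro α
    rw [hp, coeff_C_mul, abs_mul, abs_of_pos (inv_pos.mpr hNpos), inv_mul_le_iff₀ hNpos]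
    refine (abs_coeff_le w a l α).trans ?_
    calc (d * W) ^ l * (2 * (a ^ 2 + d * W)) ≤ (d * W) ^ l * (2 * ((4 ^ k + 1) * (d * W))) := by
          gcongr
      _ = (d * W) ^ (l + 1) * (2 * (4 ^ k + 1)) := by ring
      _ ≤ 2 ^ k * Nn * (2 * (4 ^ k + 1)) := by gcongr
      _ = Nn * (2 ^ k * (2 * (4 ^ k + 1))) := by ring
      _ ≤ Nn * 2 ^ (K * k) := by
        have := hbig.trans hKk
        gcongr
  -- Since `u = √W ⟨v, x⟩`, the factor `W^l` coming from `u^(2l)` and the normalization go into `q`.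
  · refine ⟨v, l, Polynomial.C (√(W ^ l / Nn)) ^ 2 *
      (Polynomial.C a + Polynomial.C (√W) * Polynomial.X) ^ 2, norm_unitVec hWpos, ?_, ?_, ?_, ?_,
      ?_, ?_, ?_⟩
    · rw [← mul_pow, sq]
      exact IsSumSq.mul_self _
    · have h1 : (Polynomial.C a + Polynomial.C (√W) * Polynomial.X).natDegree ≤ 1 := by
        compute_degree
      have h2 : (Polynomial.C (√(W ^ l / Nn)) ^ 2 *
        (Polynomial.C a + Polynomial.C (√W) * Polynomial.X) ^ 2).natDegree ≤ 0 + 2 * 1 := by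
        refine Polynomial.natDegree_mul_le_of_le ?_ (Polynomial.natDegree_pow_le_of_le 2 h1)
        rw [← Polynomial.C_pow, Polynomial.natDegree_C]
      omega
    · have h1 : ∀ b : ℝ, Polynomial.aeval (linForm v) (Polynomial.C b) = C b := fun b => by
        rw [Polynomial.aeval_C, MvPolynomial.algebraMap_eq]
      simp only [map_mul, map_pow, map_add, h1, Polynomial.aeval_X]
      rw [← hform, ← C_pow, Real.sq_sqrt (by positivity), hp, hP]
      have h2 : u ^ (2 * l) = C (W ^ l) * linForm v ^ (2 * l) := by
        rw [hform, mul_pow, ← C_pow, pow_mul (√W), hsq]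
      have h3 : (C (W ^ l / Nn) : MvPolynomial (Fin d) ℝ) = C Nn⁻¹ * C (W ^ l) := by
        rw [← C_mul]
        congr 1
        field_simp
      rw [h2, h3]
      ring
    · rw [hEv]
      have := hvpow l
      rw [← hF0] at this
      have h1 : 0 < W ^ l * L (linForm v ^ (2 * l)) := by rw [this]; exact hF0pos
      exact (mul_pos_iff_of_pos_left (by positivity)).mp h1
    · intro x
      rw [hEv]
      have h1 := hvpow l
      rw [← hF0] at h1
      have h2 : L (linForm v ^ (2 * l)) = F0 / W ^ l := by rw [← h1]; field_simp
      have h3 : inner ℝ v x ^ (2 * l) ≤ ‖x‖ ^ (2 * l) := by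
        rw [pow_mul, pow_mul]
        exact pow_le_pow_left₀ (sq_nonneg _) (hinner x) l
      have h4 : W ^ l / F0 ≤ (k : ℝ) ^ (K * k) := by
        refine le_trans ?_ (hbig.trans (hKk.trans hkK))
        rw [div_le_iff₀ hF0pos]
        refine le_of_mul_le_mul_right ?_ hWpos
        calc W ^ l * W = W ^ (l + 1) := by ring
          _ ≤ 2 ^ k * Nn := hZW
          _ ≤ 2 ^ k * (2 * (a ^ 2 + W) * F0) := by gcongr
          _ ≤ 2 ^ k * (2 * ((4 ^ k + 1) * W) * F0) := by gcongr
          _ = _ := by ring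
      have h5 : 0 ≤ inner ℝ v x ^ (2 * l) := (even_two_mul l).pow_nonneg _
      rw [h2, div_div_eq_mul_div, mul_div_assoc, mul_comm]
      gcongr
    · have e1 : E (fun x => inner ℝ v x ^ (2 * l) * inner ℝ v x ^ 2) =
          L (linForm v ^ (2 * (l + 1))) := by
        rw [← hEv]
        congr 1
        funext x
        ring
      rw [e1, hEv, hEn]
      have h1 := hvpow l
      have h2 := hvpow (l + 1)
      rw [← hF0] at h1
      rw [show u ^ (2 * (l + 1)) = u ^ (2 * l + 2) by ring, ← hF1def] at h2
      have h3 : L (linForm v ^ (2 * l)) = F0 / W ^ l := by rw [← h1]; field_simp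
      have h4 : L (linForm v ^ (2 * (l + 1))) = F1 / W ^ (l + 1) := by rw [← h2]; field_simp
      rw [h3, h4]
      have h5 : F1 / W ^ (l + 1) / (F0 / W ^ l) = F1 / (W * F0) := by
        rw [pow_succ]
        field_simp
      rw [h5, le_div_iff₀ (by positivity)]
      linarith
    · intro x
      set m := max 1 ‖x‖ with hm
      have hm1 : 1 ≤ m := le_max_left _ _
      have hmx : ‖x‖ ≤ m := le_max_right _ _
      have hux : evalAt u x ^ 2 ≤ W * ‖x‖ ^ 2 := formOf_sq_le_eval w x
      have h1 : evalAt p x = Nn⁻¹ * ((evalAt u x ^ 2) ^ l * (a + evalAt u x) ^ 2) := by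
        rw [hp, hP, ← pow_mul]
        simp [evalAt]
      have h2 : (a + evalAt u x) ^ 2 ≤ 2 * (a ^ 2 + W) * m ^ 2 := by
        have h3 : ‖x‖ ^ 2 ≤ m ^ 2 := pow_le_pow_left₀ (norm_nonneg _) hmx 2
        have h4 : 1 ≤ m ^ 2 := one_le_pow₀ hm1
        have h5 : W * ‖x‖ ^ 2 ≤ W * m ^ 2 := by gcongr
        have h6 : a ^ 2 * 1 ≤ a ^ 2 * m ^ 2 := by gcongr
        nlinarith [sq_nonneg (a - evalAt u x)]
      rw [h1, inv_mul_le_iff₀ hNpos]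
      calc (evalAt u x ^ 2) ^ l * (a + evalAt u x) ^ 2
          ≤ (W * ‖x‖ ^ 2) ^ l * (2 * (a ^ 2 + W) * m ^ 2) := by gcongr
        _ ≤ (W * ‖x‖ ^ 2) ^ l * (2 * ((4 ^ k + 1) * W) * m ^ (k - 2 * l)) := by
          have : m ^ 2 ≤ m ^ (k - 2 * l) := pow_le_pow_right₀ hm1 (by omega)
          gcongr
        _ = W ^ (l + 1) * (2 * (4 ^ k + 1)) * (‖x‖ ^ (2 * l) * m ^ (k - 2 * l)) := by
          rw [mul_pow, ← pow_mul]
          ring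
        _ ≤ 2 ^ k * Nn * (2 * (4 ^ k + 1)) * (‖x‖ ^ (2 * l) * m ^ (k - 2 * l)) := by gcongr
        _ = Nn * (2 ^ k * (2 * (4 ^ k + 1)) * (‖x‖ ^ (2 * l) * m ^ (k - 2 * l))) := by ring
        _ ≤ _ := by
          have := hbig.trans (hKk.trans hkK)
          gcongr

/-! ### The candidates enumerated by the program -/

theorem exists_code {N d l : ℕ} (ω : Fin d → ℤ) (a : ℤ) (hω : ∀ i, |ω i| ≤ N) (ha : |a| ≤ N)
    (hl : 1 ≤ l) (hl' : l ≤ 2 * N + 1) :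
    ∃ c < (2 * N + 1) ^ (d + 2), (∀ i : Fin d, candidate N c i = ω i) ∧ candidate N c d = a ∧
      candidateExp N d c = l := by
  set e := finFunctionFinEquiv (m := 2 * N + 1) (n := d + 2) with he
  have hdig : ∀ z : ℤ, |z| ≤ N → (z + N).toNat < 2 * N + 1 := fun z hz => by
    have := abs_le.mp hz
    omega
  let f : Fin (d + 2) → Fin (2 * N + 1) := fun i =>
    if h : (i : ℕ) < d then ⟨(ω ⟨i, h⟩ + N).toNat, hdig _ (hω _)⟩
    else if (i : ℕ) = d then ⟨(a + N).toNat, hdig _ ha⟩ else ⟨l - 1, by omega⟩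
  have hf : ∀ i : Fin (d + 2), (e f : ℕ) / (2 * N + 1) ^ (i : ℕ) % (2 * N + 1) = f i := by
    intro i
    have := congrArg Fin.val (congrFun (e.symm_apply_apply f) i)
    exact this
  have hcast : ∀ z : ℤ, |z| ≤ N → (((z + N).toNat : ℕ) : ℝ) - N = z := fun z hz => by
    have h1 := abs_le.mp hz
    have h2 : (((z + N).toNat : ℕ) : ℤ) = z + N := Int.toNat_of_nonneg (by omega)
    have h3 : (((z + N).toNat : ℕ) : ℝ) = z + N := by exact_mod_cast h2
    rw [h3]
    ring
  refine ⟨e f, (e f).2, fun i => ?_, ?_, ?_⟩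
  · have := hf ⟨i, by omega⟩
    simp only at this
    rw [candidate, this, ← hcast _ (hω i)]
    simp [f]
  · have := hf ⟨d, by omega⟩
    simp only at this
    rw [candidate, this, ← hcast _ ha]
    simp [f]
  · have := hf ⟨d + 1, by omega⟩
    simp only at this
    rw [candidateExp, this]
    simp [f]
    omega

theorem candidate_eq_int (N c i : ℕ) : ∃ z : ℤ, candidate N c i = z :=
  ⟨((c / (2 * N + 1) ^ i % (2 * N + 1) : ℕ) : ℤ) - N, by
    rw [candidate, Int.cast_sub, Int.cast_natCast, Int.cast_natCast]⟩

theorem candidate_sq_le (N c i : ℕ) : candidate N c i ^ 2 ≤ (N : ℝ) ^ 2 := by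
  have h1 : c / (2 * N + 1) ^ i % (2 * N + 1) ≤ 2 * N := by
    have := Nat.mod_lt (c / (2 * N + 1) ^ i) (by omega : 0 < 2 * N + 1)
    omega
  have h2 : ((c / (2 * N + 1) ^ i % (2 * N + 1) : ℕ) : ℝ) ≤ 2 * N := by exact_mod_cast h1
  have h3 : (0 : ℝ) ≤ ((c / (2 * N + 1) ^ i % (2 * N + 1) : ℕ) : ℝ) := Nat.cast_nonneg _
  rw [candidate]
  refine sq_le_sq' ?_ ?_ <;> linarith

/-- All polynomials in the test have degree at most `k + 2`, so the pairings of tables are exactly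
the values of `L`. -/
theorem accept_iff_good {d k l : ℕ} {L : MvPolynomial (Fin d) ℝ →ₗ[ℝ] ℝ} {cM : ℝ} {w inp : ℕ → ℝ}
    (hinp : ∀ a, (exponent d k a).degree ≤ k + 2 →
      inp (a + 1) = L (monomial (exponent d k a) 1)) :
    Accept d k cM inp w l ↔ Good d k L cM w l := by
  by_cases hk : 2 * l + 1 < k
  swap
  · exact ⟨fun h => absurd h.1 hk, fun h => absurd h.1 (by omega)⟩
  have hu := totalDegree_formOf d w
  have hCu : (C (w d) + formOf d w).totalDegree ≤ 1 :=
    totalDegree_add_le_of (by rw [totalDegree_C]; omega) hu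
  have hdeg : ∀ i, (formOf d w ^ (2 * l) * (C (w d) + formOf d w) ^ i).totalDegree ≤
      2 * l * 1 + i * 1 := fun i =>
    totalDegree_mul_le_of (totalDegree_pow_le_of hu _) (totalDegree_pow_le_of hCu _)
  have hT : ∀ i ≤ 3, pair ((k + 3) ^ d) inp (mulTab d (k + 3) w (2 * l) i) =
      L (formOf d w ^ (2 * l) * (C (w d) + formOf d w) ^ i) := fun i hi => by
    rw [mulTab_eq, pair_tab ((hdeg i).trans (by omega)) L inp hinp]
  have hS : pair ((k + 3) ^ d) inp (stepTab d (k + 3) w 0 (mulTab d (k + 3) w (2 * l) 2)) =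
      L (formOf d w ^ (2 * l) * (C (w d) + formOf d w) ^ 2 * formOf d w) := by
    rw [mulTab_eq, stepTab_tab, C_0, zero_add, mul_comm (formOf d w),
      pair_tab ((totalDegree_mul_le_of (hdeg 2) hu).trans (by omega)) L inp hinp]
  -- The machine knows only the moments of `u^(2l) (a + u)^i` for `i = 0, 1, 2`; inverting the
  -- binomial expansion recovers the moment of `u^(2l+2)`.
  have h2 : secondMoment (L (formOf d w ^ (2 * l) * (C (w d) + formOf d w) ^ 0))
      (L (formOf d w ^ (2 * l) * (C (w d) + formOf d w) ^ 1))
      (L (formOf d w ^ (2 * l) * (C (w d) + formOf d w) ^ 2)) (w d) =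
      L (formOf d w ^ (2 * l + 2)) := by
    have h1 : L (formOf d w ^ (2 * l) * (C (w d) + formOf d w) ^ 1) =
        w d * L (formOf d w ^ (2 * l)) + L (formOf d w ^ (2 * l + 1)) := by
      rw [pow_one, mul_add, mul_comm _ (C (w d)), map_add, map_C_mul, pow_succ]
    rw [map_shift_sq, h1, pow_zero, mul_one, secondMoment]
    ring
  unfold Accept Good
  simp only [hT 0 (by omega), hT 1 (by omega), hT 2 (by omega), hS, h2]
  rw [pow_zero, mul_one, mul_assoc (cM * sumSq d w), ← sq, ← sq]
  exact and_congr_left fun _ => by omega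

theorem input_normSq {d k : ℕ} {L : MvPolynomial (Fin d) ℝ →ₗ[ℝ] ℝ} {inp : ℕ → ℝ}
    (hinp : ∀ a, (exponent d k a).degree ≤ k + 2 →
      inp (a + 1) = L (monomial (exponent d k a) 1)) :
    ∑ i ∈ Finset.range d, inp (2 * (k + 3) ^ i + 1) = L (normSq d) := by
  classical
  rw [normSq, map_sum, Finset.sum_range]
  refine Finset.sum_congr rfl fun i _ => ?_
  have h1 := number_spec (k := k) (Finsupp.single i 2) (fun j => by
    rw [Finsupp.single_apply]
    split_ifs <;> omega)
  have h2 : number d k (Finsupp.single i 2) = 2 * (k + 3) ^ (i : ℕ) := by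
    rw [number, Finset.sum_eq_single i]
    · simp
    · intro j _ hj
      rw [Finsupp.single_eq_of_ne hj, zero_mul]
    · simp
  rw [h2] at h1
  rw [hinp _ (by rw [h1.2]; simp), h1.2, X_pow_eq_monomial]

/-! ### The program -/

/-- The time bound for the whole program, when the candidate with number `c` is accepted. -/
def totalTime (d k c : ℕ) : ℕ :=
  (13 + (d * ((k + 3) * 3 + 9) + 2) + 2 + (k * 3 + 2) + (d * 3 + 2) + 1 +
      (k * 4 + 1) + (d * 8 + 2) + 5) + ((c + 1) * roundTime d k (2 ^ (k / d)) c + 1)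

/-- The candidate `c` of `exists_good` shows that the search succeeds and bounds its time. The
polynomial is built from the number `c'` at which the search stops, to which `good_reweighting`
applies. -/
theorem exists_reweighting {d k n J N0 K : ℕ} {L : MvPolynomial (Fin d) ℝ →ₗ[ℝ] ℝ}
    {E : (Vec d → ℝ) → ℝ} {γ δ : ℝ} (hL : BallFunctional d (k + 2) L)
    (hE : ∀ p, E (evalAt p) = L p) (hd : 0 < d) (hM : 0 < L (normSq d)) (hγ : 0 < γ)
    (hγ1 : γ ≤ 1 / 8) (hδ : 4 * γ ≤ δ) (hn : 1 ≤ n)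
    (H2 : (2 * n + 1 : ℝ) ^ (2 * d) * ((1 - 2 * γ) * ((N0 : ℝ) + d) ^ 2) ^ n ≤ (N0 : ℝ) ^ (2 * n))
    (H3 : 1 < (1 - 2 * γ) * L (normSq d) * (1 + γ ^ 2) ^ J) (H4 : 2 * (n + J) ≤ k)
    (H5 : 2 ≤ γ ^ 2 * L (normSq d) * (N0 : ℝ) ^ 2)
    (H6 : (2 * d : ℝ) ^ (n + J) ≤ 2 ^ k * L (normSq d) ^ (n + J)) (H7 : d + 1 ≤ N0)
    (hN : 2 ^ (k / d) = 2 * N0) (hkN : k ≤ 2 * N0) (hK : 4 ≤ K)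
    (hT : ∀ c < (2 * 2 ^ (k / d) + 1) ^ (d + 2), totalTime d k c ≤ 2 ^ (K * k)) :
    ∃ p : MvPolynomial (Fin d) ℝ, IsReweightingPoly k E p ∧
      (∃ g : MvPolynomial (Fin d) ℝ, p = g ^ 2 ∧ 2 * g.totalDegree ≤ k) ∧
      (∃ v : Vec d, ‖v‖ = 1 ∧ (1 - δ) * L (normSq d) ≤ L (p * linForm v) ^ 2) ∧
      (∀ α, |p.coeff α| ≤ 2 ^ (K * k)) ∧ HasFixingShape K k δ E p ∧
      FindsWithin (.seq setupProg searchProg) (2 ^ (K * k)) d k δ E p := by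
  set s0 := initialState d k δ E with hs0
  set N := 2 ^ (k / d) with hNdef
  have hinp : ∀ a, (exponent d k a).degree ≤ k + 2 →
      s0.input (a + 1) = L (monomial (exponent d k a) 1) := by
    intro a ha
    rw [hs0, initialState]
    simp [ha, hE]
  obtain ⟨ω, a, l, hω, ha, hl1, hl2, hgood⟩ :=
    exists_good hL hd hM hγ hγ1 hδ hn H2 H3 H4 H5 H6 H7
  obtain ⟨c, hc, hcω, hca, hcl⟩ := exists_code (N := N) ω a
    (fun i => by rw [hN]; exact_mod_cast hω i) (by rw [hN]; exact_mod_cast ha) hl1 (by omega)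
  have hacc : Accept d k ((1 - δ) * L (normSq d)) s0.input (candidate N c)
      (candidateExp N d c) := by
    rw [accept_iff_good hinp, hcl]
    exact hgood _ hcω hca
  have hcM : (1 - s0.input 0) * ∑ i ∈ Finset.range d, s0.input (2 * (k + 3) ^ i + 1) =
      (1 - δ) * L (normSq d) := by
    rw [input_normSq hinp]
    rfl
  have hrun : Halts (.seq setupProg searchProg) (totalTime d k c) s0 _ :=
    (halts_setupProg hd (inp := s0.input) (s := s0) (fun _ => rfl) (fun _ => rfl) rfl).seq
      fun s hs => halts_searchProg hs.1 hs.2.1 hs.2.2 c (by rw [hcM]; exact hacc)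
  obtain ⟨t, ht, s, hs, c', hc', hacc', hout⟩ := hrun
  rw [hcM, accept_iff_good hinp] at hacc'
  set w := candidate N c' with hw
  set l' := candidateExp N d c' with hl'
  have hl'1 : 1 ≤ l' := by
    rw [hl', candidateExp]
    omega
  have h4 : (N : ℝ) ^ 2 ≤ 4 ^ k := by
    have h1 : N ≤ 2 ^ k := Nat.pow_le_pow_right (by omega) (Nat.div_le_self _ _)
    have h2 : (N : ℝ) ≤ 2 ^ k := by exact_mod_cast h1
    calc (N : ℝ) ^ 2 ≤ (2 ^ k) ^ 2 := by gcongr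
      _ = 4 ^ k := by rw [← pow_mul, mul_comm, pow_mul]; norm_num
  set P := formOf d w ^ (2 * l') * (C (w d) + formOf d w) ^ 2 with hP
  obtain ⟨r1, r2, r3, r4, r5⟩ := good_reweighting hL hE hd hl'1 hK hacc'
    (fun i => candidate_eq_int _ _ _) ((candidate_sq_le N c' d).trans h4) rfl
  refine ⟨_, r1, r2, r3, r4, r5, t, ht.trans (hT c hc), s, hs, fun y hy => ?_⟩
  have hPdeg : P.totalDegree ≤ k + 2 := by
    have h1 := totalDegree_mul_le_of (totalDegree_pow_le_of (totalDegree_formOf d w) (2 * l'))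
      (totalDegree_pow_le_of (totalDegree_add_le_of (f := C (w d)) (by rw [totalDegree_C]; omega)
        (totalDegree_formOf d w)) 2)
    have := hacc'.1
    exact h1.trans (by omega)
  rw [hout y hy, mulTab_eq, ← hP, pair_tab hPdeg L _ hinp, tab_eq_coeff hPdeg hy, coeff_C_mul,
    div_eq_inv_mul]

/-! ### The running time -/

theorem stepTime_le {d k x : ℕ} (hx : 64 ≤ x) (hM : (k + 3) ^ d ≤ x) (hd : d ≤ x) :
    stepTime d k ≤ x ^ 3 := by
  unfold stepTime
  calc (k + 3) ^ d * (d * 11 + 13) + 3 ≤ x * (x * 11 + 13) + 3 := by gcongr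
    _ ≤ x ^ 3 := by
      -- With `x = 64 + z` both sides are polynomials in `z` with natural coefficients and can be
      -- compared monomial by monomial.
      obtain ⟨z, rfl⟩ := Nat.exists_eq_add_of_le hx
      ring_nf
      omega

theorem momentsTime_le {d k l x : ℕ} (hx : 64 ≤ x) (hM : (k + 3) ^ d ≤ x) (hd : d ≤ x)
    (hl : l ≤ 2 * x) : momentsTime d k l ≤ x ^ 5 := by
  have hs := stepTime_le hx hM hd
  unfold momentsTime
  calc _ ≤ (x * 6 + 3) + (x * 4 + 3) + 2 + ((2 * x + 1) * (x ^ 3 * 2 + 3) + 3) + 4 +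
        x ^ 3 + 1 + x ^ 3 + 1 + (x * 6 + 2) + 1 + x ^ 3 := by gcongr
    _ ≤ x ^ 5 := by
      obtain ⟨z, rfl⟩ := Nat.exists_eq_add_of_le hx
      ring_nf
      omega

theorem roundTime_le {d k N c x : ℕ} (hx : 64 ≤ x) (hM : (k + 3) ^ d ≤ x) (hd : d + 2 ≤ x)
    (hN : N ≤ x) (hc : c ≤ x ^ 4) : roundTime d k N c ≤ x ^ 6 := by
  have hs := momentsTime_le hx hM (by omega : d ≤ x) (by omega : 2 * N ≤ 2 * x)
  unfold roundTime
  calc _ ≤ (x * (x ^ 4 * 3 + (2 * x + 1) * 3 + 12) + 3) + (x ^ 5 + 20) + 2 := by gcongr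
    _ ≤ x ^ 6 := by
      obtain ⟨z, rfl⟩ := Nat.exists_eq_add_of_le hx
      ring_nf
      omega

theorem totalTime_le {d k c x : ℕ} (hx : 64 ≤ x) (hM : (k + 3) ^ d ≤ x) (hd : d + 2 ≤ x)
    (hk : k + 3 ≤ x) (hN : 2 ^ (k / d) ≤ x) (hc : c < x ^ 4) : totalTime d k c ≤ x ^ 11 := by
  have hs := roundTime_le hx hM hd hN hc.le
  have hc' : c + 1 ≤ x ^ 4 := hc
  unfold totalTime
  calc _ ≤ (13 + (x * (x * 3 + 9) + 2) + 2 + (x * 3 + 2) + (x * 3 + 2) + 1 +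
      (x * 4 + 1) + (x * 8 + 2) + 5) + (x ^ 4 * x ^ 6 + 1) := by
        have h1 : d ≤ x := by omega
        have h2 : k ≤ x := by omega
        gcongr
    _ ≤ x ^ 10 + x ^ 10 := by
      have h1 : (13 + (x * (x * 3 + 9) + 2) + 2 + (x * 3 + 2) + (x * 3 + 2) + 1 +
        (x * 4 + 1) + (x * 8 + 2) + 5) + 1 ≤ x ^ 3 := by
        obtain ⟨z, rfl⟩ := Nat.exists_eq_add_of_le hx
        ring_nf
        omega
      have h2 : x ^ 3 ≤ x ^ 10 := Nat.pow_le_pow_right (by omega) (by omega)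
      have h3 : x ^ 4 * x ^ 6 = x ^ 10 := by ring
      omega
    _ ≤ x ^ 11 := by
      rw [pow_succ x 10]
      have := Nat.mul_le_mul_left (x ^ 10) (by omega : 2 ≤ x)
      omega

/-- Everything is polynomial in `x = 2 ^ k`: the table has `(k + 3) ^ d ≤ 2 ^ (d (k / d)) ≤ x`
entries, and the number of candidates is at most `2 ^ ((k / d + 2) (d + 2)) ≤ x ^ 4`. -/
theorem totalTime_le_two_pow {d k c : ℕ} (hd : 2 ≤ d) (hκ : 3 ≤ k / d) (hk : k + 3 ≤ 2 ^ (k / d))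
    (hc : c < (2 * 2 ^ (k / d) + 1) ^ (d + 2)) : totalTime d k c ≤ 2 ^ (11 * k) := by
  have hkd : k / d * d ≤ k := Nat.div_mul_le_self k d
  have hκk : k / d ≤ k := Nat.div_le_self k d
  have hk6 : 6 ≤ k := by nlinarith
  have hdk : d + 2 ≤ k := by nlinarith
  have hkx : k + 3 ≤ 2 ^ k := hk.trans (Nat.pow_le_pow_right (by omega) hκk)
  rw [mul_comm, pow_mul]
  refine totalTime_le ?_ ?_ (by omega) hkx (Nat.pow_le_pow_right (by omega) hκk) ?_
  · calc 64 = 2 ^ 6 := by norm_num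
      _ ≤ 2 ^ k := Nat.pow_le_pow_right (by omega) hk6
  · calc (k + 3) ^ d ≤ (2 ^ (k / d)) ^ d := Nat.pow_le_pow_left hk d
      _ = 2 ^ (k / d * d) := by rw [pow_mul]
      _ ≤ 2 ^ k := Nat.pow_le_pow_right (by omega) hkd
  · refine lt_of_lt_of_le hc ?_
    have h1 : 2 * 2 ^ (k / d) + 1 ≤ 2 ^ (k / d + 2) := by
      rw [pow_add]
      have := Nat.one_le_two_pow (n := k / d)
      omega
    calc (2 * 2 ^ (k / d) + 1) ^ (d + 2) ≤ (2 ^ (k / d + 2)) ^ (d + 2) := Nat.pow_le_pow_left h1 _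
      _ = 2 ^ ((k / d + 2) * (d + 2)) := by rw [pow_mul]
      _ ≤ 2 ^ (k * 4) := by
        refine Nat.pow_le_pow_right (by omega) ?_
        calc (k / d + 2) * (d + 2) ≤ (2 * (k / d)) * (2 * d) := by gcongr <;> omega
          _ = 4 * (k / d * d) := by ring
          _ ≤ k * 4 := by omega
      _ = (2 ^ k) ^ 4 := by rw [pow_mul]

/-! ### The choice of the parameters -/

/-- Bernoulli gives `(1 + γ) ^ g ≥ 2`, and `(1 - γ)(1 + γ) ≤ 1`. -/
theorem one_sub_pow_le_half {γ : ℝ} (hγ : 0 < γ) (hγ1 : γ ≤ 1) {g : ℕ} (hg : 1 ≤ γ * g) :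
    (1 - γ) ^ g ≤ 1 / 2 := by
  have h1 : 2 ≤ (1 + γ) ^ g := by
    have := one_add_mul_le_pow (a := γ) (by linarith) g
    linarith
  have h2 : (1 - γ) ^ g * (1 + γ) ^ g ≤ 1 := by
    rw [← mul_pow]
    exact pow_le_one₀ (by nlinarith) (by nlinarith)
  have h3 : 0 ≤ (1 - γ) ^ g := pow_nonneg (by linarith) g
  nlinarith

/-- Exponentials beat squares. The spare `4` in the exponent later pays for a factor `2 ^ (4 b)` in
`large_moment_condition`. -/
theorem exists_sq_le_two_pow (B : ℕ) : ∃ A : ℕ, 4 ≤ A ∧ (B * A) ^ 2 ≤ 2 ^ (A - 4) := by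
  have h := (tendsto_pow_const_div_const_pow_of_one_lt 2 (r := (2 : ℝ)) (by norm_num)).eventually_le_const
    (show (0 : ℝ) < 1 / (16 * (B + 1) ^ 2) by positivity)
  obtain ⟨A, hA4, hA⟩ := ((Filter.eventually_ge_atTop 4).and h).exists
  refine ⟨A, hA4, ?_⟩
  rw [div_le_div_iff₀ (by positivity) (by positivity), one_mul] at hA
  have h1 : A ^ 2 * (16 * (B + 1) ^ 2) ≤ 2 ^ A := by exact_mod_cast hA
  have h2 : 2 ^ A = 2 ^ (A - 4) * 16 := by
    rw [show (16 : ℕ) = 2 ^ 4 by norm_num, ← pow_add, Nat.sub_add_cancel hA4]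
  rw [h2] at h1
  have h3 : (B * A) ^ 2 ≤ A ^ 2 * (B + 1) ^ 2 := by
    rw [mul_pow, mul_comm]
    gcongr
    omega
  nlinarith

/-- The gain `(1 - γ) ^ n ≤ 2 ^ (-d A b)` has to beat the loss `(2n+1)^(2d)`. As `n` contains the
factor `A` itself, `A` must satisfy the self-referential bound `hgA`. Rounding costs little because
`d ≤ (γ / 3) N0` and `(1 - 2γ)(1 + γ/3)² ≤ 1 - γ`. -/
theorem large_moment_condition {d b g A n N0 : ℕ} {γ : ℝ} (hd : 1 ≤ d) (hdb : d ≤ 2 ^ b) (hb : 1 ≤ b)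
    (hγ : 0 < γ) (hγ1 : γ ≤ 1 / 8) (hg : 1 ≤ γ * g) (hA : 4 ≤ A) (hgA : (3 * g * A) ^ 2 ≤ 2 ^ (A - 4))
    (hn : n = g * (d * (A * b))) (hN0 : 3 * (d * g) ≤ N0) :
    (2 * n + 1 : ℝ) ^ (2 * d) * ((1 - 2 * γ) * ((N0 : ℝ) + d) ^ 2) ^ n ≤ (N0 : ℝ) ^ (2 * n) := by
  have hg1 : 1 ≤ g := by
    rcases Nat.eq_zero_or_pos g with h | h
    · rw [h] at hg
      norm_num at hg
    · exact h
  have hb2 : b ≤ 2 ^ b := Nat.lt_two_pow_self.le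
  have h1 : (2 * n + 1) ^ 2 ≤ 2 ^ (A * b) := by
    calc (2 * n + 1) ^ 2 ≤ (3 * g * A * (2 ^ b * 2 ^ b)) ^ 2 := by
          refine Nat.pow_le_pow_left ?_ 2
          have h2 : 1 ≤ g * (d * (A * b)) := Nat.mul_pos hg1 (Nat.mul_pos hd (Nat.mul_pos (by omega) hb))
          calc 2 * n + 1 ≤ 3 * (g * (d * (A * b))) := by rw [hn]; linarith
            _ = 3 * g * A * (d * b) := by ring
            _ ≤ _ := by gcongr
      _ = (3 * g * A) ^ 2 * 2 ^ (4 * b) := by ring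
      _ ≤ (2 ^ (A - 4)) ^ b * 2 ^ (4 * b) := by
          exact Nat.mul_le_mul_right _ (hgA.trans (Nat.le_self_pow (by omega) _))
      _ = 2 ^ (A * b) := by
          rw [← pow_mul, ← pow_add, ← add_mul, Nat.sub_add_cancel hA]
  have h2 : (2 * n + 1 : ℝ) ^ (2 * d) ≤ 2 ^ (d * (A * b)) := by
    rw [pow_mul, mul_comm d, pow_mul]
    refine pow_le_pow_left₀ (by positivity) ?_ d
    exact_mod_cast h1
  have h3 : (1 - γ) ^ n ≤ (1 / 2 : ℝ) ^ (d * (A * b)) := by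
    rw [hn, pow_mul]
    exact pow_le_pow_left₀ (pow_nonneg (by linarith) _)
      (one_sub_pow_le_half hγ (by linarith) hg) _
  have hd0 : (0 : ℝ) ≤ d := Nat.cast_nonneg d
  have h4 : (d : ℝ) ≤ γ / 3 * N0 := by
    have h5 : (3 * (d * g) : ℝ) ≤ N0 := by exact_mod_cast hN0
    nlinarith
  have hN : (0 : ℝ) ≤ N0 := Nat.cast_nonneg N0
  have h5 : (1 - 2 * γ) * ((N0 : ℝ) + d) ^ 2 ≤ (1 - γ) * (N0 : ℝ) ^ 2 := by
    have h6 : ((N0 : ℝ) + d) ^ 2 ≤ ((1 + γ / 3) * N0) ^ 2 :=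
      pow_le_pow_left₀ (by positivity) (by linarith) 2
    calc (1 - 2 * γ) * ((N0 : ℝ) + d) ^ 2 ≤ (1 - 2 * γ) * ((1 + γ / 3) * N0) ^ 2 :=
          mul_le_mul_of_nonneg_left h6 (by linarith)
      _ = ((1 - 2 * γ) * (1 + γ / 3) ^ 2) * (N0 : ℝ) ^ 2 := by ring
      _ ≤ _ := by
          refine mul_le_mul_of_nonneg_right ?_ (by positivity)
          nlinarith [mul_pos hγ hγ, mul_pos (mul_pos hγ hγ) hγ]
  have h6 : ((1 - 2 * γ) * ((N0 : ℝ) + d) ^ 2) ^ n ≤ ((1 - γ) * (N0 : ℝ) ^ 2) ^ n :=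
    pow_le_pow_left₀ (mul_nonneg (by linarith) (by positivity)) h5 n
  calc _ ≤ 2 ^ (d * (A * b)) * ((1 - γ) * (N0 : ℝ) ^ 2) ^ n :=
        mul_le_mul h2 h6 (pow_nonneg (mul_nonneg (by linarith) (by positivity)) n) (by positivity)
    _ = 2 ^ (d * (A * b)) * (1 - γ) ^ n * (N0 : ℝ) ^ (2 * n) := by rw [mul_pow, ← pow_mul]; ring
    _ ≤ 2 ^ (d * (A * b)) * (1 / 2) ^ (d * (A * b)) * (N0 : ℝ) ^ (2 * n) := by gcongr
    _ = (N0 : ℝ) ^ (2 * n) := by rw [← mul_pow]; norm_num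

set_option maxHeartbeats 600000 in
-- The square of the logarithm comes from the size condition: `n + J` is of order `d b`, and `2 d /
-- M` is at most `2 ^ ((D + 2) b)`, so `2 ^ k` dominates `(2 d / M) ^ (n + J)` once `k` is a large
-- multiple of `d b²`.
theorem exists_parameters (C : ℝ) {δ : ℝ} (hδ : 0 < δ) : ∃ A : ℕ,
    ∀ d b k : ℕ, 3 ≤ d → d ≤ 2 ^ b → 1 ≤ b → A * b ^ 2 ≤ k / d →
    ∀ M : ℝ, (d : ℝ) ^ (-C) ≤ M → ∃ (n J N0 : ℕ) (γ : ℝ),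
      0 < M ∧ 0 < γ ∧ γ ≤ 1 / 8 ∧ 4 * γ ≤ δ ∧ 1 ≤ n ∧
      (2 * n + 1 : ℝ) ^ (2 * d) * ((1 - 2 * γ) * ((N0 : ℝ) + d) ^ 2) ^ n ≤ (N0 : ℝ) ^ (2 * n) ∧
      1 < (1 - 2 * γ) * M * (1 + γ ^ 2) ^ J ∧ 2 * (n + J) ≤ k ∧
      2 ≤ γ ^ 2 * M * (N0 : ℝ) ^ 2 ∧ (2 * d : ℝ) ^ (n + J) ≤ 2 ^ k * M ^ (n + J) ∧
      d + 1 ≤ N0 ∧ 2 ^ (k / d) = 2 * N0 ∧ 3 ≤ k / d ∧ k + 3 ≤ 2 ^ (k / d) := by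
  obtain ⟨γ, hγ, hγ1, hγδ⟩ : ∃ γ : ℝ, 0 < γ ∧ γ ≤ 1 / 8 ∧ 4 * γ ≤ δ :=
    ⟨min (1 / 8) (δ / 4), by positivity, min_le_left _ _,
      by have := min_le_right (1 / 8) (δ / 4); linarith⟩
  obtain ⟨g, hg⟩ : ∃ g : ℕ, 1 ≤ γ * g := by
    obtain ⟨g, hg⟩ := exists_nat_ge (1 / γ)
    exact ⟨g, by rwa [div_le_iff₀' hγ] at hg⟩
  obtain ⟨h, hh⟩ : ∃ h : ℕ, 1 ≤ γ ^ 2 * h := by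
    obtain ⟨h, hh⟩ := exists_nat_ge (1 / γ ^ 2)
    exact ⟨h, by rwa [div_le_iff₀' (by positivity)] at hh⟩
  obtain ⟨D, hD⟩ := exists_nat_ge C
  obtain ⟨A, hA, hgA⟩ := exists_sq_le_two_pow (3 * g)
  have hg1 : 1 ≤ g := by
    rcases Nat.eq_zero_or_pos g with h | h
    · rw [h] at hg
      norm_num at hg
    · exact h
  set B := g * A + h * (D + 1) with hB
  -- The first summand pays for the size condition through `n + J ≤ B d b`; the others make `2 ^ (k
  -- / d)` exceed `k + 3` and make `N0` large enough for the rounding.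
  refine ⟨(D + 2) * B * 2 + 12 + g + D, fun d b k hd hdb hb hκ M hM => ?_⟩
  set κ := k / d with hκdef
  have hkd : κ * d ≤ k := Nat.div_mul_le_self k d
  have hbb : b ≤ b ^ 2 := Nat.le_self_pow (by omega) b
  have hbb1 : 1 ≤ b ^ 2 := hb.trans hbb
  have hκ1 : (D + 2) * B * 2 * b ^ 2 + 12 * b ^ 2 + g * b ^ 2 + D * b ^ 2 ≤ κ := by
    refine le_trans (le_of_eq ?_) hκ
    ring
  have hgb : g ≤ g * b ^ 2 := Nat.le_mul_of_pos_right g (by omega)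
  have hDb : D * b ≤ D * b ^ 2 := Nat.mul_le_mul_left D hbb
  have hκ2 : 12 * b + g + D * b ≤ κ := by omega
  set n := g * (d * (A * b)) with hn
  set J := h * (D * b + 1) with hJ
  set N0 := 2 ^ (κ - 1) with hN0
  -- The only use of the lower bound on `M`: it is at least `d ^ (-C) ≥ 2 ^ (-D b)`.
  have hM2 : 1 ≤ 2 ^ (D * b) * M := by
    have h1 : (d : ℝ) ^ C ≤ 2 ^ (D * b) := by
      calc (d : ℝ) ^ C ≤ (d : ℝ) ^ (D : ℝ) :=
            Real.rpow_le_rpow_of_exponent_le (by exact_mod_cast (by omega : 1 ≤ d)) hD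
        _ = (d : ℝ) ^ D := Real.rpow_natCast _ _
        _ ≤ (2 ^ b) ^ D := pow_le_pow_left₀ (Nat.cast_nonneg d) (by exact_mod_cast hdb) D
        _ = 2 ^ (D * b) := by rw [← pow_mul, mul_comm]
    have hd0 : (0 : ℝ) < d := by exact_mod_cast (by omega : 0 < d)
    have h2 : 0 < (d : ℝ) ^ C := Real.rpow_pos_of_pos hd0 C
    rw [Real.rpow_neg hd0.le, inv_le_iff_one_le_mul₀' h2] at hM
    have hM0 : 0 ≤ M := by
      by_contra! hneg
      nlinarith
    exact hM.trans (mul_le_mul_of_nonneg_right h1 hM0)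
  have hMpos : 0 < M := (mul_pos_iff_of_pos_left (by positivity)).mp (lt_of_lt_of_le one_pos hM2)
  have hnJ : n + J ≤ B * (d * b) := by
    have h1 : D * b + 1 ≤ (D + 1) * (d * b) := by
      have : b ≤ d * b := Nat.le_mul_of_pos_left b (by omega)
      nlinarith
    calc n + J ≤ g * (d * (A * b)) + h * ((D + 1) * (d * b)) :=
          add_le_add le_rfl (Nat.mul_le_mul_left h h1)
      _ = B * (d * b) := by rw [hB]; ring
  have hnk : (D + 2) * b * (n + J) * 2 ≤ k := by
    calc (D + 2) * b * (n + J) * 2 ≤ (D + 2) * b * (B * (d * b)) * 2 := by gcongr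
      _ = ((D + 2) * B * 2 * b ^ 2) * d := by ring
      _ ≤ κ * d := Nat.mul_le_mul_right d (by omega)
      _ ≤ k := hkd
  have hk3 : k + 3 ≤ 2 ^ κ := by
    have h1 : k < d * (κ + 1) := Nat.lt_mul_div_succ k (by omega)
    obtain ⟨y, hy⟩ : ∃ y, κ = b + (y + 4) := ⟨κ - b - 4, by omega⟩
    have h2 : y < 2 ^ y := Nat.lt_two_pow_self
    have h3 : κ + 4 ≤ 2 ^ (y + 4) := by
      rw [pow_add]
      omega
    calc k + 3 ≤ d * (κ + 4) := by nlinarith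
      _ ≤ 2 ^ b * 2 ^ (y + 4) := Nat.mul_le_mul hdb h3
      _ = 2 ^ κ := by rw [hy, ← pow_add]
  have hN2 : 2 ^ κ = 2 * N0 := by
    rw [hN0, ← pow_succ', Nat.sub_add_cancel (by omega)]
  have hN3 : 3 * (d * g) ≤ N0 := by
    calc 3 * (d * g) ≤ 2 ^ 2 * (2 ^ b * 2 ^ g) := by
          gcongr
          · norm_num
          · exact Nat.lt_two_pow_self.le
      _ = 2 ^ (2 + (b + g)) := by rw [pow_add, pow_add]
      _ ≤ N0 := Nat.pow_le_pow_right (by omega) (by omega)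
  refine ⟨n, J, N0, γ, hMpos, hγ, hγ1, hγδ,
    Nat.mul_pos hg1 (Nat.mul_pos (by omega) (Nat.mul_pos (by omega) hb)),
    large_moment_condition (by omega) hdb hb hγ hγ1 hg hA hgA hn hN3, ?_, ?_, ?_, ?_, ?_, hN2,
    by omega, hk3⟩
  · have h1 : (2 : ℝ) ^ (D * b + 1) ≤ (1 + γ ^ 2) ^ J := by
      rw [hJ, pow_mul]
      refine pow_le_pow_left₀ (by norm_num) ?_ _
      have := one_add_mul_le_pow (a := γ ^ 2) (by nlinarith) h
      linarith
    calc (1 : ℝ) < (1 - 2 * γ) * 2 := by linarith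
      _ ≤ (1 - 2 * γ) * 2 * (2 ^ (D * b) * M) :=
          le_mul_of_one_le_right (by linarith) hM2
      _ = (1 - 2 * γ) * M * 2 ^ (D * b + 1) := by ring
      _ ≤ _ := mul_le_mul_of_nonneg_left h1 (mul_nonneg (by linarith) hMpos.le)
  · refine le_trans ?_ hnk
    have : 1 ≤ (D + 2) * b := Nat.mul_pos (by omega) hb
    rw [mul_comm]
    exact Nat.mul_le_mul_right 2 (Nat.le_mul_of_pos_left _ this)
  · have h1 : (2 : ℝ) * (g ^ 2 * 2 ^ (D * b)) ≤ (N0 : ℝ) ^ 2 := by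
      have : 2 * (g ^ 2 * 2 ^ (D * b)) ≤ N0 ^ 2 := by
        calc 2 * (g ^ 2 * 2 ^ (D * b)) ≤ 2 * ((2 ^ g) ^ 2 * 2 ^ (D * b)) := by
              gcongr
              exact Nat.lt_two_pow_self.le
          _ = 2 ^ (1 + (g * 2 + D * b)) := by rw [pow_add, pow_add, pow_mul 2 g, pow_one]
          _ ≤ 2 ^ ((κ - 1) * 2) := Nat.pow_le_pow_right (by omega) (by omega)
          _ = N0 ^ 2 := by rw [hN0, pow_mul]
      exact_mod_cast this
    have h2 : 1 ≤ (γ * g) ^ 2 := one_le_pow₀ hg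
    calc (2 : ℝ) ≤ 2 * ((γ * g) ^ 2 * (2 ^ (D * b) * M)) := by
          have := one_le_mul_of_one_le_of_one_le h2 hM2
          linarith
      _ = γ ^ 2 * M * (2 * (g ^ 2 * 2 ^ (D * b))) := by ring
      _ ≤ _ := mul_le_mul_of_nonneg_left h1 (by positivity)
  · have h1 : (2 * d : ℝ) ≤ 2 ^ ((D + 2) * b) * M := by
      have hdb' : (d : ℝ) ≤ 2 ^ b := by exact_mod_cast hdb
      calc (2 * d : ℝ) ≤ 2 ^ b * 2 ^ b := by
            have : (2 : ℝ) ≤ 2 ^ b := le_self_pow₀ (by norm_num) (by omega)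
            gcongr
        _ ≤ 2 ^ b * 2 ^ b * (2 ^ (D * b) * M) := le_mul_of_one_le_right (by positivity) hM2
        _ = 2 ^ ((D + 2) * b) * M := by ring
    calc (2 * d : ℝ) ^ (n + J) ≤ (2 ^ ((D + 2) * b) * M) ^ (n + J) := by gcongr
      _ = 2 ^ ((D + 2) * b * (n + J)) * M ^ (n + J) := by rw [mul_pow, ← pow_mul]
      _ ≤ 2 ^ k * M ^ (n + J) := by
          gcongr
          · norm_num
          · omega
  · have : d ≤ d * g := Nat.le_mul_of_pos_right d hg1
    omega

theorem exists_reweighting_of_large (C : ℝ) {δ : ℝ} (hδ : 0 < δ) : ∃ A : ℕ,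
    ∀ d b k : ℕ, 3 ≤ d → d ≤ 2 ^ b → 1 ≤ b → A * b ^ 2 ≤ k / d →
    ∀ (L : MvPolynomial (Fin d) ℝ →ₗ[ℝ] ℝ) (E : (Vec d → ℝ) → ℝ), BallFunctional d (k + 2) L →
    (∀ p, E (evalAt p) = L p) → (d : ℝ) ^ (-C) ≤ L (normSq d) →
    ∃ p : MvPolynomial (Fin d) ℝ, IsReweightingPoly k E p ∧
      (∃ g : MvPolynomial (Fin d) ℝ, p = g ^ 2 ∧ 2 * g.totalDegree ≤ k) ∧
      (∃ v : Vec d, ‖v‖ = 1 ∧ (1 - δ) * L (normSq d) ≤ L (p * linForm v) ^ 2) ∧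
      (∀ α, |p.coeff α| ≤ 2 ^ (11 * k)) ∧ HasFixingShape 11 k δ E p ∧
      FindsWithin (.seq setupProg searchProg) (2 ^ (11 * k)) d k δ E p := by
  obtain ⟨A, hA⟩ := exists_parameters C hδ
  refine ⟨A, fun d b k hd hdb hb hκ L E hL hE hM => ?_⟩
  obtain ⟨n, J, N0, γ, hMpos, hγ, hγ1, hγδ, hn, H2, H3, H4, H5, H6, H7, hN, hκ3, hk3⟩ :=
    hA d b k hd hdb hb hκ _ hM
  exact exists_reweighting hL hE (by omega) hMpos hγ hγ1 hγδ hn H2 H3 H4 H5 H6 H7 hN (by omega)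
    (by omega) fun c hc => totalTime_le_two_pow (by omega) hκ3 hk3 hc

/-- Two of the logarithms pay for `(clog d)²`. The other `j` absorb the constants including `δ`,
uniformly in `d`, because `log d ≥ log 3 > 1`. -/
theorem exists_exponent (A : ℕ) {δ : ℝ} (hδ : 0 < δ) : ∃ C' : ℕ, ∀ d : ℕ, 3 ≤ d →
    A * Nat.clog 2 d ^ 2 ≤ ⌊(d : ℝ) / δ * Real.log d ^ C'⌋₊ / d := by
  have h3 : 1 < Real.log 3 := by
    rw [Real.lt_log_iff_exp_lt (by norm_num)]
    exact Real.exp_one_lt_three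
  obtain ⟨j, hj⟩ := pow_unbounded_of_one_lt (9 * A * δ) h3
  refine ⟨j + 2, fun d hd => ?_⟩
  have hd0 : (0 : ℝ) < d := by exact_mod_cast (by omega : 0 < d)
  have hlog : Real.log 3 ≤ Real.log d :=
    Real.log_le_log (by norm_num) (by exact_mod_cast hd)
  have hb : (Nat.clog 2 d : ℝ) ≤ 3 * Real.log d := by
    have h1 : 2 ^ (Nat.clog 2 d).pred < d := Nat.pow_pred_clog_lt_self (by omega) (by omega)
    have h2 : 1 ≤ Nat.clog 2 d := Nat.clog_pos (by omega) (by omega)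
    have h4 : (2 : ℝ) ^ (Nat.clog 2 d).pred ≤ d := by exact_mod_cast h1.le
    have h5 := Real.log_le_log (by positivity) h4
    rw [Real.log_pow, Nat.pred_eq_sub_one, Nat.cast_sub h2] at h5
    have h6 := Real.log_two_gt_d9
    have h7 : (1 : ℝ) ≤ Nat.clog 2 d := by exact_mod_cast h2
    push_cast at h5
    nlinarith
  rw [← Nat.floor_div_natCast]
  refine Nat.le_floor ?_
  push_cast
  have hl1 : 0 < Real.log d := by linarith
  calc (A : ℝ) * (Nat.clog 2 d : ℝ) ^ 2 ≤ A * (3 * Real.log d) ^ 2 := by gcongr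
    _ = (9 * A * δ) * Real.log d ^ 2 / δ := by field_simp; ring
    _ ≤ Real.log d ^ j * Real.log d ^ 2 / δ := by
        have : 9 * A * δ ≤ Real.log d ^ j :=
          hj.le.trans (pow_le_pow_left₀ (by linarith) hlog j)
        gcongr
    _ = _ := by field_simp; ring

/-! ### Distributions -/

section Distribution

open MeasureTheory

variable {d : ℕ} {μ : Measure (Vec d)}

theorem continuous_evalAt (p : MvPolynomial (Fin d) ℝ) : Continuous (evalAt p) := by
  unfold evalAt
  exact (MvPolynomial.continuous_eval p).comp (by fun_prop)

theorem integrable_of_continuous {V : Type*} [NormedAddCommGroup V]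
    [SecondCountableTopology V] [IsFiniteMeasure μ] (hμ : ∀ᵐ x ∂μ, ‖x‖ ≤ 1) {F : Vec d → V}
    (hF : Continuous F) : Integrable F μ := by
  obtain ⟨b, hb⟩ := (isCompact_closedBall (0 : Vec d) 1).exists_bound_of_continuousOn
    hF.continuousOn
  refine Integrable.of_bound hF.aestronglyMeasurable b ?_
  filter_upwards [hμ] with x hx
  exact hb x (by simpa using hx)

/-- The expectation of polynomials. -/
noncomputable def expectation [IsFiniteMeasure μ] (hμ : ∀ᵐ x ∂μ, ‖x‖ ≤ 1) :
    MvPolynomial (Fin d) ℝ →ₗ[ℝ] ℝ where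
  toFun p := ∫ x, evalAt p x ∂μ
  map_add' p q := by
    rw [← integral_add (integrable_of_continuous hμ (continuous_evalAt p))
      (integrable_of_continuous hμ (continuous_evalAt q))]
    simp [evalAt]
  map_smul' c p := by
    rw [RingHom.id_apply, smul_eq_mul, ← integral_const_mul]
    simp [evalAt]

theorem ballFunctional_expectation [IsProbabilityMeasure μ] (hμ : ∀ᵐ x ∂μ, ‖x‖ ≤ 1) (m : ℕ) :
    BallFunctional d m (expectation hμ) where
  one := by simp [expectation, evalAt]
  sq_nonneg f _ := integral_nonneg fun x => by
    rw [evalAt_pow]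
    exact sq_nonneg _
  ball_nonneg f _ := by
    refine integral_nonneg_of_ae ?_
    filter_upwards [hμ] with x hx
    have h1 : evalAt (1 - ∑ i, X i ^ 2) x = 1 - ‖x‖ ^ 2 := by
      rw [← evalAt_normSq, normSq]
      simp [evalAt]
    rw [evalAt_mul, evalAt_pow, h1]
    have : ‖x‖ ^ 2 ≤ 1 := pow_le_one₀ (norm_nonneg x) hx
    exact mul_nonneg (by linarith) (sq_nonneg _)

theorem isProbabilityMeasure_reweightMeasure [IsFiniteMeasure μ] (hμ : ∀ᵐ x ∂μ, ‖x‖ ≤ 1)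
    {p : MvPolynomial (Fin d) ℝ} (hp : ∀ x, 0 ≤ evalAt p x) (h1 : ∫ x, evalAt p x ∂μ = 1) :
    IsProbabilityMeasure (reweightMeasure p μ) := by
  constructor
  rw [reweightMeasure, withDensity_apply _ MeasurableSet.univ, Measure.restrict_univ,
    ← ofReal_integral_eq_lintegral_ofReal (integrable_of_continuous hμ (continuous_evalAt p))
      (Filter.Eventually.of_forall hp), h1, ENNReal.ofReal_one]

theorem inner_integral_reweightMeasure [IsFiniteMeasure μ] (hμ : ∀ᵐ x ∂μ, ‖x‖ ≤ 1)
    {p : MvPolynomial (Fin d) ℝ} (hp : ∀ x, 0 ≤ evalAt p x) (v : Vec d) :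
    inner ℝ v (∫ x, x ∂(reweightMeasure p μ)) = expectation hμ (p * linForm v) := by
  have hm : Measurable fun x => ENNReal.ofReal (evalAt p x) :=
    (continuous_evalAt p).measurable.ennreal_ofReal
  have hpx := continuous_evalAt p
  rw [reweightMeasure, integral_withDensity_eq_integral_toReal_smul hm
    (Filter.Eventually.of_forall fun _ => ENNReal.ofReal_lt_top)]
  simp only [ENNReal.toReal_ofReal (hp _)]
  rw [← integral_inner (integrable_of_continuous hμ (by fun_prop))]
  refine integral_congr_ae (Filter.Eventually.of_forall fun x => ?_)
  simp only [inner_smul_right, evalAt_mul, evalAt_linForm]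

end Distribution

/-! ### Pseudo-distributions -/

section PseudoDistribution

variable {d : ℕ}

/-- The pseudo-expectation of polynomials. -/
noncomputable def pseudoExpectation (μ : Vec d →₀ ℝ) : MvPolynomial (Fin d) ℝ →ₗ[ℝ] ℝ where
  toFun p := pseudoExp μ (evalAt p)
  map_add' p q := by simp [pseudoExp, evalAt, mul_add, Finset.sum_add_distrib]
  map_smul' c p := by
    simp only [pseudoExp, evalAt, smul_eval, smul_eq_mul, RingHom.id_apply, Finset.mul_sum]
    exact Finset.sum_congr rfl fun x _ => by ring

theorem totalDegree_one_sub (d : ℕ) :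
    (1 - ∑ i, X i ^ 2 : MvPolynomial (Fin d) ℝ).totalDegree ≤ 2 :=
  (totalDegree_sub _ _).trans (max_le (by rw [totalDegree_one]; omega) (totalDegree_normSq d))

theorem pseudoExp_congr {μ : Vec d →₀ ℝ} {p : MvPolynomial (Fin d) ℝ} {F : Vec d → ℝ}
    (h : ∀ x, F x = evalAt p x) : pseudoExp μ F = pseudoExpectation μ p := by
  rw [funext h]
  rfl

theorem IsPseudoDistributionOnBall.ballFunctional {D m : ℕ} {μ : Vec d →₀ ℝ}
    (hμ : IsPseudoDistributionOnBall D μ) (hm : m ≤ D) :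
    BallFunctional d m (pseudoExpectation μ) where
  one := by
    rw [← hμ.1.1]
    exact (pseudoExp_congr fun x => by simp [evalAt]).symm
  sq_nonneg f hf := by
    rw [← pseudoExp_congr fun x => (evalAt_pow f 2 x).symm]
    exact hμ.1.2 f (hf.trans hm)
  ball_nonneg f hf := by
    rw [← pseudoExp_congr (F := fun x => evalAt (1 - ∑ i, X i ^ 2) x * evalAt f x ^ 2)
      fun x => by rw [evalAt_mul, evalAt_pow]]
    exact hμ.2 f ((Nat.add_le_add_right (totalDegree_one_sub d) _).trans (hf.trans hm))

theorem pseudoExp_reweight {V : Type*} [AddCommGroup V] [Module ℝ V]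
    (p : MvPolynomial (Fin d) ℝ) (μ : Vec d →₀ ℝ) (F : Vec d → V) :
    pseudoExp (reweight p μ) F = pseudoExp μ (fun x => evalAt p x • F x) := by
  have hs : (reweight p μ).support ⊆ μ.support := Finsupp.support_onFinset_subset
  rw [pseudoExp, pseudoExp, Finset.sum_subset hs]
  · refine Finset.sum_congr rfl fun x _ => ?_
    rw [smul_smul, mul_comm (μ x)]
    rfl
  · intro x _ hx
    rw [Finsupp.notMem_support_iff.mp hx, zero_smul]

theorem inner_pseudoExp_reweight (p : MvPolynomial (Fin d) ℝ) (μ : Vec d →₀ ℝ) (v : Vec d) :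
    inner ℝ v (pseudoExp (reweight p μ) fun x => x) = pseudoExpectation μ (p * linForm v) := by
  rw [pseudoExp_reweight, pseudoExp, inner_sum]
  refine Finset.sum_congr rfl fun x _ => ?_
  rw [inner_smul_right, inner_smul_right, evalAt_mul, evalAt_linForm, smul_eq_mul]

/-- For `p = g²`, testing the reweighted functional on `f²` is testing the original one on `(g f)²`;
this uses up the degree `2 deg g ≤ k`. -/
theorem IsPseudoDistributionOnBall.reweight_sq {D k : ℕ} {μ : Vec d →₀ ℝ}
    (hμ : IsPseudoDistributionOnBall D μ) (hkD : k + 2 ≤ D) {g : MvPolynomial (Fin d) ℝ}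
    (hg : 2 * g.totalDegree ≤ k) (h1 : pseudoExp μ (evalAt (g ^ 2)) = 1) :
    IsPseudoDistributionOnBall (D - k) (reweight (g ^ 2) μ) := by
  have hdeg : ∀ f : MvPolynomial (Fin d) ℝ, (g * f).totalDegree ≤ g.totalDegree + f.totalDegree :=
    fun f => totalDegree_mul _ _
  refine ⟨⟨?_, fun f hf => ?_⟩, fun f hf => ?_⟩
  · rw [pseudoExp_reweight]
    simpa using h1
  · rw [pseudoExp_reweight]
    have := hμ.1.2 (g * f) (by have := hdeg f; omega)
    simpa only [evalAt_mul, evalAt_pow, mul_pow, smul_eq_mul] using this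
  · rw [pseudoExp_reweight]
    have := hμ.2 (g * f) (by have := hdeg f; omega)
    simpa only [evalAt_mul, evalAt_pow, mul_pow, smul_eq_mul, mul_left_comm] using this

end PseudoDistribution

/-! ### Assembling the two cases -/

theorem le_norm_sq {d : ℕ} {v y : Vec d} (hv : ‖v‖ = 1) : inner ℝ v y ^ 2 ≤ ‖y‖ ^ 2 := by
  have h1 := abs_real_inner_le_norm v y
  rw [hv, one_mul] at h1
  rw [← sq_abs]
  exact pow_le_pow_left₀ (abs_nonneg _) h1 2

end SubspaceFixing

theorem lemma5p4 :
    ∃ (P : SubspaceFixing.Program) (K : ℕ), ∀ C : ℝ, 1 ≤ C → ∀ δ : ℝ, 0 < δ →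
      ∃ C' : ℕ, ∀ d : ℕ, 3 ≤ d → ∀ k : ℕ, k = ⌊(d : ℝ) / δ * Real.log d ^ C'⌋₊ →
        -- distributions over the unit ball
        (∀ μ : MeasureTheory.Measure (SubspaceFixing.Vec d),
          MeasureTheory.IsProbabilityMeasure μ →
          (∀ᵐ x ∂μ, ‖x‖ ≤ 1) →
          (d : ℝ) ^ (-C) ≤ ∫ x, ‖x‖ ^ 2 ∂μ →
          ∃ p : MvPolynomial (Fin d) ℝ,
            SubspaceFixing.IsReweightingPoly k (fun F => ∫ x, F x ∂μ) p ∧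
            MeasureTheory.IsProbabilityMeasure (SubspaceFixing.reweightMeasure p μ) ∧
            (1 - δ) * ∫ x, ‖x‖ ^ 2 ∂μ ≤
              ‖∫ x, x ∂(SubspaceFixing.reweightMeasure p μ)‖ ^ 2 ∧
            (∀ α, |p.coeff α| ≤ 2 ^ (K * k)) ∧
            SubspaceFixing.HasFixingShape K k δ (fun F => ∫ x, F x ∂μ) p ∧
            SubspaceFixing.FindsWithin P (2 ^ (K * k)) d k δ (fun F => ∫ x, F x ∂μ) p) ∧
        -- pseudo-distributions over the unit ball
        (∀ D : ℕ, k + 2 ≤ D → ∀ μ : SubspaceFixing.Vec d →₀ ℝ,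
          SubspaceFixing.IsPseudoDistributionOnBall D μ →
          (d : ℝ) ^ (-C) ≤ SubspaceFixing.pseudoExp μ (fun x => ‖x‖ ^ 2) →
          ∃ p : MvPolynomial (Fin d) ℝ,
            SubspaceFixing.IsReweightingPoly k (SubspaceFixing.pseudoExp μ) p ∧
            SubspaceFixing.IsPseudoDistributionOnBall (D - k) (SubspaceFixing.reweight p μ) ∧
            (1 - δ) * SubspaceFixing.pseudoExp μ (fun x => ‖x‖ ^ 2) ≤
              ‖SubspaceFixing.pseudoExp (SubspaceFixing.reweight p μ) (fun x => x)‖ ^ 2 ∧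
            (∀ α, |p.coeff α| ≤ 2 ^ (K * k)) ∧
            SubspaceFixing.HasFixingShape K k δ (SubspaceFixing.pseudoExp μ) p ∧
            SubspaceFixing.FindsWithin P (2 ^ (K * k)) d k δ (SubspaceFixing.pseudoExp μ) p) := by
  refine ⟨.seq SubspaceFixing.setupProg SubspaceFixing.searchProg, 11, fun C _ δ hδ => ?_⟩
  obtain ⟨A, hA⟩ := SubspaceFixing.exists_reweighting_of_large C hδ
  obtain ⟨C', hC'⟩ := SubspaceFixing.exists_exponent A hδ
  refine ⟨C', fun d hd k hk => ?_⟩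
  -- The parameter `b` is the base-two logarithm rounded up, so that `d ≤ 2 ^ b`.
  have hlarge := hA d (Nat.clog 2 d) k hd (Nat.le_pow_clog (by omega) d)
    (Nat.clog_pos (by omega) (by omega)) (by rw [hk]; exact hC' d hd)
  refine ⟨fun μ _ hμ hM => ?_, fun D hD μ hμ hM => ?_⟩
  · have hn : ∫ x, ‖x‖ ^ 2 ∂μ = SubspaceFixing.expectation hμ (SubspaceFixing.normSq d) :=
      MeasureTheory.integral_congr_ae
        (Filter.Eventually.of_forall fun x => (SubspaceFixing.evalAt_normSq x).symm)
    obtain ⟨p, h1, ⟨g, hg, _⟩, ⟨v, hv, hvp⟩, h4, h5, h6⟩ :=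
      hlarge (SubspaceFixing.expectation hμ) (fun F => ∫ x, F x ∂μ)
        (SubspaceFixing.ballFunctional_expectation hμ _) (fun _ => rfl) (hn ▸ hM)
    have hp : ∀ x, 0 ≤ SubspaceFixing.evalAt p x := fun x => by
      rw [hg, SubspaceFixing.evalAt_pow]
      exact sq_nonneg _
    refine ⟨p, h1, SubspaceFixing.isProbabilityMeasure_reweightMeasure hμ hp h1.2.2, ?_, h4, h5, h6⟩
    rw [hn]
    -- The value of `L` at `p ⟨v, x⟩` is the component of the new mean along the unit vector `v`, so
    -- its square is at most the squared norm of the mean.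
    rw [← SubspaceFixing.inner_integral_reweightMeasure hμ hp] at hvp
    exact hvp.trans (SubspaceFixing.le_norm_sq hv)
  · have hn : SubspaceFixing.pseudoExp μ (fun x => ‖x‖ ^ 2) =
        SubspaceFixing.pseudoExpectation μ (SubspaceFixing.normSq d) :=
      SubspaceFixing.pseudoExp_congr fun x => (SubspaceFixing.evalAt_normSq x).symm
    obtain ⟨p, h1, ⟨g, hg, hgd⟩, ⟨v, hv, hvp⟩, h4, h5, h6⟩ :=
      hlarge (SubspaceFixing.pseudoExpectation μ) (SubspaceFixing.pseudoExp μ)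
        (hμ.ballFunctional hD) (fun _ => rfl) (hn ▸ hM)
    refine ⟨p, h1, ?_, ?_, h4, h5, h6⟩
    · rw [hg]
      exact hμ.reweight_sq hD hgd (hg ▸ h1.2.2)
    · rw [hn]
      rw [← SubspaceFixing.inner_pseudoExp_reweight] at hvp
      exact hvp.trans (SubspaceFixing.le_norm_sq hv)
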